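/- **Setup.** Let $G$ be a connected reductive group with maximal torus $T$, character lattice $X$, a choice of simple roots, and Weyl group $W$. Let $V=\bigoplus_{c\in\kappa}V_c$ be a representation of $G$ (split into simple summands; only the Weyl-invariance of the weights of each $V_c$ is used), with weights $\varphi_1,\dots,\varphi_d\in X$ listed with multiplicity; let $c(i)$ be the summand containing $\varphi_i$ and write $i\sim j$ if $c(i)=c(j)$. Let $\epsilon_c\in(-1,0)$ for $c\in\kappa$, and put $\epsilon_i=\epsilon_{c(i)}$. A flavor is a vector $k=(k_c)_{c\in\kappa}$ (the weights of a $\mathbb C^*$ commuting with $G$ on the $V_c$). Let $\Phi$ be either $\mathbb R^\kappa$ ("all flavors") or $\{n\}$ for one integral flavor $n\in\mathbb Z^\kappa$. In $\mathfrak t_{\mathbb R}\times\Phi$ consider the matter hyperplanes $H_i=\{(\gamma,k):\varphi_i(\gamma)+k_{c(i)}=\epsilon_i\}$ and the Coxeter hyperplanes $h_\alpha=\{\alpha(\gamma)=0\}$, $\alpha$ a root. Assume that $\epsilon$ is generic in the sense that $\emptyset\ne H_i\cap h_\alpha\subseteq H_j$ implies $i\sim j$ (automatic if $\Phi=\mathbb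 R^\kappa$). For $\sigma\in\{+,-\}^d$ let $C'_\sigma$ be the set of points of $\mathfrak t_{\mathbb R}\times\Phi$ at which $\varphi_i(\gamma)+k_{c(i)}-\epsilon_i$ is positive if $\sigma_i=+$ and negative if $\sigma_i=-$, let $C'_{\sigma,1}$ be its intersection with the open positive Weyl chamber, and $C'_{w\sigma,w}=w\cdot C'_{\sigma,1}$. Let $I'$ be the set of $\sigma$ such that $C'_{\sigma,1}$ contains a point with integral flavor. For a simple root $\alpha$, write $s_\alpha\sigma=\sigma$ if $s_\alpha C'_\sigma=C'_\sigma$. Let $\Bbbk$ be a field in which no simple root becomes $0$ in $\mathfrak t^*=\Bbbk\otimes X$; let $S=\operatorname{Sym}(\mathfrak t^*)$ and $\partial_\alpha(f)=(s_\alpha f-f)/\alpha$. Let $\varphi(\sigma,\sigma',\sigma'')$ be the product of the $\varphi_i$ with $\sigma_i=\sigma''_i=-\sigma'_i$. The $\Bbbk$-linear category $A_{I'}$ has objects $\sigma\in I'$; its morphisms are generated by an action of the algebra $S$ on each object, by $\mathbb w(\sigma,\sigma')\colon\sigma'\to\sigma$, and by $\psi_\alpha(\sigma)\colon\sigma\to\sigma$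 for simple roots $\alpha$ with $s_\alpha\sigma=\sigma$, subject to the relations: 1. $\mathbb w(\sigma,\sigma)=1$, $\ \mathbb w(\sigma,\sigma')\mathbb w(\sigma',\sigma'')=\varphi(\sigma,\sigma',\sigma'')\mathbb w(\sigma,\sigma'')$, $\ \mu\,\mathbb w(\sigma,\sigma')=\mathbb w(\sigma,\sigma')\mu$ for $\mu\in\mathfrak t^*$; 2. $\psi_\alpha(\sigma)^2=0$, $\ \psi_\alpha(\sigma)\mu-(s_\alpha\mu)\psi_\alpha(\sigma)=\partial_\alpha(\mu)$ for $\mu\in\mathfrak t^*$; 3. the braid relation $\psi_\alpha(\sigma)\psi_\beta(\sigma)\cdots=\psi_\beta(\sigma)\psi_\alpha(\sigma)\cdots$ with $m$ factors on each side, $m$ the order of $s_\alpha s_\beta$, if $s_\alpha\sigma=s_\beta\sigma=\sigma$; 4. for a simple root $\alpha$ and a point $y$ of the closed positive Weyl chamber lying on $H_j\cap h_\alpha$, on no other Coxeter hyperplane, and on no matter hyperplane not containing $H_j\cap h_\alpha$: let $\rho,\tau\in I'$ be the chambers adjacent to $y$ (i.e. with $y\in\overline{C'_{\rho,1}}$,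 $y\in\overline{C'_{\tau,1}}$) on the positive, resp. negative, side of all matter hyperplanes through $y$, and let $\sigma,\sigma'\in I'$ be adjacent to $y$ such that $C'_{\sigma,1}$ and $s_\alpha C'_{\sigma',1}$ are separated by all hyperplanes through $y$; then $$\mathbb w(\sigma',\tau)\psi_\alpha(\tau)\mathbb w(\tau,\sigma)=\mathbb w(\sigma',\rho)\psi_\alpha(\rho)\mathbb w(\rho,\sigma)-\partial_\alpha\Big(\prod\varphi_i\Big)\mathbb w(\sigma',\sigma),$$ the product being over the $i$ with $y\in H_i$ and $\sigma_i=\sigma'_i=-$. For $\sigma,\sigma'\in I'$ and $w\in W$ choose a path (crossing one hyperplane at a time) from $C'_{\sigma',1}$ to $C'_{w\sigma,w}$ that crosses a minimal number of hyperplanes, and fold it into the positive Weyl chamber: each time it leaves this chamber, apply the corresponding simple reflection to the remainder of the path. If the reflections are in the simple roots $\beta_1,\dots,\beta_p$, taking place in the chambers $\sigma_1,\dots,\sigma_p$, put $$\tilde{\mathbb w}(\sigma,\sigma',w)=\mathbb w(\sigma,\sigma_p)\psi_{\beta_p}(\sigma_p)\mathbb w(\sigma_p,\sigma_{p-1})\cdots\psi_{\beta_1}(\sigma_1)\mathbb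 w(\sigma_1,\sigma').$$ **Theorem.** For all $\sigma,\sigma'\in I'$ and every $w\in W$ such paths and foldings exist, and for every choice of them the elements $\tilde{\mathbb w}(\sigma,\sigma',w)$, $w\in W$, form a basis of $\operatorname{Hom}_{A_{I'}}(\sigma',\sigma)$ as a right $S$-module. -/

import Mathlib

open CategoryTheory
open scoped TensorProduct

noncomputable section

namespace Steinberg

/-- The combinatorial data of a connected reductive group `G` (a reduced root datum with character
lattice `X`, cocharacter lattice `Y` and a choice of simple roots) and of a representation `V` of
`G` split into summands indexed by `κ`.  `weight i` are the weights of `V` with multiplicity,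
`cls i` is the summand in which the weight `i` occurs (so `i ∼ j` means `cls i = cls j`), and the
weights of every summand are stable under the Weyl group, with multiplicity.  `ε` is the shift
`ε_i ∈ (-1, 0)` of the matter hyperplanes, constant on each summand. -/
structure GaugeData (R X Y ι κ : Type*) [AddCommGroup X] [AddCommGroup Y] where
  roots : RootPairing R ℤ X Y
  reduced : roots.IsReduced
  base : roots.Base
  weight : ι → X
  cls : ι → κ
  weyl_stable : ∀ a : R, ∃ p : Equiv.Perm ι, ∀ i,
    cls (p i) = cls i ∧ weight (p i) = roots.reflection a (weight i)
  ε : κ → ℝ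
  ε_mem : ∀ c, ε c ∈ Set.Ioo (-1 : ℝ) 0

variable {R X Y ι κ : Type*} [AddCommGroup X] [AddCommGroup Y]

namespace GaugeData

variable (D : GaugeData R X Y ι κ)

/-! ### The arrangement -/

variable (X κ) in
/-- A point is a real cocharacter `γ ∈ 𝔱_ℝ = Hom(X, ℝ)` together with a real flavor: with flavor
`k`, the group `𝕋` acts on the summand `c` of `V` with weight `k c`.  So `(γ, k)` is the real lift
on which the `i`-th weight of `V` takes the value `γ(weight i) + k (cls i)`. -/
abbrev Point : Type _ := (X →ₗ[ℤ] ℝ) × (κ → ℝ)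

/-- The Weyl group acts on points through `𝔱_ℝ`. -/
def act (g : X ≃ₗ[ℤ] X) (x : Point X κ) : Point X κ :=
  (x.1 ∘ₗ (g.symm : X →ₗ[ℤ] X), x.2)

/-- The action of an element of the Weyl group on points. -/
def weylAct (w : D.roots.weylGroup) (x : Point X κ) : Point X κ :=
  act (RootPairing.Equiv.weightHom D.roots (w : RootPairing.Aut D.roots)) x

/-- The value of a root at a point. -/
def rootVal (a : R) (x : Point X κ) : ℝ := x.1 (D.roots.root a)

/-- The function `φ_i - ε_i` on points. -/
def matterVal (i : ι) (x : Point X κ) : ℝ :=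
  x.1 (D.weight i) + x.2 (D.cls i) - D.ε (D.cls i)

/-- The set `Φ` of flavors under consideration being given, the matter hyperplane `H_i`. -/
def matterHyp (Φ : Set (κ → ℝ)) (i : ι) : Set (Point X κ) :=
  {x | x.2 ∈ Φ ∧ D.matterVal i x = 0}

/-- The Coxeter hyperplane of a root. -/
def coxHyp (Φ : Set (κ → ℝ)) (a : R) : Set (Point X κ) :=
  {x | x.2 ∈ Φ ∧ D.rootVal a x = 0}

/-- The genericity of `ε`: if a matter hyperplane meets a Coxeter hyperplane, then the intersection
lies in no matter hyperplanes other than those belonging to the same summand. -/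
def Generic (Φ : Set (κ → ℝ)) : Prop :=
  ∀ (i j : ι) (a : R), (D.matterHyp Φ i ∩ D.coxHyp Φ a).Nonempty →
    D.matterHyp Φ i ∩ D.coxHyp Φ a ⊆ D.matterHyp Φ j → D.cls i = D.cls j

/-- The open positive Weyl chamber. -/
def Dominant (x : Point X κ) : Prop := ∀ a ∈ D.base.support, 0 < D.rootVal a x

/-- The chamber `C'_σ`; the signs `+` and `-` are written `true` and `false`. -/
def chamber (Φ : Set (κ → ℝ)) (σ : ι → Bool) : Set (Point X κ) :=
  {x | x.2 ∈ Φ ∧ ∀ i, if σ i then 0 < D.matterVal i x else D.matterVal i x < 0}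

/-- The chamber `C'_{σ,1}`: the part of `C'_σ` in the open positive Weyl chamber. -/
def posChamber (Φ : Set (κ → ℝ)) (σ : ι → Bool) : Set (Point X κ) :=
  {x | x ∈ D.chamber Φ σ ∧ D.Dominant x}

/-- `s_a · C'_σ = C'_σ`, that is `s_a · σ = σ`. -/
def Stable (Φ : Set (κ → ℝ)) (a : R) (σ : ι → Bool) : Prop :=
  act (D.roots.reflection a) '' D.chamber Φ σ = D.chamber Φ σ

/-- The set `I'`: the sign vectors with `C'_{σ,1} ≠ ∅` for some (integral) flavor in `Φ`. -/
@[ext] structure Obj (Φ : Set (κ → ℝ)) where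
  sgn : ι → Bool
  feasible : ∃ n : κ → ℤ, (fun c => (n c : ℝ)) ∈ Φ ∧
    ∃ γ : X →ₗ[ℤ] ℝ, (γ, fun c => (n c : ℝ)) ∈ D.posChamber Φ sgn

/-! ### The ring `S = Sym(𝔱^*)` and Demazure operators -/

section Sym

variable (𝕜 : Type*) [Field 𝕜] (X)

/-- `S = Sym(𝔱^*)` with `𝔱^* = 𝕜 ⊗ X`. -/
abbrev Sym : Type _ := SymmetricAlgebra 𝕜 (𝕜 ⊗[ℤ] X)

variable {X}

/-- The image in `S` of a character. -/
def charS (χ : X) : Sym X 𝕜 := SymmetricAlgebra.ι 𝕜 (𝕜 ⊗[ℤ] X) (1 ⊗ₜ[ℤ] χ)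

/-- The action on `S` of an automorphism of the character lattice. -/
def actS (g : X ≃ₗ[ℤ] X) : Sym X 𝕜 →ₐ[𝕜] Sym X 𝕜 :=
  SymmetricAlgebra.lift
    (SymmetricAlgebra.ι 𝕜 (𝕜 ⊗[ℤ] X) ∘ₗ (g : X →ₗ[ℤ] X).baseChange 𝕜)

lemma actS_char_sub (a : R) (f : Sym X 𝕜) :
    charS 𝕜 (D.roots.root a) ∣ actS 𝕜 (D.roots.reflection a) f - f := by
  induction f using SymmetricAlgebra.induction with
  | algebraMap r => simp
  | ι x =>
    induction x using TensorProduct.induction_on with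
    | zero => simp
    | add x y hx hy =>
      have h := dvd_add hx hy
      simp only [map_add]
      convert h using 1
      ring
    | tmul r χ =>
      refine ⟨algebraMap 𝕜 _ (-(D.roots.coroot' a χ : ℤ) * r), ?_⟩
      simp only [actS, charS, SymmetricAlgebra.lift_ι_apply, LinearMap.comp_apply,
        LinearMap.baseChange_tmul, ← map_sub, LinearEquiv.coe_coe]
      have e : D.roots.reflection a χ = χ - (D.roots.coroot' a χ) • D.roots.root a := rfl
      rw [e, mul_comm, ← Algebra.smul_def, ← map_smul (SymmetricAlgebra.ι 𝕜 (𝕜 ⊗[ℤ] X))]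
      congr 1
      rw [TensorProduct.tmul_sub, sub_sub_cancel_left, TensorProduct.tmul_smul,
        TensorProduct.smul_tmul', TensorProduct.smul_tmul', ← TensorProduct.neg_tmul]
      congr 1
      simp
  | mul f g hf hg =>
    have h := dvd_add (hf.mul_right (actS 𝕜 (D.roots.reflection a) g)) (hg.mul_left f)
    simp only [map_mul]
    convert h using 1
    ring
  | add f g hf hg =>
    have h := dvd_add hf hg
    simp only [map_add]
    convert h using 1
    ring

/-- The BGG-Demazure operator `∂_a f = (s_a f - f) / a` on `S`. -/
def demazure (a : R) (f : Sym X 𝕜) : Sym X 𝕜 := (D.actS_char_sub 𝕜 a f).choose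

lemma demazure_spec (a : R) (f : Sym X 𝕜) :
    actS 𝕜 (D.roots.reflection a) f - f = charS 𝕜 (D.roots.root a) * D.demazure 𝕜 a f :=
  (D.actS_char_sub 𝕜 a f).choose_spec

end Sym

/-! ### The category `A_{I'}` -/

section Category

variable (Φ : Set (κ → ℝ)) (𝕜 : Type*) [Field 𝕜]

/-- The generating morphisms of `A_{I'}`. -/
inductive Gen : D.Obj Φ → D.Obj Φ → Type _
  | poly (σ : D.Obj Φ) (f : Sym X 𝕜) : Gen σ σ
  | wall (σ σ' : D.Obj Φ) : Gen σ' σ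
  | psi (a : D.base.support) (σ : D.Obj Φ) (h : D.Stable Φ a σ.sgn) : Gen σ σ

/-- The vertices of the quiver of generators. -/
@[nolint unusedArguments]
def Vertex (_ : Type*) : Type _ := D.Obj Φ

instance : Quiver (D.Vertex Φ 𝕜) := ⟨D.Gen Φ 𝕜⟩

/-- The free `𝕜`-linear category on the generators. -/
abbrev FreeCat : Type _ := Free 𝕜 (Paths (D.Vertex Φ 𝕜))

variable {D Φ}

/-- An object of the free category. -/
def fob (σ : D.Obj Φ) : D.FreeCat Φ 𝕜 := σ

/-- A generator as a morphism of the free category. -/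
def fgen {σ τ : D.Obj Φ} (g : D.Gen Φ 𝕜 σ τ) : fob 𝕜 σ ⟶ fob 𝕜 τ :=
  (Free.embedding 𝕜 (Paths (D.Vertex Φ 𝕜))).map ((Paths.of (D.Vertex Φ 𝕜)).map g)

/-- The generator `f : σ → σ` for `f ∈ S`. -/
def fpoly (σ : D.Obj Φ) (f : Sym X 𝕜) : fob 𝕜 σ ⟶ fob 𝕜 σ := fgen 𝕜 (.poly σ f)

/-- The generator `𝕨(σ,σ') : σ' → σ`. -/
def fwall (σ σ' : D.Obj Φ) : fob 𝕜 σ' ⟶ fob 𝕜 σ := fgen 𝕜 (.wall σ σ')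

/-- The generator `ψ_a(σ) : σ → σ`. -/
def fpsi (a : D.base.support) (σ : D.Obj Φ) (h : D.Stable Φ a σ.sgn) : fob 𝕜 σ ⟶ fob 𝕜 σ :=
  fgen 𝕜 (.psi a σ h)

variable (D) in
/-- The product of the weights `φ_i`, with multiplicity, over the indices `i` satisfying `p`. -/
def weightProd [Finite ι] (p : ι → Prop) : Sym X 𝕜 :=
  ∏ i ∈ (Set.toFinite {i | p i}).toFinset, charS 𝕜 (D.weight i)

/-- `φ(σ,σ',σ'')`: the product of the `φ_i` with `σ_i = σ''_i = -σ'_i`. -/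
def tripleProd [Finite ι] (σ σ' σ'' : D.Obj Φ) : Sym X 𝕜 :=
  D.weightProd 𝕜 fun i => σ.sgn i = σ''.sgn i ∧ σ'.sgn i ≠ σ.sgn i

/-- The alternating product `f g f g ⋯` with `n` factors. -/
def altProd {C : Type*} [Category C] {c : C} (f g : End c) : ℕ → End c
  | 0 => 1
  | n + 1 => f * altProd g f n

variable (D) in
/-- The Coxeter number `m` of two simple roots: the order of `s_a s_b`. -/
def coxeterM (a b : D.base.support) : ℕ :=
  orderOf (D.roots.reflection a * D.roots.reflection b)

variable (D Φ) in
/-- `y` is a point of the closed positive Weyl chamber which lies on the codimension 2 intersection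
`H_j ∩ h_a` and is generic on it: `h_a` is the only Coxeter hyperplane through `y`, and every matter
hyperplane through `y` contains `H_j ∩ h_a`. -/
structure IsMixedPoint (a : D.base.support) (j : ι) (y : Point X κ) : Prop where
  mem_matter : y ∈ D.matterHyp Φ j
  mem_cox : y ∈ D.coxHyp Φ a
  pos : ∀ b : D.base.support, b ≠ a → 0 < D.rootVal b y
  codim_two : ∀ i, D.matterVal i y = 0 → D.matterHyp Φ j ∩ D.coxHyp Φ a ⊆ D.matterHyp Φ i

/-- `y` lies in the closure of `C'_{σ,1}` (for `y` in the closed positive Weyl chamber): the signs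
of `σ` are right for all the matter hyperplanes which do not contain `y`. -/
def AdjacentTo (σ : D.Obj Φ) (y : Point X κ) : Prop :=
  ∀ i, D.matterVal i y ≠ 0 → (σ.sgn i = true ↔ 0 < D.matterVal i y)

/-- For `σ`, `σ'` adjacent to a point `y` of the Coxeter hyperplane of `a`: seen from `y`, the
chambers `C'_{σ,1}` and `s_a · C'_{σ',1}` are opposite, i.e. separated by all the
hyperplanes through `y`. -/
def OppositeAt (a : D.base.support) (y : Point X κ) (σ σ' : D.Obj Φ) : Prop :=
  ∀ i i', D.matterVal i y = 0 → D.cls i' = D.cls i →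
    D.weight i' = D.roots.reflection a (D.weight i) → σ'.sgn i' = !σ.sgn i

variable (D Φ) in
/-- The defining relations of `A_{I'}`.  The composite written `f g` in mathematical notation
(first `g`, then `f`) is `g ≫ f`.  No relation has to be listed for the intersections of two matter
hyperplanes: `𝕨(π,ρ) 𝕨(ρ,σ) = 𝕨(π,τ) 𝕨(τ,σ)` is a case of `wall_wall`, both sides being
`𝕨(π,σ)`. -/
inductive BasicRel [Finite ι] : HomRel (D.FreeCat Φ 𝕜)
  /- `f ↦ f` is an action of the `𝕜`-algebra `S` on each object. -/
  | poly_algebraMap (σ : D.Obj Φ) (r : 𝕜) :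
      BasicRel (fpoly 𝕜 σ (algebraMap 𝕜 _ r)) (r • 𝟙 (fob 𝕜 σ))
  | poly_add (σ : D.Obj Φ) (f g : Sym X 𝕜) :
      BasicRel (fpoly 𝕜 σ (f + g)) (fpoly 𝕜 σ f + fpoly 𝕜 σ g)
  | poly_mul (σ : D.Obj Φ) (f g : Sym X 𝕜) :
      BasicRel (fpoly 𝕜 σ (f * g)) (fpoly 𝕜 σ g ≫ fpoly 𝕜 σ f)
  /- Crossing no wall is the identity. -/
  | wall_self (σ : D.Obj Φ) : BasicRel (fwall 𝕜 σ σ) (𝟙 (fob 𝕜 σ))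
  /- `𝕨(σ,σ') 𝕨(σ',σ'') = φ(σ,σ',σ'') 𝕨(σ,σ'')`. -/
  | wall_wall (σ σ' σ'' : D.Obj Φ) :
      BasicRel (fwall 𝕜 σ' σ'' ≫ fwall 𝕜 σ σ')
        (fwall 𝕜 σ σ'' ≫ fpoly 𝕜 σ (tripleProd 𝕜 σ σ' σ''))
  /- `μ 𝕨(σ,σ') = 𝕨(σ,σ') μ`. -/
  | wall_poly (σ σ' : D.Obj Φ) (μ : 𝕜 ⊗[ℤ] X) :
      BasicRel (fwall 𝕜 σ σ' ≫ fpoly 𝕜 σ (SymmetricAlgebra.ι 𝕜 _ μ))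
        (fpoly 𝕜 σ' (SymmetricAlgebra.ι 𝕜 _ μ) ≫ fwall 𝕜 σ σ')
  /- `ψ_a(σ)² = 0`. -/
  | psi_sq (a : D.base.support) (σ : D.Obj Φ) (h : D.Stable Φ a σ.sgn) :
      BasicRel (fpsi 𝕜 a σ h ≫ fpsi 𝕜 a σ h) 0
  /- `ψ_a(σ) μ - (s_a μ) ψ_a(σ) = ∂_a(μ)`. -/
  | psi_poly (a : D.base.support) (σ : D.Obj Φ) (h : D.Stable Φ a σ.sgn) (μ : 𝕜 ⊗[ℤ] X) :
      BasicRel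
        (fpoly 𝕜 σ (SymmetricAlgebra.ι 𝕜 _ μ) ≫ fpsi 𝕜 a σ h -
          fpsi 𝕜 a σ h ≫
            fpoly 𝕜 σ (actS 𝕜 (D.roots.reflection a) (SymmetricAlgebra.ι 𝕜 _ μ)))
        (fpoly 𝕜 σ (D.demazure 𝕜 a (SymmetricAlgebra.ι 𝕜 _ μ)))
  /- Two Coxeter hyperplanes: the braid relation.  (If `s_a` and `s_b` both fix `σ`, then
  `h_a ∩ h_b` does contain a face of `C'_{σ,1}`.) -/
  | coxeter (a b : D.base.support) (σ : D.Obj Φ) (ha : D.Stable Φ a σ.sgn)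
      (hb : D.Stable Φ b σ.sgn) :
      BasicRel
        (altProd (c := fob 𝕜 σ) (fpsi 𝕜 a σ ha) (fpsi 𝕜 b σ hb) (D.coxeterM a b))
        (altProd (c := fob 𝕜 σ) (fpsi 𝕜 b σ hb) (fpsi 𝕜 a σ ha) (D.coxeterM a b))
  /- A Coxeter hyperplane `h_a` and matter hyperplanes, all containing one codimension 2 subspace.
  Let `ρ` and `τ` be the adjacent chambers on the positive, resp. negative side of all these matter
  hyperplanes, and let `σ`, `σ'` be adjacent chambers with `C'_{σ,1}` and `s_a C'_{σ',1}` opposite.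
  The relation is
  `𝕨(σ',τ) ψ_a(τ) 𝕨(τ,σ) = 𝕨(σ',ρ) ψ_a(ρ) 𝕨(ρ,σ) - ∂_a(∏ φ_i) 𝕨(σ',σ)`,
  the product being over the matter hyperplanes on whose negative side both `σ` and `σ'` lie.
  For `σ = τ`, `σ' = ρ` it says `𝕨(ρ,τ) ψ_a(τ) = ψ_a(ρ) 𝕨(ρ,τ)`, and for `σ = ρ`, `σ' = τ` it says
  `ψ_a(τ) 𝕨(τ,ρ) = 𝕨(τ,ρ) ψ_a(ρ)`.  If there are just two matter hyperplanes, `H_j` and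
  its image under `s_a`, of multiplicity `m`, the remaining case is that `σ = σ'` is the chamber
  between them, say on the negative side of `H_j`, and the relation is
  `𝕨(σ,τ) ψ_a(τ) 𝕨(τ,σ) = 𝕨(σ,ρ) ψ_a(ρ) 𝕨(ρ,σ) - ∂_a(φ_j ^ m)`. -/
  | mixed (a : D.base.support) (j : ι) (y : Point X κ) (hy : D.IsMixedPoint Φ a j y)
      (ρ τ σ σ' : D.Obj Φ)
      (hρ : AdjacentTo ρ y) (hτ : AdjacentTo τ y) (hσ : AdjacentTo σ y) (hσ' : AdjacentTo σ' y)
      (hρ_pos : ∀ i, D.matterVal i y = 0 → ρ.sgn i = true)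
      (hτ_neg : ∀ i, D.matterVal i y = 0 → τ.sgn i = false)
      (hopp : OppositeAt a y σ σ')
      (sρ : D.Stable Φ a ρ.sgn) (sτ : D.Stable Φ a τ.sgn) :
      BasicRel
        (fwall 𝕜 τ σ ≫ fpsi 𝕜 a τ sτ ≫ fwall 𝕜 σ' τ)
        (fwall 𝕜 ρ σ ≫ fpsi 𝕜 a ρ sρ ≫ fwall 𝕜 σ' ρ -
          fwall 𝕜 σ' σ ≫ fpoly 𝕜 σ' (D.demazure 𝕜 a
            (D.weightProd 𝕜 fun i =>
              D.matterVal i y = 0 ∧ σ.sgn i = false ∧ σ'.sgn i = false)))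

variable (D Φ) in
/-- The congruence of `𝕜`-linear categories generated by the defining relations. -/
inductive Rel [Finite ι] : HomRel (D.FreeCat Φ 𝕜)
  | basic {σ τ : D.FreeCat Φ 𝕜} {f g : σ ⟶ τ} : BasicRel D Φ 𝕜 f g → Rel f g
  | refl {σ τ : D.FreeCat Φ 𝕜} (f : σ ⟶ τ) : Rel f f
  | symm {σ τ : D.FreeCat Φ 𝕜} {f g : σ ⟶ τ} : Rel f g → Rel g f
  | trans {σ τ : D.FreeCat Φ 𝕜} {f g h : σ ⟶ τ} : Rel f g → Rel g h → Rel f h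
  | add {σ τ : D.FreeCat Φ 𝕜} {f f' g g' : σ ⟶ τ} : Rel f f' → Rel g g' → Rel (f + g) (f' + g')
  | smul {σ τ : D.FreeCat Φ 𝕜} (r : 𝕜) {f f' : σ ⟶ τ} : Rel f f' → Rel (r • f) (r • f')
  | comp_left {σ τ υ : D.FreeCat Φ 𝕜} (f : σ ⟶ τ) {g g' : τ ⟶ υ} :
      Rel g g' → Rel (f ≫ g) (f ≫ g')
  | comp_right {σ τ υ : D.FreeCat Φ 𝕜} {f f' : σ ⟶ τ} (g : τ ⟶ υ) :
      Rel f f' → Rel (f ≫ g) (f' ≫ g)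

instance [Finite ι] : Congruence (Rel D Φ 𝕜) where
  equivalence := ⟨Rel.refl, Rel.symm, Rel.trans⟩
  comp_left := Rel.comp_left
  comp_right := Rel.comp_right

variable (D Φ) in
/-- The category `A_{I'}`. -/
abbrev CatA [Finite ι] : Type _ := Quotient (Rel D Φ 𝕜)

instance [Finite ι] : Preadditive (D.CatA Φ 𝕜) :=
  Quotient.preadditive (Rel D Φ 𝕜) fun _ _ _ _ _ _ => Rel.add

instance [Finite ι] : (Quotient.functor (Rel D Φ 𝕜)).Additive :=
  Quotient.functor_additive (Rel D Φ 𝕜) fun _ _ _ _ _ _ => Rel.add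

instance [Finite ι] : Linear 𝕜 (D.CatA Φ 𝕜) :=
  Quotient.linear 𝕜 (Rel D Φ 𝕜) fun r _ _ _ _ => Rel.smul r

variable [Finite ι]

/-- An object of `A_{I'}`. -/
def ob (σ : D.Obj Φ) : D.CatA Φ 𝕜 := (Quotient.functor (Rel D Φ 𝕜)).obj (fob 𝕜 σ)

/-- The morphism `𝕨(σ,σ') : σ' → σ` of `A_{I'}`. -/
def wall (σ σ' : D.Obj Φ) : ob 𝕜 σ' ⟶ ob 𝕜 σ := (Quotient.functor _).map (fwall 𝕜 σ σ')

/-- The morphism `ψ_a(σ) : σ → σ` of `A_{I'}`. -/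
def psi (a : D.base.support) (σ : D.Obj Φ) (h : D.Stable Φ a σ.sgn) : ob 𝕜 σ ⟶ ob 𝕜 σ :=
  (Quotient.functor _).map (fpsi 𝕜 a σ h)

/-- The action of `S` on an object of `A_{I'}`. -/
def poly (σ : D.Obj Φ) : Sym X 𝕜 →+* End (ob 𝕜 σ) where
  toFun f := (Quotient.functor (Rel D Φ 𝕜)).map (fpoly 𝕜 σ f)
  map_one' := CategoryTheory.Quotient.sound _ (by
    have := BasicRel.poly_algebraMap (D := D) (Φ := Φ) (𝕜 := 𝕜) σ 1
    rw [map_one, one_smul] at this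
    exact .basic this)
  map_mul' f g := CategoryTheory.Quotient.sound _ (.basic (.poly_mul σ f g))
  map_zero' := CategoryTheory.Quotient.sound _ (by
    have := BasicRel.poly_algebraMap (D := D) (Φ := Φ) (𝕜 := 𝕜) σ 0
    rw [map_zero, zero_smul] at this
    exact .basic this)
  map_add' f g := CategoryTheory.Quotient.sound _ (.basic (.poly_add σ f g))

/-- The right `S`-module structure on the morphisms `σ' → σ` of `A_{I'}`: `h · f = h ∘ f`, the
precomposition with the action of `f` on `σ'`. -/
instance rightModule (σ' σ : D.Obj Φ) : Module (Sym X 𝕜)ᵐᵒᵖ (ob 𝕜 σ' ⟶ ob 𝕜 σ) :=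
  Module.compHom _ (RingHom.op (poly 𝕜 σ'))

lemma op_smul_eq {σ' σ : D.Obj Φ} (f : Sym X 𝕜) (h : ob 𝕜 σ' ⟶ ob 𝕜 σ) :
    MulOpposite.op f • h = (show ob 𝕜 σ' ⟶ ob 𝕜 σ' from poly 𝕜 σ' f) ≫ h := rfl

end Category

/-! ### Paths and foldings -/

section Paths

variable (Φ : Set (κ → ℝ))

/-- The hyperplanes crossed when passing from `x` to `y`. -/
def crossed (x y : Point X κ) : Set (Set (Point X κ)) :=
  {H | (∃ i, H = D.matterHyp Φ i ∧ D.matterVal i x * D.matterVal i y < 0) ∨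
    ∃ a, H = D.coxHyp Φ a ∧ D.rootVal a x * D.rootVal a y < 0}

/-- A point of the complement of all the hyperplanes. -/
def Regular (x : Point X κ) : Prop :=
  x.2 ∈ Φ ∧ (∀ i, D.matterVal i x ≠ 0) ∧ ∀ a, D.rootVal a x ≠ 0

/-- A step of a path: it crosses exactly one hyperplane. -/
def Step (x y : Point X κ) : Prop :=
  D.Regular Φ x ∧ D.Regular Φ y ∧ ∃ H, D.crossed Φ x y = {H}

variable {Φ}

/-- `p` is a path from `C'_{σ',1}` to `C'_{wσ,w} = w · C'_{σ,1}`, given by one point in each of the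
successive chambers through which it runs. -/
structure IsPath (σ' σ : D.Obj Φ) (w : D.roots.weylGroup) (p : List (Point X κ)) : Prop where
  chain : p.IsChain (D.Step Φ)
  source : ∃ x ∈ p.head?, x ∈ D.posChamber Φ σ'.sgn
  target : ∃ x ∈ p.getLast?, ∃ z ∈ D.posChamber Φ σ.sgn, x = D.weylAct w z

/-- A path crossing a minimal number of hyperplanes. -/
structure IsMinimalPath (σ' σ : D.Obj Φ) (w : D.roots.weylGroup) (p : List (Point X κ)) :
    Prop where
  isPath : D.IsPath σ' σ w p
  minimal : ∀ q, D.IsPath σ' σ w q → p.length ≤ q.length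

variable (Φ) in
/-- A place where a folded path is reflected: the wall of the positive Weyl chamber given by a
simple root, and the chamber `C'_{σ,1}` in which the reflection takes place. -/
structure Turn where
  root : D.base.support
  obj : D.Obj Φ
  stable : D.Stable Φ root obj.sgn

variable {D}

/-- `Folds p l`: the path `p`, starting in the positive Weyl chamber, is folded into the positive
Weyl chamber with the successive turns `l`.  Whenever the path leaves the positive Weyl chamber,
the simple reflection is applied to the remainder of the path. -/
inductive Folds : List (Point X κ) → List (D.Turn Φ) → Prop
  | single {x : Point X κ} : D.Dominant x → Folds [x] []
  | step {x y : Point X κ} {p : List (Point X κ)} {l : List (D.Turn Φ)} :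
      D.Dominant x → D.Dominant y → Folds (y :: p) l → Folds (x :: y :: p) l
  | turn {x y : Point X κ} {p : List (Point X κ)} {l : List (D.Turn Φ)} (t : D.Turn Φ) :
      x ∈ D.posChamber Φ t.obj.sgn → D.Dominant (act (D.roots.reflection t.root) y) →
      Folds ((y :: p).map (act (D.roots.reflection t.root))) l → Folds (x :: y :: p) (t :: l)

/-- `l` is the list of turns `(β_1,σ_1), …, (β_p,σ_p)` of the folding of a minimal path from
`C'_{σ',1}` to `C'_{wσ,w}`. -/
def IsFolding (σ' σ : D.Obj Φ) (w : D.roots.weylGroup) (l : List (D.Turn Φ)) : Prop :=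
  ∃ p, D.IsMinimalPath σ' σ w p ∧ Folds p l

/-- The product `𝕨(σ,σ_p) ψ_{β_p}(σ_p) 𝕨(σ_p,σ_{p-1}) ⋯ ψ_{β_1}(σ_1) 𝕨(σ_1,σ')`. -/
def foldedWall (𝕜 : Type*) [Field 𝕜] [Finite ι] (σ : D.Obj Φ) :
    (σ' : D.Obj Φ) → List (D.Turn Φ) → (ob 𝕜 σ' ⟶ ob 𝕜 σ)
  | σ', [] => wall 𝕜 σ σ'
  | σ', t :: l =>
      wall 𝕜 t.obj σ' ≫ psi 𝕜 t.root t.obj t.stable ≫ foldedWall 𝕜 σ t.obj l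

end Paths

end GaugeData

end Steinberg

end

set_option linter.unusedSectionVars false

noncomputable section

namespace Steinberg.GaugeData

variable {R X Y ι κ : Type*} [AddCommGroup X] [AddCommGroup Y] (D : GaugeData R X Y ι κ)

/-! ### Weyl group -/

section Weyl

/-! The proof has two halves: geodesic foldings span by a filtration argument, and they are
independent because they act independently in a representation.

Spanning. Moving polynomials to the source writes every morphism as a combination of products
attached to lists of turns, filtered by the number of turns. The key is coherence (`Sys.coh`):
foldings of two geodesics from one chamber to the same Weyl translate have equal products modulo
products with fewer turns. By induction only the first turns matter. If both lie on the hyperplane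
of one simple root, the two faces are joined by a generic segment inside this hyperplane, and each
of its crossings is an instance of relation 4, whose correction term has no `psi` (`Coh.same_root`;
this uses the genericity of `ε`). If two roots turn in a common chamber, both lists are prolonged to
full alternating words and the braid relation applies (`Coh.two_roots`). The general case is a
connectedness argument (`Coh.turns`): as a point moves from one face to the other, the simple
hyperplane through which the segment from the target `v` to that point enters the Weyl chamber
changes only where two such hyperplanes are met at once. Given coherence, a superfluous turn can be
rewritten to contain `psi ≫ psi = 0`, and a superfluous crossing of matter hyperplanes becomes a
polynomial factor, up to fewer turns. So geodesic foldings span, and one for each `w` suffices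
(`Sys.F_le_G`, `Sys.exists_expansion`).

Independence. Walls act on polynomials by products of weights and `psi` by Demazure operators. Over
`𝕜` this need not be faithful: weights may vanish, and the Weyl group may act trivially on `𝕜 ⊗ X`.
Therefore one works over `ℤ` with the flavors as additional variables (`polySys`), where the
polynomials form a domain, the weights are nonzero and the Weyl group acts faithfully. There the
operator of a folding for `w` is, over the field of fractions, a combination of elements `u⁻¹` with
nonzero coefficient at `u = w` and all other `u` shorter (`exists_weyl_expansion`), so independence
follows from Dedekind's theorem (`polySys_independent`). The spanning half uses only a weak form of
the relations, axiomatized in `Sys`, and applies to these operators too; hence they form free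
bimodules with the expected basis (`Sys.exists_basis_bimod`). Base change on the source side along
the reduction to `S`, which kills the flavors, keeps the basis. As flavors commute with all
generators, they also act by zero from the left, and the result is a representation of `A_{I'}`
(`specRep`). Applied to `1 ⊗ id`, a relation between folded walls becomes a relation between basis
vectors (`foldedWall_independent`). -/

lemma act_one (x : Point X κ) : act (1 : X ≃ₗ[ℤ] X) x = x := rfl

lemma act_mul (g h : X ≃ₗ[ℤ] X) (x : Point X κ) : act (g * h) x = act g (act h x) := rfl

lemma act_reflection_act (a : R) (x : Point X κ) :
    act (D.roots.reflection a) (act (D.roots.reflection a) x) = x := by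
  rw [← act_mul]
  have : D.roots.reflection a * D.roots.reflection a = 1 := by
    ext χ; simp
  rw [this, act_one]

lemma rootVal_act (a b : R) (x : Point X κ) :
    D.rootVal b (act (D.roots.reflection a) x) = D.rootVal (D.roots.reflectionPerm a b) x := by
  simp only [rootVal, act, RootPairing.root_reflectionPerm]
  rfl

lemma matterVal_act {a : R} {i i' : ι} (hc : D.cls i' = D.cls i)
    (hw : D.weight i' = D.roots.reflection a (D.weight i)) (x : Point X κ) :
    D.matterVal i' (act (D.roots.reflection a) x) = D.matterVal i x := by
  simp [matterVal, act, hc, hw]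

lemma exists_reflect (a : R) (i : ι) : ∃ i', D.cls i' = D.cls i ∧
    D.weight i' = D.roots.reflection a (D.weight i) := by
  obtain ⟨p, hp⟩ := D.weyl_stable a
  exact ⟨p i, hp i⟩

lemma reflect_symm {a : R} {i i' : ι} (h : D.weight i' = D.roots.reflection a (D.weight i)) :
    D.weight i = D.roots.reflection a (D.weight i') := by
  rw [h]; simp

lemma rootVal_add_smul (a : R) (x y : Point X κ) (t : ℝ) :
    D.rootVal a (x + t • (y - x)) = D.rootVal a x + t * (D.rootVal a y - D.rootVal a x) := by
  simp [rootVal]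

lemma matterVal_add_smul (i : ι) (x y : Point X κ) (t : ℝ) :
    D.matterVal i (x + t • (y - x)) =
      D.matterVal i x + t * (D.matterVal i y - D.matterVal i x) := by
  simp [matterVal]; ring

/-- The simple reflection in the Weyl group. -/
abbrev sref (a : R) : D.roots.weylGroup := RootPairing.weylGroup.ofIdx D.roots a

/-- The permutation of the roots given by an element of the Weyl group. -/
abbrev idx (w : D.roots.weylGroup) : R ≃ R := (w : RootPairing.Aut D.roots).toHom.indexEquiv

lemma root_idx (w : D.roots.weylGroup) (i : R) :
    D.roots.root (D.idx w i) = RootPairing.Equiv.weightHom D.roots w.1 (D.roots.root i) :=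
  RootPairing.Hom.root_weightMap_apply _ _ _ _ |>.symm

lemma idx_mul (v w : D.roots.weylGroup) (i : R) : D.idx (v * w) i = D.idx v (D.idx w i) := rfl

lemma idx_sref (a i : R) : D.idx (D.sref a) i = D.roots.reflectionPerm a i := rfl

lemma weightHom_sref (a : R) :
    RootPairing.Equiv.weightHom D.roots (D.sref a).1 = D.roots.reflection a :=
  RootPairing.Equiv.reflection_weightEquiv _ _

lemma weylAct_mul (v w : D.roots.weylGroup) (x : Point X κ) :
    D.weylAct (v * w) x = D.weylAct v (D.weylAct w x) := by
  simp only [weylAct, ← act_mul]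
  congr 1
  exact map_mul (RootPairing.Equiv.weightHom D.roots) v.1 w.1

lemma weylAct_one (x : Point X κ) : D.weylAct 1 x = x := by
  rw [weylAct, Subgroup.coe_one, map_one, act_one]

lemma weylAct_sref (a : R) (x : Point X κ) :
    D.weylAct (D.sref a) x = act (D.roots.reflection a) x := by
  rw [weylAct, weightHom_sref]

lemma sref_mul_self (a : R) : D.sref a * D.sref a = 1 := by
  ext1
  have := RootPairing.Equiv.reflection_inv D.roots a
  change RootPairing.Equiv.reflection D.roots a * RootPairing.Equiv.reflection D.roots a = 1
  nth_rw 1 [← this]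
  exact inv_mul_cancel _

lemma weylGroup_ext {v w : D.roots.weylGroup}
    (h : ∀ χ, RootPairing.Equiv.weightHom D.roots v.1 χ =
      RootPairing.Equiv.weightHom D.roots w.1 χ) : v = w := by
  ext1
  exact RootPairing.Equiv.weightHom_injective D.roots (LinearEquiv.ext h)

lemma rootVal_weylAct (w : D.roots.weylGroup) (b : R) (x : Point X κ) :
    D.rootVal (D.idx w b) (D.weylAct w x) = D.rootVal b x := by
  change x.1 ((RootPairing.Equiv.weightHom D.roots w.1).symm (D.roots.root (D.idx w b))) = _
  rw [root_idx, LinearEquiv.symm_apply_apply]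
  rfl

/-- This is `w s_a w⁻¹ = s_{wa}`. On characters it reduces to the invariance of the pairing of
weights with coroots. -/
lemma mul_sref {w : D.roots.weylGroup} {a c : R} (h : D.idx w a = c) :
    w * D.sref a = D.sref c * w := by
  apply D.weylGroup_ext
  intro χ
  have e1 := map_mul (RootPairing.Equiv.weightHom D.roots) w.1 (D.sref a).1
  have e2 := map_mul (RootPairing.Equiv.weightHom D.roots) (D.sref c).1 w.1
  rw [Subgroup.coe_mul, Subgroup.coe_mul, e1, e2, weightHom_sref, weightHom_sref]
  simp only [LinearEquiv.mul_apply]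
  rw [RootPairing.reflection_apply, RootPairing.reflection_apply, map_sub, map_smul, ← root_idx, h]
  congr 2
  have h1 := DFunLike.congr_fun (RootPairing.Hom.weight_coweight_transpose_apply D.roots D.roots
    (D.roots.coroot c) w.1.toHom) χ
  have h2 := RootPairing.Hom.coroot_coweightMap_apply D.roots D.roots c w.1.toHom
  have h3 : w.1.toHom.indexEquiv.symm c = a := by
    rw [Equiv.symm_apply_eq]
    exact h.symm
  rw [h3] at h2
  rw [h2] at h1
  exact h1.symm

end Weyl

/-! ### Alternating words -/

section AltWord

/-- The alternating product `s t s ⋯` with `n` factors. -/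
def altWord {M : Type*} [Monoid M] (s t : M) : ℕ → M
  | 0 => 1
  | n + 1 => s * altWord t s n

lemma altWord_succ {M : Type*} [Monoid M] (s t : M) (n : ℕ) :
    altWord s t (n + 1) = s * altWord t s n := rfl

lemma altWord_succ_right {M : Type*} [Monoid M] (s t : M) (n : ℕ) :
    altWord s t (n + 1) = altWord s t n * (if Even n then s else t) := by
  induction n generalizing s t with
  | zero => simp [altWord]
  | succ n ih =>
    rw [altWord_succ, ih, altWord_succ, mul_assoc]
    congr 2
    by_cases h : Even n <;> simp [h, Nat.even_add_one]

/-- In the `3n` letters of the left side the last `n` letters of `(s t) ^ n` cancel against the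
word. Consequently the two alternating words of length `n` agree exactly when `(s t) ^ n = 1`. -/
lemma pow_mul_altWord {M : Type*} [Monoid M] {s t : M} (hs : s * s = 1) (ht : t * t = 1) (n : ℕ) :
    (s * t) ^ n * altWord t s n = altWord s t n := by
  induction n with
  | zero => simp [altWord]
  | succ n ih =>
    rw [altWord_succ_right t s, pow_succ', mul_assoc, ← mul_assoc ((s * t) ^ n), ih]
    have : s * t * altWord s t n = altWord s t (n + 2) := by
      rw [altWord_succ, altWord_succ, mul_assoc]
    rw [← mul_assoc, this, altWord_succ_right s t (n + 1), mul_assoc]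
    by_cases h : Even n <;> simp [h, Nat.even_add_one, hs, ht]

lemma altWord_eq_iff {G : Type*} [Group G] {s t : G} (hs : s * s = 1) (ht : t * t = 1) (n : ℕ) :
    altWord s t n = altWord t s n ↔ (s * t) ^ n = 1 := by
  rw [← pow_mul_altWord hs ht, mul_eq_right]

lemma map_altWord {M N : Type*} [Monoid M] [Monoid N] (f : M →* N) (s t : M) (n : ℕ) :
    f (altWord s t n) = altWord (f s) (f t) n := by
  induction n generalizing s t with
  | zero => simp [altWord]
  | succ n ih => simp [altWord_succ, ih]

lemma altProd_eq {C : Type*} [Category C] {c : C} (f g : End c) (n : ℕ) :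
    altProd f g n = altWord f g n := by
  induction n generalizing f g with
  | zero => rfl
  | succ n ih => rw [altProd, altWord_succ, ih]

end AltWord

/-! ### Positive roots -/

section Positive

lemma rootVal_reflect_self (a : R) (x : Point X κ) :
    D.rootVal (D.roots.reflectionPerm a a) x = - D.rootVal a x := by
  simp [rootVal, RootPairing.root_reflectionPerm]

lemma height_reflect_self (a : R) :
    D.base.height (D.roots.reflectionPerm a a) = - D.base.height a :=
  D.base.height_reflectionPerm_self a

lemma not_isPos_reflect {a : R} (h : D.base.IsPos a) :
    ¬ D.base.IsPos (D.roots.reflectionPerm a a) := by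
  rw [RootPairing.Base.isPos_iff, height_reflect_self]
  rw [RootPairing.Base.isPos_iff] at h
  omega

lemma isPos_reflect_of_not {a : R} (h : ¬ D.base.IsPos a) :
    D.base.IsPos (D.roots.reflectionPerm a a) := by
  rw [RootPairing.Base.isPos_iff, height_reflect_self]
  rw [RootPairing.Base.isPos_iff'] at h
  omega

lemma reflectionPerm_reflectionPerm (a b : R) :
    D.roots.reflectionPerm a (D.roots.reflectionPerm a b) = b := by simp

/-- There are real cocharacters with prescribed values on the simple roots. -/
lemma exists_functional (f : D.base.support → ℝ) :
    ∃ h : X →ₗ[ℤ] ℝ, ∀ a : D.base.support, h (D.roots.root a) = f a := by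
  -- Since `ℝ` is divisible, it is injective over `ℤ`, so a functional on the root lattice extends
  -- to `X`.
  have hB : Module.Baer ℤ ℝ := Module.Baer.of_divisible ℝ
  obtain ⟨h, hh⟩ := hB.extension_property
    (Finsupp.linearCombination ℤ (fun a : D.base.support => D.roots.root a))
    D.base.linearIndepOn_root (Finsupp.linearCombination ℤ f)
  refine ⟨h, fun a => ?_⟩
  have := DFunLike.congr_fun hh (Finsupp.single a 1)
  simpa using this

variable [Finite R]

lemma isPos_reflect {a b : R} (hb : D.base.IsPos b) (ha : a ∈ D.base.support) (h : b ≠ a) :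
    D.base.IsPos (D.roots.reflectionPerm a b) :=
  have := D.reduced
  hb.reflectionPerm ha h

lemma rootVal_pos {b : R} (hb : D.base.IsPos b) {x : Point X κ} (hx : D.Dominant x) :
    0 < D.rootVal b x := by
  have := D.reduced
  refine hb.induction_on_add (p := fun b => 0 < D.rootVal b x) hx ?_
  intro i j k h hi hj
  have : D.rootVal k x = D.rootVal i x + D.rootVal j x := by simp [rootVal, h]
  have := hx j hj
  linarith

lemma isPos_functional {b : R} (hb : D.base.IsPos b) {h : X →ₗ[ℤ] ℝ}
    (hh : ∀ a ∈ D.base.support, 0 ≤ h (D.roots.root a)) : 0 ≤ h (D.roots.root b) := by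
  have := D.reduced
  refine hb.induction_on_add (p := fun b => 0 ≤ h (D.roots.root b)) hh ?_
  intro i j k e hi hj
  have := hh j hj
  rw [e, map_add]
  linarith

lemma rootVal_neg {b : R} (hb : ¬ D.base.IsPos b) {x : Point X κ} (hx : D.Dominant x) :
    D.rootVal b x < 0 := by
  have := D.rootVal_pos (D.isPos_reflect_of_not hb) hx
  rw [rootVal_reflect_self] at this
  linarith

lemma rootVal_ne_zero {x : Point X κ} (hx : D.Dominant x) (b : R) : D.rootVal b x ≠ 0 := by
  by_cases hb : D.base.IsPos b
  · exact (D.rootVal_pos hb hx).ne'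
  · exact (D.rootVal_neg hb hx).ne

lemma isPos_of_rootVal_pos {b : R} {x : Point X κ} (hx : D.Dominant x)
    (h : 0 < D.rootVal b x) : D.base.IsPos b := by
  by_contra hb
  exact absurd (D.rootVal_neg hb hx) (not_lt.2 h.le)

/-- The number of positive roots that are negative at a point. -/
def negCount (v : Point X κ) : ℕ := {b | D.base.IsPos b ∧ D.rootVal b v < 0}.ncard

/-- The simple reflection permutes the positive roots other than `a`, and `a` itself ceases to be
counted. -/
lemma negCount_reflect {a : R} (ha : a ∈ D.base.support) {v : Point X κ}
    (h : D.rootVal a v < 0) :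
    D.negCount (act (D.roots.reflection a) v) + 1 = D.negCount v := by
  have hap := D.base.isPos_of_mem_support ha
  have : {b | D.base.IsPos b ∧ D.rootVal b (act (D.roots.reflection a) v) < 0} =
      D.roots.reflectionPerm a '' ({b | D.base.IsPos b ∧ D.rootVal b v < 0} \ {a}) := by
    ext b
    simp only [Set.mem_ofPred_eq, rootVal_act, Set.mem_image, Set.mem_sdiff,
      Set.mem_singleton_iff]
    constructor
    · rintro ⟨hb, hv⟩
      have hba : b ≠ a := by
        rintro rfl
        rw [rootVal_reflect_self] at hv
        linarith
      refine ⟨_, ⟨⟨D.isPos_reflect hb ha hba, hv⟩, ?_⟩, D.reflectionPerm_reflectionPerm a b⟩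
      intro e
      have := D.reflectionPerm_reflectionPerm a b
      rw [e] at this
      exact D.not_isPos_reflect hap (this ▸ hb)
    · rintro ⟨c, ⟨⟨hc, hv⟩, hca⟩, rfl⟩
      rw [reflectionPerm_reflectionPerm]
      exact ⟨D.isPos_reflect hc ha hca, hv⟩
  rw [negCount, negCount, this, Set.ncard_image_of_injective _ (Equiv.injective _)]
  exact Set.ncard_sdiff_singleton_add_one (by exact ⟨hap, h⟩) (Set.toFinite _)

lemma negCount_dominant {v : Point X κ} (h : D.Dominant v) : D.negCount v = 0 := by
  rw [negCount, Set.ncard_eq_zero]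
  ext b
  simp only [Set.mem_ofPred_eq, Set.mem_empty_iff_false, iff_false, not_and, not_lt]
  exact fun hb => (D.rootVal_pos hb h).le

/-- The product of the simple reflections in a list of roots. -/
def wordProd (L : List R) : D.roots.weylGroup := (L.map D.sref).prod

lemma wordProd_cons (a : R) (L : List R) : D.wordProd (a :: L) = D.sref a * D.wordProd L := by
  simp [wordProd]

lemma wordProd_append (L L' : List R) :
    D.wordProd (L ++ L') = D.wordProd L * D.wordProd L' := by
  simp [wordProd]

/-- Follow `a` through the word from the right. The letter `c` that makes its image negative must
equal that image, because `s_c` makes no other positive root negative. Moving `s_a` through the part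
of the word to the right of `c` then turns it into `s_c`, which cancels that letter. -/
lemma exchange {L : List R} (hL : ∀ b ∈ L, b ∈ D.base.support) {a : R} (ha : a ∈ D.base.support)
    (h : ¬ D.base.IsPos (D.idx (D.wordProd L) a)) :
    ∃ L' : List R, (∀ b ∈ L', b ∈ D.base.support) ∧ L'.length + 1 = L.length ∧
      D.wordProd L' = D.wordProd L * D.sref a := by
  induction L with
  | nil => exact absurd (D.base.isPos_of_mem_support ha) h
  | cons c L ih =>
    by_cases hc : D.base.IsPos (D.idx (D.wordProd L) a)
    · have hac : D.idx (D.wordProd L) a = c := by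
        by_contra hne
        refine h ?_
        rw [wordProd_cons, idx_mul, idx_sref]
        exact D.isPos_reflect hc (hL c (by simp)) hne
      refine ⟨L, fun b hb => hL b (by simp [hb]), by simp, ?_⟩
      rw [wordProd_cons, mul_assoc, D.mul_sref hac, ← mul_assoc, sref_mul_self, one_mul]
    · obtain ⟨L', h1, h2, h3⟩ := ih (fun b hb => hL b (by simp [hb])) hc
      refine ⟨c :: L', ?_, by simp [h2], ?_⟩
      · intro b hb
        rcases List.mem_cons.1 hb with rfl | hb
        · exact hL b (by simp)
        · exact h1 b hb
      · rw [wordProd_cons, h3, wordProd_cons, mul_assoc]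

/-- If the whole word keeps its last letter `a` positive, then the word without its last letter
makes `a` negative, and the exchange property replaces the word by one that is shorter by two. -/
lemma wordProd_eq_one {L : List R} (hL : ∀ b ∈ L, b ∈ D.base.support)
    (h : ∀ b, D.base.IsPos b → D.base.IsPos (D.idx (D.wordProd L) b)) : D.wordProd L = 1 := by
  induction hn : L.length using Nat.strong_induction_on generalizing L with
  | _ n ih =>
    rcases L.eq_nil_or_concat with rfl | ⟨L₀, a, rfl⟩
    · rfl
    · simp only [List.concat_eq_append] at hL h hn ⊢
      have ha : a ∈ D.base.support := hL a (by simp)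
      have e : D.wordProd (L₀ ++ [a]) = D.wordProd L₀ * D.sref a := by
        rw [wordProd_append]; simp [wordProd]
      rw [e] at h ⊢
      obtain ⟨L', h1, h2, h3⟩ := D.exchange (L := L₀) (fun b hb => hL b (by simp [hb])) ha (by
        intro hp
        have h1 := h a (D.base.isPos_of_mem_support ha)
        rw [idx_mul, idx_sref] at h1
        have h2 := D.root_idx (D.wordProd L₀) (D.roots.reflectionPerm a a)
        have h3 := D.root_idx (D.wordProd L₀) a
        rw [RootPairing.root_reflectionPerm, RootPairing.reflection_apply_self, map_neg,
          ← h3] at h2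
        have h4 : D.idx (D.wordProd L₀) (D.roots.reflectionPerm a a) =
            D.roots.reflectionPerm (D.idx (D.wordProd L₀) a) (D.idx (D.wordProd L₀) a) := by
          apply D.roots.root.injective
          rw [h2, RootPairing.root_reflectionPerm, RootPairing.reflection_apply_self]
        rw [h4] at h1
        exact D.not_isPos_reflect hp h1)
      rw [← h3] at h ⊢
      refine ih _ ?_ h1 h rfl
      simp at hn
      omega

/-- Every root is obtained from simple roots by simple reflections, and `s_{s_j i} = s_j s_i s_j`,
so the simple reflections generate all reflections. -/
lemma exists_wordProd (w : D.roots.weylGroup) :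
    ∃ L : List R, (∀ b ∈ L, b ∈ D.base.support) ∧ D.wordProd L = w := by
  have := D.reduced
  let H : Subgroup D.roots.weylGroup := Subgroup.closure (D.sref '' D.base.support)
  have hs : ∀ a, D.sref a ∈ H := by
    intro a
    refine D.base.induction_reflect a (p := fun a => D.sref a ∈ H) ?_ ?_ ?_
    · intro i hi
      have : D.sref (D.roots.reflectionPerm i i) = D.sref i := by
        have := D.mul_sref (w := D.sref i) (a := i) rfl
        rw [idx_sref] at this
        exact (mul_right_cancel this).symm
      rwa [this]
    · exact fun i hi => Subgroup.subset_closure ⟨i, hi, rfl⟩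
    · intro i j hi hj
      have := D.mul_sref (w := D.sref j) (a := i) rfl
      rw [idx_sref] at this
      have e : D.sref (D.roots.reflectionPerm j i) = D.sref j * D.sref i * D.sref j := by
        rw [this, mul_assoc, sref_mul_self, mul_one]
      have hj' : D.sref j ∈ H := Subgroup.subset_closure ⟨j, hj, rfl⟩
      rw [e]
      exact H.mul_mem (H.mul_mem hj' hi) hj'
  have hw : w ∈ H := by
    obtain ⟨w, hw⟩ := w
    induction hw using RootPairing.weylGroup.induction with
    | mem i => exact hs i
    | one => exact H.one_mem
    | mul x y hx hy h1 h2 => exact H.mul_mem h1 h2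
  refine Subgroup.closure_induction (p := fun w _ => ∃ L : List R,
    (∀ b ∈ L, b ∈ D.base.support) ∧ D.wordProd L = w) ?_ ⟨[], by simp, rfl⟩ ?_ ?_ hw
  · rintro _ ⟨a, ha, rfl⟩
    exact ⟨[a], by simpa using ha, by simp [wordProd]⟩
  · rintro x y - - ⟨L, h1, rfl⟩ ⟨L', h2, rfl⟩
    refine ⟨L ++ L', ?_, D.wordProd_append L L'⟩
    intro b hb
    rcases List.mem_append.1 hb with hb | hb
    · exact h1 b hb
    · exact h2 b hb
  · rintro x - ⟨L, h1, rfl⟩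
    refine ⟨L.reverse, by simpa using h1, ?_⟩
    clear h1
    induction L with
    | nil => simp [wordProd]
    | cons a L ih =>
      rw [List.reverse_cons, wordProd_append, ih, D.wordProd_cons a L, mul_inv_rev]
      congr 1
      rw [eq_inv_iff_mul_eq_one]
      simp [wordProd, sref_mul_self]

/-- An element of the Weyl group that preserves the positive roots is trivial. -/
lemma eq_one_of_isPos {w : D.roots.weylGroup}
    (h : ∀ b, D.base.IsPos b → D.base.IsPos (D.idx w b)) : w = 1 := by
  obtain ⟨L, hL, rfl⟩ := D.exists_wordProd w
  exact D.wordProd_eq_one hL h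

lemma eq_one_of_dominant {w : D.roots.weylGroup} {z : Point X κ} (hz : D.Dominant z)
    (hw : D.Dominant (D.weylAct w z)) : w = 1 := by
  refine D.eq_one_of_isPos fun b hb => D.isPos_of_rootVal_pos hw ?_
  rw [rootVal_weylAct]
  exact D.rootVal_pos hb hz

instance : Finite D.roots.weylGroup := by
  refine Finite.of_injective (fun w => D.idx w) fun v w h => ?_
  rw [← inv_mul_eq_one]
  refine D.eq_one_of_isPos fun b hb => ?_
  have h' : D.idx v = D.idx w := h
  have : D.idx (v⁻¹ * w) b = b := by
    have h1 : D.idx v (D.idx (v⁻¹ * w) b) = D.idx w b := by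
      rw [← idx_mul, mul_inv_cancel_left]
    rw [← h'] at h1
    exact (D.idx v).injective h1
  rwa [this]

lemma coxeterM_eq (a b : D.base.support) :
    D.coxeterM a b = orderOf (D.sref a * D.sref b) := by
  have hinj : Function.Injective
      ((RootPairing.Equiv.weightHom D.roots).comp D.roots.weylGroup.subtype) :=
    (RootPairing.Equiv.weightHom_injective D.roots).comp Subtype.val_injective
  rw [← orderOf_injective _ hinj, map_mul]
  simp only [MonoidHom.comp_apply, Subgroup.subtype_apply, weightHom_sref]
  rfl

lemma coxeterM_pos (a b : D.base.support) : 0 < D.coxeterM a b := by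
  rw [coxeterM_eq]
  exact orderOf_pos _

lemma altWord_sref_eq (a b : D.base.support) :
    altWord (D.sref a) (D.sref b) (D.coxeterM a b) =
      altWord (D.sref b) (D.sref a) (D.coxeterM a b) := by
  rw [altWord_eq_iff (D.sref_mul_self _) (D.sref_mul_self _), coxeterM_eq, pow_orderOf_eq_one]

lemma coxeterM_comm (a b : D.base.support) : D.coxeterM a b = D.coxeterM b a := by
  rw [coxeterM_eq, coxeterM_eq, ← orderOf_inv, mul_inv_rev,
    inv_eq_of_mul_eq_one_left (D.sref_mul_self _), inv_eq_of_mul_eq_one_left (D.sref_mul_self _)]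

/-- Alternating words with at most `m` letters are reduced. Otherwise some shorter word would carry
the next simple root to the root about to be reflected, the two alternating words of length `k + 1 <
m` would agree, and `(s_a s_b) ^ (k + 1)` would be trivial. -/
lemma isPos_altWord (a b : D.base.support) {k : ℕ} (hk : k < D.coxeterM a b) :
    D.base.IsPos (D.idx (altWord (D.sref a) (D.sref b) k) (if Even k then a else b : D.base.support))
    := by
  induction k generalizing a b with
  | zero => exact D.base.isPos_of_mem_support a.2
  | succ k ih =>
    have ih := ih b a (by rw [coxeterM_comm]; omega)
    rw [altWord_succ, idx_mul, idx_sref]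
    have e : (if Even (k + 1) then a else b : D.base.support) = if Even k then b else a := by
      by_cases h : Even k <;> simp [h, Nat.even_add_one]
    rw [e]
    refine D.isPos_reflect ih a.2 fun h => ?_
    have h1 := D.mul_sref h
    have h2 : altWord (D.sref b) (D.sref a) (k + 1) = altWord (D.sref a) (D.sref b) (k + 1) := by
      rw [altWord_succ_right, altWord_succ (D.sref a), ← h1]
      congr 1
      split_ifs <;> rfl
    have h3 := (altWord_eq_iff (D.sref_mul_self _) (D.sref_mul_self _) _).1 h2.symm
    have h4 := orderOf_le_of_pow_eq_one (Nat.succ_pos k) h3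
    rw [← coxeterM_eq] at h4
    omega

lemma root_altWord_mem (a b : D.base.support) (k : ℕ) (c : R)
    (hc : ∃ p q : ℤ, D.roots.root c = p • D.roots.root a + q • D.roots.root b) :
    ∃ p q : ℤ, D.roots.root (D.idx (altWord (D.sref a) (D.sref b) k) c) =
      p • D.roots.root a + q • D.roots.root b := by
  induction k generalizing a b with
  | zero => simpa [altWord] using hc
  | succ k ih =>
    obtain ⟨p, q, h⟩ := ih b a (by obtain ⟨p, q, h⟩ := hc; exact ⟨q, p, by rw [h, add_comm]⟩)
    refine ⟨-q - p * (D.roots.coroot' a (D.roots.root b)), p, ?_⟩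
    rw [altWord_succ, idx_mul, idx_sref, RootPairing.root_reflectionPerm, h, map_add, map_smul,
      map_smul, RootPairing.reflection_apply_self, RootPairing.reflection_apply]
    module

/-- The root in question is the value at `v` of a positive root in the span of `a` and `b`, that is,
of a nonnegative combination of them. This shows that `m` alternating turns towards `v` all go in
the right direction. -/
lemma rootVal_altWord_neg {a b : D.base.support} (hab : a ≠ b) {v : Point X κ}
    (ha : D.rootVal a v < 0) (hb : D.rootVal b v < 0) {k : ℕ} (hk : k < D.coxeterM a b) :
    D.rootVal (if Even k then a else b : D.base.support)
      (D.weylAct (altWord (D.sref a) (D.sref b) k)⁻¹ v) < 0 := by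
  set u := altWord (D.sref a) (D.sref b) k
  set c : D.base.support := if Even k then a else b with hc
  have hpos : D.base.IsPos (D.idx u c) := D.isPos_altWord a b hk
  obtain ⟨p, q, h⟩ := D.root_altWord_mem a b k c (by
    rw [hc]
    split_ifs
    · exact ⟨1, 0, by simp⟩
    · exact ⟨0, 1, by simp⟩)
  have e : D.rootVal c (D.weylAct u⁻¹ v) = D.rootVal (D.idx u c) v := by
    rw [← D.rootVal_weylAct u, ← weylAct_mul, mul_inv_cancel, weylAct_one]
  change D.roots.root (D.idx u c) = _ at h
  classical
  -- A functional that vanishes on `b` and is `1` on the other simple roots is nonnegative on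
  -- positive roots and reads off `p`.
  have hp : 0 ≤ p := by
    obtain ⟨f, hf⟩ := D.exists_functional (fun c => if c = b then 0 else 1)
    have := D.isPos_functional hpos (h := f) (fun c hc => by
      rw [hf ⟨c, hc⟩]; split_ifs <;> norm_num)
    rw [h, map_add, map_smul, map_smul, hf a, hf b] at this
    simpa [hab] using this
  have hq : 0 ≤ q := by
    obtain ⟨f, hf⟩ := D.exists_functional (fun c => if c = a then 0 else 1)
    have := D.isPos_functional hpos (h := f) (fun c hc => by
      rw [hf ⟨c, hc⟩]; split_ifs <;> norm_num)
    rw [h, map_add, map_smul, map_smul, hf a, hf b] at this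
    simpa [hab.symm] using this
  have hne : ¬ (p = 0 ∧ q = 0) := by
    rintro ⟨rfl, rfl⟩
    exact D.roots.ne_zero (D.idx u c) (by simp [h])
  rw [e]
  have e2 : D.rootVal (D.idx u c) v = p * D.rootVal a v + q * D.rootVal b v := by
    simp [rootVal, h]
  rw [e2]
  have hp' : (0 : ℝ) ≤ p := by exact_mod_cast hp
  have hq' : (0 : ℝ) ≤ q := by exact_mod_cast hq
  rcases hp.lt_or_eq with hp1 | hp1
  · have : (0 : ℝ) < p := by exact_mod_cast hp1
    nlinarith
  · have : (0 : ℝ) < q := by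
      have : 0 < q := lt_of_le_of_ne hq fun h => hne ⟨hp1.symm, h.symm⟩
      exact_mod_cast this
    nlinarith

/-- The permutation of the weights given by an element of the Weyl group. -/
lemma weyl_perm (w : D.roots.weylGroup) : ∃ p : Equiv.Perm ι, ∀ i, D.cls (p i) = D.cls i ∧
    D.weight (p i) = RootPairing.Equiv.weightHom D.roots w.1 (D.weight i) := by
  obtain ⟨L, -, rfl⟩ := D.exists_wordProd w
  induction L with
  | nil => exact ⟨1, fun i => ⟨rfl, rfl⟩⟩
  | cons a L ih =>
    obtain ⟨p, hp⟩ := ih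
    obtain ⟨q, hq⟩ := D.weyl_stable a
    refine ⟨p.trans q, fun i => ⟨(hq _).1.trans (hp i).1, ?_⟩⟩
    rw [Equiv.trans_apply, (hq _).2, (hp i).2, wordProd_cons, Subgroup.coe_mul, map_mul,
      LinearEquiv.mul_apply, weightHom_sref]

lemma matterVal_weylAct {w : D.roots.weylGroup} {p : Equiv.Perm ι}
    (hp : ∀ i, D.cls (p i) = D.cls i ∧
      D.weight (p i) = RootPairing.Equiv.weightHom D.roots w.1 (D.weight i))
    (i : ι) (x : Point X κ) : D.matterVal (p i) (D.weylAct w x) = D.matterVal i x := by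
  rw [matterVal, matterVal, (hp i).1, (hp i).2]
  change x.1 ((RootPairing.Equiv.weightHom D.roots w.1).symm _) + _ - _ = _
  rw [LinearEquiv.symm_apply_apply]
  rfl

end Positive

end Steinberg.GaugeData
end

noncomputable section

namespace Steinberg.GaugeData

/-! ### Perturbations and generic segments -/

section Generic

open Filter Topology

lemma eventually_add_mul_pos {A : ℝ} (hA : 0 < A) (B : ℝ) : ∀ᶠ δ in 𝓝[>] (0 : ℝ), 0 < A + δ * B := by
  have h : Tendsto (fun δ : ℝ => A + δ * B) (𝓝[>] 0) (𝓝 (A + 0 * B)) :=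
    ((continuous_const.add (continuous_id.mul continuous_const)).tendsto 0).mono_left
      nhdsWithin_le_nhds
  exact h.eventually (lt_mem_nhds (by simpa using hA))

lemma eventually_same_sign {A : ℝ} (hA : A ≠ 0) (B : ℝ) :
    ∀ᶠ δ in 𝓝[>] (0 : ℝ), 0 < (A + δ * B) * A := by
  have h := eventually_add_mul_pos (mul_self_pos.2 hA) (B * A)
  filter_upwards [h] with δ hδ
  nlinarith

lemma eventually_add_mul_ne {A B : ℝ} (h : A ≠ 0 ∨ B ≠ 0) :
    ∀ᶠ δ in 𝓝[>] (0 : ℝ), A + δ * B ≠ 0 := by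
  by_cases hA : A = 0
  · filter_upwards [self_mem_nhdsWithin] with δ hδ
    simp only [hA, zero_add]
    exact mul_ne_zero (ne_of_gt hδ) (h.resolve_left (not_not.2 hA))
  · filter_upwards [eventually_same_sign hA B] with δ hδ h0
    simp [h0] at hδ

lemma eventually_lt_one : ∀ᶠ δ in 𝓝[>] (0 : ℝ), δ < 1 :=
  nhdsWithin_le_nhds (gt_mem_nhds one_pos)

variable {V : Type*} [AddCommGroup V] [Module ℝ V]

/-- A function with affine restrictions to all lines. -/
def IsAff (u : V → ℝ) : Prop := ∀ x y (t : ℝ), u (x + t • (y - x)) = u x + t * (u y - u x)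

/-- A set that contains the lines through any two of its points. -/
def IsFlat (P : Set V) : Prop := ∀ x ∈ P, ∀ y ∈ P, ∀ t : ℝ, x + t • (y - x) ∈ P

lemma IsAff.comb {u v : V → ℝ} (hu : IsAff u) (hv : IsAff v) (a b : ℝ) :
    IsAff fun p => a * u p - b * v p := by
  intro x y t
  simp only [hu x y t, hv x y t]
  ring

/-- The functions are made nonzero one at a time, by a small move towards a point where the next one
does not vanish; small moves preserve the open conditions already achieved. -/
lemma exists_avoiding {K J : Type*} [Finite K] {u : K → V → ℝ} (hu : ∀ k, IsAff (u k))
    {g : J → V → ℝ} (hg : ∀ j, IsAff (g j)) {P : Set V} (hP : IsFlat P) (s : Finset J)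
    (hs : ∀ j ∈ s, ∃ p ∈ P, g j p ≠ 0) {y : V} (hy : y ∈ P) (huy : ∀ k, u k y ≠ 0) :
    ∃ y' ∈ P, (∀ j ∈ s, g j y' ≠ 0) ∧ ∀ k, 0 < u k y' * u k y := by
  classical
  induction s using Finset.induction_on with
  | empty => exact ⟨y, hy, by simp, fun k => mul_self_pos.2 (huy k)⟩
  | insert j s hj ih =>
    obtain ⟨y', hy', h1, h2⟩ := ih fun i hi => hs i (Finset.mem_insert_of_mem hi)
    obtain ⟨p, hp, hgp⟩ := hs j (Finset.mem_insert_self _ _)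
    have e1 : ∀ᶠ δ in 𝓝[>] (0 : ℝ), ∀ i ∈ s, g i (y' + δ • (p - y')) ≠ 0 := by
      rw [Filter.eventually_all_finset]
      intro i hi
      simp only [hg i y' p]
      exact eventually_add_mul_ne (.inl (h1 i hi))
    have e2 : ∀ᶠ δ in 𝓝[>] (0 : ℝ), g j (y' + δ • (p - y')) ≠ 0 := by
      simp only [hg j y' p]
      apply eventually_add_mul_ne
      by_cases h : g j y' = 0
      · right; simpa [h] using hgp
      · exact .inl h
    have e3 : ∀ᶠ δ in 𝓝[>] (0 : ℝ), ∀ k, 0 < u k (y' + δ • (p - y')) * u k y := by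
      rw [Filter.eventually_all]
      intro k
      simp only [hu k y' p]
      have := eventually_add_mul_pos (h2 k) ((u k p - u k y') * u k y)
      filter_upwards [this] with δ hδ
      nlinarith
    obtain ⟨δ, h3, h4, h5⟩ := (e1.and (e2.and e3)).exists
    refine ⟨_, hP y' hy' p hp δ, ?_, h5⟩
    intro i hi
    rcases Finset.mem_insert.1 hi with rfl | hi
    · exact h4
    · exact h3 i hi

/-- The first crossing of a generic segment from `x` towards the chamber of `y`. -/
lemma exists_first_crossing {K : Type*} [Finite K] {u : K → V → ℝ} (hu : ∀ k, IsAff (u k))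
    {P : Set V} (hP : IsFlat P) {x y : V} (hx : x ∈ P) (hy : y ∈ P) (hux : ∀ k, u k x ≠ 0)
    (huy : ∀ k, u k y ≠ 0) (hsep : ∃ k, u k x * u k y < 0) :
    ∃ m ∈ P, ∃ x₁ ∈ P, (∃ k, u k m = 0) ∧
      (∀ k, u k m = 0 → u k x * u k y < 0 ∧ 0 < u k x₁ * u k y) ∧
      (∀ k, u k m ≠ 0 → 0 < u k m * u k x ∧ 0 < u k x₁ * u k x) ∧
      ∀ k l, u k m = 0 → u l m = 0 → ∀ p ∈ P, u k x * u l p = u l x * u k p := by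
  classical
  have := Fintype.ofFinite K
  -- If two functions vanish at one point of the segment from `x` to `y'`, this determinant vanishes
  -- at `y'`. So `y'` is moved off its zero set unless it vanishes on all of `P`, in which case the
  -- two functions are proportional there.
  obtain ⟨y', hy', hgen, hs'⟩ := exists_avoiding (J := K × K) hu
    (g := fun j p => u j.1 x * u j.2 p - u j.2 x * u j.1 p)
    (fun j => (hu j.2).comb (hu j.1) _ _) hP
    (Finset.univ.filter fun j => ∃ p ∈ P, u j.1 x * u j.2 p - u j.2 x * u j.1 p ≠ 0)
    (by simp) hy huy
  have hsame : ∀ k, u k x * u k y' < 0 ↔ u k x * u k y < 0 := by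
    intro k
    have h := hs' k
    rcases lt_or_gt_of_ne (hux k) with h1 | h1 <;> rcases lt_or_gt_of_ne (huy k) with h2 | h2 <;>
      constructor <;> intro h3 <;> nlinarith
  have huy' : ∀ k, u k y' ≠ 0 := fun k h => by have := hs' k; simp [h] at this
  -- The sign change with the smallest parameter along the segment is the first crossing.
  obtain ⟨k₀, hk₀, hmin⟩ := Set.exists_min_image {k | u k x * u k y' < 0}
    (fun k => u k x / (u k x - u k y')) (Set.toFinite _)
    (by obtain ⟨k, hk⟩ := hsep; exact ⟨k, (hsame k).2 hk⟩)
  have hk₀ : u k₀ x * u k₀ y' < 0 := hk₀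
  set t := u k₀ x / (u k₀ x - u k₀ y') with ht
  have hd : ∀ k, u k x * u k y' < 0 → u k x - u k y' ≠ 0 := by
    intro k hk h
    have : u k x = u k y' := by linarith
    rw [this] at hk
    nlinarith [mul_self_nonneg (u k y')]
  have ratio : ∀ k, u k x * u k y' < 0 → 0 < u k x / (u k x - u k y') ∧
      u k x / (u k x - u k y') < 1 := by
    intro k hk
    rcases lt_or_gt_of_ne (hux k) with h | h
    · have h2 : 0 < u k y' := by nlinarith
      constructor
      · exact div_pos_of_neg_of_neg h (by linarith)
      · rw [div_lt_one_of_neg (by linarith)]; linarith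
    · have h2 : u k y' < 0 := by nlinarith
      constructor
      · exact div_pos h (by linarith)
      · rw [div_lt_one (by linarith)]; linarith
  obtain ⟨ht0, ht1⟩ := ratio k₀ hk₀
  have hm : ∀ k, u k (x + t • (y' - x)) = u k x + t * (u k y' - u k x) := fun k => hu k x y' t
  have hmz : u k₀ (x + t • (y' - x)) = 0 := by
    rw [hm, ht]
    field_simp [hd k₀ hk₀]
    ring
  have hzero : ∀ k, u k (x + t • (y' - x)) = 0 → u k x * u k y' < 0 := by
    intro k hk
    rw [hm] at hk
    have h1 : (1 - t) * (u k x * u k x) + t * (u k x * u k y') = 0 := by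
      have : ((1 - t) * u k x + t * u k y') * u k x = 0 := by
        rw [show (1 - t) * u k x + t * u k y' = 0 by linarith]; ring
      linarith
    have h2 := mul_pos (sub_pos.2 ht1) (mul_self_pos.2 (hux k))
    by_contra h
    nlinarith [mul_nonneg ht0.le (not_lt.1 h)]
  have hnz : ∀ k, u k (x + t • (y' - x)) ≠ 0 → 0 < u k (x + t • (y' - x)) * u k x := by
    intro k hk
    rw [hm] at hk ⊢
    by_cases h : u k x * u k y' < 0
    · have h1 : t ≤ u k x / (u k x - u k y') := hmin k h
      have h2 : u k x + t * (u k y' - u k x) =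
          (u k x / (u k x - u k y') - t) * (u k x - u k y') := by
        field_simp [hd k h]
        ring
      have h3 : 0 < u k x / (u k x - u k y') - t := by
        refine lt_of_le_of_ne (by linarith) fun h4 => hk ?_
        rw [h2, ← h4, zero_mul]
      have h4 : 0 < (u k x - u k y') * u k x := by nlinarith [mul_self_nonneg (u k x)]
      rw [h2]
      nlinarith [mul_pos h3 h4]
    · nlinarith [mul_pos (sub_pos.2 ht1) (mul_self_pos.2 (hux k)),
        mul_nonneg ht0.le (not_lt.1 h)]
  -- The point `x₁` is taken just beyond the crossing, before any other function changes sign.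
  have e1 : ∀ᶠ δ in 𝓝[>] (0 : ℝ), ∀ k, u k (x + t • (y' - x)) ≠ 0 →
      0 < (u k (x + t • (y' - x)) + δ * (u k y' - u k x)) * u k x := by
    rw [Filter.eventually_all]
    intro k
    by_cases h : u k (x + t • (y' - x)) = 0
    · simp [h]
    · filter_upwards [eventually_add_mul_pos (hnz k h) ((u k y' - u k x) * u k x)] with δ hδ _
      nlinarith
  obtain ⟨δ, hδ, hδ0⟩ := (e1.and self_mem_nhdsWithin).exists
  have hδ0 : 0 < δ := hδ0
  have hx1 : ∀ k, u k (x + (t + δ) • (y' - x)) =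
      u k (x + t • (y' - x)) + δ * (u k y' - u k x) := by
    intro k; rw [hu k x y', hm]; ring
  refine ⟨x + t • (y' - x), hP x hx y' hy' t, x + (t + δ) • (y' - x), hP x hx y' hy' _,
    ⟨k₀, hmz⟩, ?_, ?_, ?_⟩
  · intro k hk
    have h := hzero k hk
    refine ⟨(hsame k).1 h, ?_⟩
    rw [hx1, hk, zero_add]
    have h1 := hs' k
    have h2 := (hsame k).1 h
    have : 0 < (u k y' - u k x) * u k y := by nlinarith
    nlinarith [mul_pos hδ0 this]
  · intro k hk
    exact ⟨hnz k hk, by rw [hx1]; exact hδ k hk⟩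
  · intro k l hk hl p hp
    by_contra hne
    have := hgen (k, l) (by
      simp only [Finset.mem_filter, Finset.mem_univ, true_and]
      exact ⟨p, hp, sub_ne_zero.2 hne⟩)
    apply this
    rw [hm] at hk hl
    have : t * (u k x * u l y' - u l x * u k y') = 0 := by
      linear_combination u k x * hl - u l x * hk
    exact (mul_eq_zero.1 this).resolve_left ht0.ne'

end Generic

end Steinberg.GaugeData
end

noncomputable section

namespace Steinberg.GaugeData

/-! ### Objects attached to points -/

section Objects

open Filter Topology

variable {R X Y ι κ : Type*} [AddCommGroup X] [AddCommGroup Y] (D : GaugeData R X Y ι κ)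

lemma isAff_matterVal (i : ι) : IsAff (D.matterVal i) := D.matterVal_add_smul i

lemma isAff_rootVal (a : R) : IsAff (D.rootVal a) := D.rootVal_add_smul a

/-- All flavors, or one integral flavor. -/
def IsFlavorSet (Φ : Set (κ → ℝ)) : Prop :=
  Φ = Set.univ ∨ ∃ n : κ → ℤ, Φ = {fun c => (n c : ℝ)}

variable {Φ : Set (κ → ℝ)} (hΦ : IsFlavorSet Φ)

include hΦ in
lemma IsFlavorSet.isFlat : IsFlat {p : Point X κ | p.2 ∈ Φ} := by
  rcases hΦ with rfl | ⟨n, rfl⟩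
  · intro x _ y _ t; trivial
  · intro x hx y hy t
    simp only [Set.mem_singleton_iff, Set.mem_ofPred_eq] at hx hy ⊢
    simp [hx, hy]

include hΦ in
lemma IsFlavorSet.exists_int : ∃ n : κ → ℤ, (fun c => (n c : ℝ)) ∈ Φ := by
  rcases hΦ with rfl | ⟨n, rfl⟩
  · exact ⟨0, trivial⟩
  · exact ⟨n, rfl⟩

include hΦ in
/-- There is a point on all Coxeter hyperplanes and on no matter hyperplane. -/
lemma exists_center : ∃ p : Point X κ, p.2 ∈ Φ ∧ p.1 = 0 ∧ ∃ f : κ → ℝ, (∀ c, f c ≠ 0) ∧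
    ∀ i, D.matterVal i p = f (D.cls i) := by
  obtain ⟨n, hn⟩ := hΦ.exists_int
  refine ⟨(0, fun c => (n c : ℝ)), hn, rfl, fun c => n c - D.ε c, fun c => ?_, fun i => ?_⟩
  -- No integer lies strictly between `-1` and `0`.
  · obtain ⟨h1, h2⟩ := D.ε_mem c
    intro h
    have h3 : (n c : ℝ) = D.ε c := by linarith
    rw [← h3] at h1 h2
    have h4 : (-1 : ℤ) < n c := by exact_mod_cast h1
    have h5 : n c < (0 : ℤ) := by exact_mod_cast h2
    omega
  · simp [matterVal]

/-- The signs of the matter functions at a point. -/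
def sg (p : Point X κ) : ι → Bool := fun i => decide (0 < D.matterVal i p)

variable {D} in
lemma sg_eq_true {p : Point X κ} {i : ι} : D.sg p i = true ↔ 0 < D.matterVal i p := by
  simp [sg]

variable {D} in
lemma sg_eq_false {p : Point X κ} {i : ι} : D.sg p i = false ↔ D.matterVal i p ≤ 0 := by
  simp [sg]

lemma sg_eq_of_mul_pos {p q : Point X κ} {i : ι}
    (h : 0 < D.matterVal i p * D.matterVal i q) : D.sg p i = D.sg q i := by
  have : 0 < D.matterVal i p ↔ 0 < D.matterVal i q := by
    constructor <;> intro h' <;> by_contra h'' <;> nlinarith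
  simp [sg, this]

lemma sg_eq_not_of_mul_neg {p q : Point X κ} {i : ι}
    (h : D.matterVal i p * D.matterVal i q < 0) : D.sg p i = !D.sg q i := by
  by_cases h1 : 0 < D.matterVal i p
  · have h2 : D.matterVal i q ≤ 0 := by by_contra h2; nlinarith
    rw [sg_eq_true.2 h1, sg_eq_false.2 h2]; rfl
  · have h2 : 0 < D.matterVal i q := by by_contra h2; nlinarith
    rw [sg_eq_false.2 (not_lt.1 h1), sg_eq_true.2 h2]; rfl

lemma mul_pos_of_sg_eq {p q : Point X κ} {i : ι} (hp : D.matterVal i p ≠ 0)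
    (hq : D.matterVal i q ≠ 0) (h : D.sg p i = D.sg q i) :
    0 < D.matterVal i p * D.matterVal i q := by
  rcases lt_or_gt_of_ne (mul_ne_zero hp hq) with h' | h'
  · rw [D.sg_eq_not_of_mul_neg h'] at h
    cases hh : D.sg q i <;> simp [hh] at h
  · exact h'

lemma mul_neg_of_sg_ne {p q : Point X κ} {i : ι} (hp : D.matterVal i p ≠ 0)
    (hq : D.matterVal i q ≠ 0) (h : D.sg p i ≠ D.sg q i) :
    D.matterVal i p * D.matterVal i q < 0 := by
  rcases lt_or_gt_of_ne (mul_ne_zero hp hq) with h' | h'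
  · exact h'
  · exact absurd (D.sg_eq_of_mul_pos h') h

variable (Φ) in
/-- A point of the closed positive Weyl chamber on no matter hyperplane. -/
structure Face (p : Point X κ) : Prop where
  flavor : p.2 ∈ Φ
  matter : ∀ i, D.matterVal i p ≠ 0
  root : ∀ a ∈ D.base.support, 0 ≤ D.rootVal a p

lemma mem_chamber_iff {p : Point X κ} {s : ι → Bool} :
    p ∈ D.chamber Φ s ↔ p.2 ∈ Φ ∧ (∀ i, D.matterVal i p ≠ 0) ∧ s = D.sg p := by
  constructor
  · rintro ⟨h1, h2⟩
    refine ⟨h1, fun i => ?_, funext fun i => ?_⟩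
    · have := h2 i
      split_ifs at this <;> linarith
    · have := h2 i
      split_ifs at this with h
      · rw [h, eq_comm, sg_eq_true]; exact this
      · rw [Bool.not_eq_true] at h
        rw [h, eq_comm, sg_eq_false]; exact this.le
  · rintro ⟨h1, h2, rfl⟩
    refine ⟨h1, fun i => ?_⟩
    split_ifs with h
    · exact sg_eq_true.1 h
    · rw [Bool.not_eq_true, sg_eq_false] at h
      exact lt_of_le_of_ne h (h2 i)

lemma mem_posChamber_iff {p : Point X κ} {s : ι → Bool} :
    p ∈ D.posChamber Φ s ↔
      p.2 ∈ Φ ∧ (∀ i, D.matterVal i p ≠ 0) ∧ s = D.sg p ∧ D.Dominant p := by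
  change (p ∈ D.chamber Φ s ∧ _) ↔ _
  rw [mem_chamber_iff]
  tauto

variable {D} in
lemma Obj.exists_point (σ : D.Obj Φ) : ∃ x, x ∈ D.posChamber Φ σ.sgn := by
  obtain ⟨n, -, γ, h⟩ := σ.feasible
  exact ⟨_, h⟩

variable [Finite ι]

include hΦ in
-- If all flavors are allowed, dilate by a large `N` about a point with `γ = 0` and flavor `ε`,
-- where all matter functions vanish, and round the flavors. The matter functions then exceed `1` in
-- absolute value and rounding changes them by at most `1/2`.
lemma feasible_of_mem {p : Point X κ} {s : ι → Bool} (hp : p ∈ D.posChamber Φ s) :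
    ∃ n : κ → ℤ, (fun c => (n c : ℝ)) ∈ Φ ∧
      ∃ γ : X →ₗ[ℤ] ℝ, (γ, fun c => (n c : ℝ)) ∈ D.posChamber Φ s := by
  rcases hΦ with rfl | ⟨n, rfl⟩
  · obtain ⟨-, h2, rfl, h4⟩ := D.mem_posChamber_iff.1 hp
    have e1 : ∀ᶠ N : ℝ in atTop, ∀ i, 1 < N * |D.matterVal i p| := by
      rw [Filter.eventually_all]
      intro i
      exact (tendsto_id.atTop_mul_const (abs_pos.2 (h2 i))).eventually_gt_atTop 1
    obtain ⟨N, hN, hN0⟩ := (e1.and (eventually_gt_atTop 0)).exists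
    let n : κ → ℤ := fun c => round (N * (p.2 c - D.ε c) + D.ε c)
    have key : ∀ i, 0 < D.matterVal i (N • p.1, fun c => (n c : ℝ)) * D.matterVal i p := by
      intro i
      have h := abs_sub_round (N * (p.2 (D.cls i) - D.ε (D.cls i)) + D.ε (D.cls i))
      rw [abs_le] at h
      have e : D.matterVal i (N • p.1, fun c => (n c : ℝ)) = N * D.matterVal i p +
          (n (D.cls i) - (N * (p.2 (D.cls i) - D.ε (D.cls i)) + D.ε (D.cls i))) := by
        simp [matterVal]; ring
      rw [e]
      have h1 := hN i
      change _ ≤ _ - ((n (D.cls i) : ℤ) : ℝ) ∧ _ - ((n (D.cls i) : ℤ) : ℝ) ≤ _ at h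
      rcases lt_or_gt_of_ne (h2 i) with h3 | h3
      · rw [abs_of_neg h3] at h1
        apply mul_pos_of_neg_of_neg _ h3
        linarith
      · rw [abs_of_pos h3] at h1
        apply mul_pos _ h3
        linarith
    refine ⟨n, trivial, N • p.1, D.mem_posChamber_iff.2 ⟨trivial, fun i h => ?_, ?_, ?_⟩⟩
    · have := key i
      simp [h] at this
    · exact funext fun i => (D.sg_eq_of_mul_pos (key i)).symm
    · intro a ha
      have : D.rootVal a (N • p.1, fun c => (n c : ℝ)) = N * D.rootVal a p := by simp [rootVal]
      rw [this]
      exact mul_pos hN0 (h4 a ha)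
  · refine ⟨n, rfl, p.1, ?_⟩
    have h := (D.mem_posChamber_iff.1 hp).1
    rw [Set.mem_singleton_iff] at h
    have e : (p.1, fun c => (n c : ℝ)) = p := Prod.ext rfl h.symm
    rw [e]
    exact hp

variable {D}

include hΦ in
-- A small move towards a cocharacter that is `1` on all simple roots enters the open Weyl chamber
-- and crosses no matter hyperplane.
lemma Face.feasible {p : Point X κ} (hp : D.Face Φ p) : ∃ x, x ∈ D.posChamber Φ (D.sg p) := by
  obtain ⟨h, hh⟩ := D.exists_functional fun _ => 1
  have e1 : ∀ᶠ δ in 𝓝[>] (0 : ℝ), ∀ i,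
      0 < D.matterVal i (p + δ • ((h, p.2) - p)) * D.matterVal i p := by
    rw [Filter.eventually_all]
    intro i
    simp only [matterVal_add_smul]
    exact eventually_same_sign (hp.matter i) _
  obtain ⟨δ, h1, h2, h3⟩ := (e1.and (eventually_lt_one.and self_mem_nhdsWithin)).exists
  have h3 : 0 < δ := h3
  refine ⟨p + δ • ((h, p.2) - p), D.mem_posChamber_iff.2
    ⟨hΦ.isFlat p hp.flavor (h, p.2) hp.flavor δ, fun i h0 => ?_, ?_, ?_⟩⟩
  · have := h1 i; simp [h0] at this
  · exact funext fun i => (D.sg_eq_of_mul_pos (h1 i)).symm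
  · intro a ha
    rw [rootVal_add_smul]
    have e : D.rootVal a (h, p.2) = 1 := hh ⟨a, ha⟩
    rw [e]
    nlinarith [hp.root a ha]

/-- The object whose chamber contains a given point. -/
def objAt {p : Point X κ} (hp : D.Face Φ p) : D.Obj Φ where
  sgn := D.sg p
  feasible := by
    obtain ⟨x, hx⟩ := hp.feasible hΦ
    exact D.feasible_of_mem hΦ hx

variable (D) in
lemma act_eq_self {a : R} {p : Point X κ} (h : D.rootVal a p = 0) :
    act (D.roots.reflection a) p = p := by
  ext1
  · ext χ
    change p.1 ((D.roots.reflection a).symm χ) = p.1 χ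
    have : (D.roots.reflection a).symm χ = D.roots.reflection a χ := rfl
    rw [this, RootPairing.reflection_apply, map_sub, map_smul]
    change p.1 (D.roots.root a) = 0 at h
    rw [h]; simp
  · rfl

lemma act_mem_chamber {a : R} {p q : Point X κ} (hp : D.rootVal a p = 0)
    (hp0 : ∀ i, D.matterVal i p ≠ 0) (hq : q ∈ D.chamber Φ (D.sg p)) :
    act (D.roots.reflection a) q ∈ D.chamber Φ (D.sg p) := by
  obtain ⟨h1, h2, h3⟩ := D.mem_chamber_iff.1 hq
  have key : ∀ i, 0 < D.matterVal i (act (D.roots.reflection a) q) * D.matterVal i p := by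
    intro i
    obtain ⟨i', hc, hw⟩ := D.exists_reflect a i
    rw [D.matterVal_act hc.symm (D.reflect_symm hw)]
    nth_rw 1 [← D.act_eq_self hp]
    rw [D.matterVal_act hc.symm (D.reflect_symm hw)]
    exact D.mul_pos_of_sg_eq (h2 i') (hp0 i') (congrFun h3 i').symm
  refine D.mem_chamber_iff.2 ⟨h1, fun i h0 => ?_, funext fun i => ?_⟩
  · have := key i; simp [h0] at this
  · exact (D.sg_eq_of_mul_pos (key i)).symm

/-- The reflection fixes `p` and permutes the matter functions, so it preserves the chamber of `p`.
-/
lemma stable_of_rootVal_eq_zero {a : R} {p : Point X κ} (hp : D.rootVal a p = 0)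
    (hp0 : ∀ i, D.matterVal i p ≠ 0) : D.Stable Φ a (D.sg p) := by
  apply Set.Subset.antisymm
  · rintro _ ⟨q, hq, rfl⟩
    exact act_mem_chamber hp hp0 hq
  · intro q hq
    exact ⟨_, act_mem_chamber hp hp0 hq, D.act_reflection_act a q⟩

variable [Finite R]

include hΦ in
-- Take the midpoint of `x` and `s_a x`: both lie in the convex chamber, and the other simple roots
-- are positive at both.
lemma Stable.exists_face {a : D.base.support} {σ : D.Obj Φ} (h : D.Stable Φ a σ.sgn) :
    ∃ p, D.Face Φ p ∧ D.sg p = σ.sgn ∧ D.rootVal a p = 0 ∧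
      ∀ b ∈ D.base.support, b ≠ a → 0 < D.rootVal b p := by
  obtain ⟨x, hx⟩ := σ.exists_point
  obtain ⟨h1, h2, h3, h4⟩ := D.mem_posChamber_iff.1 hx
  have hsx : act (D.roots.reflection a) x ∈ D.chamber Φ σ.sgn := by
    rw [← h]; exact ⟨x, hx.1, rfl⟩
  obtain ⟨h1', h2', h3'⟩ := D.mem_chamber_iff.1 hsx
  set y := act (D.roots.reflection a) x with hy
  have key : ∀ i, 0 < D.matterVal i (x + (1 / 2 : ℝ) • (y - x)) * D.matterVal i x := by
    intro i
    have h5 := D.mul_pos_of_sg_eq (h2' i) (h2 i) (by rw [← h3, ← h3'])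
    rw [matterVal_add_smul]
    nlinarith [mul_self_pos.2 (h2 i)]
  have ha : D.rootVal a (x + (1 / 2 : ℝ) • (y - x)) = 0 := by
    rw [rootVal_add_smul, hy, rootVal_act, rootVal_reflect_self]; ring
  have hb : ∀ b ∈ D.base.support, b ≠ a → 0 < D.rootVal b (x + (1 / 2 : ℝ) • (y - x)) := by
    intro b hb hba
    have h5 := h4 b hb
    have h6 : 0 < D.rootVal b y := by
      rw [hy, rootVal_act]
      exact D.rootVal_pos (D.isPos_reflect (D.base.isPos_of_mem_support hb) a.2 hba) h4
    rw [rootVal_add_smul]; linarith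
  refine ⟨_, ⟨hΦ.isFlat x h1 y h1' _, fun i h0 => ?_, fun b hb' => ?_⟩, ?_, ha, hb⟩
  · have := key i
    rw [h0, zero_mul] at this
    exact lt_irrefl _ this
  · by_cases hba : b = a
    · rw [hba, ha]
    · exact (hb b hb' hba).le
  · rw [h3]; exact funext fun i => D.sg_eq_of_mul_pos (key i)

end Objects

/-! ### Paths -/

section PathGeometry

variable {R X Y ι κ : Type*} [AddCommGroup X] [AddCommGroup Y] (D : GaugeData R X Y ι κ)

/-- The functions defining all the hyperplanes. -/
def val : ι ⊕ R → Point X κ → ℝ := Sum.elim D.matterVal D.rootVal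

lemma isAff_val (k : ι ⊕ R) : IsAff (D.val k) := by
  rcases k with i | a
  · exact D.isAff_matterVal i
  · exact D.isAff_rootVal a

variable (Φ : Set (κ → ℝ))

/-- All the hyperplanes. -/
def hyp (k : ι ⊕ R) : Set (Point X κ) := {x | x.2 ∈ Φ ∧ D.val k x = 0}

lemma crossed_eq (x y : Point X κ) :
    D.crossed Φ x y = D.hyp Φ '' {k | D.val k x * D.val k y < 0} := by
  ext H
  constructor
  · rintro (⟨i, rfl, h⟩ | ⟨a, rfl, h⟩)
    · exact ⟨.inl i, h, rfl⟩
    · exact ⟨.inr a, h, rfl⟩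
  · rintro ⟨i | a, h, rfl⟩
    · exact .inl ⟨i, rfl, h⟩
    · exact .inr ⟨a, rfl, h⟩

variable {Φ}

lemma regular_iff {x : Point X κ} : D.Regular Φ x ↔ x.2 ∈ Φ ∧ ∀ k, D.val k x ≠ 0 := by
  simp [Regular, val]

variable (hΦ : IsFlavorSet Φ)

variable {D} in
include hΦ in
-- Crossed hyperplanes are recorded as sets, and several weights or roots may define the same set.
-- The segment meets that set in a point which is a zero of each of these functions, so that they
-- change sign together.
lemma hyp_mem_crossed {x y : Point X κ} (hx : D.Regular Φ x) (hy : D.Regular Φ y) (k : ι ⊕ R) :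
    D.hyp Φ k ∈ D.crossed Φ x y ↔ D.val k x * D.val k y < 0 := by
  rw [regular_iff] at hx hy
  rw [crossed_eq]
  refine ⟨?_, fun h => ⟨k, h, rfl⟩⟩
  rintro ⟨l, hl, e⟩
  have hl : D.val l x * D.val l y < 0 := hl
  have hd : D.val l x - D.val l y ≠ 0 := by
    intro h
    rw [sub_eq_zero.1 h] at hl
    nlinarith [mul_self_nonneg (D.val l y)]
  set t := D.val l x / (D.val l x - D.val l y) with ht
  have h0 : D.val l (x + t • (y - x)) = 0 := by
    rw [D.isAff_val l, ht]; field_simp; ring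
  have hm : x + t • (y - x) ∈ D.hyp Φ k := by
    rw [← e]
    exact ⟨hΦ.isFlat x hx.1 y hy.1 t, h0⟩
  have hk := hm.2
  rw [D.isAff_val k] at hk
  have ht01 : 0 < t ∧ t < 1 := by
    rcases lt_or_gt_of_ne (hx.2 l) with h | h
    · have h2 : 0 < D.val l y := by nlinarith
      exact ⟨div_pos_of_neg_of_neg h (by linarith), by rw [ht, div_lt_one_of_neg] <;> linarith⟩
    · have h2 : D.val l y < 0 := by nlinarith
      exact ⟨div_pos h (by linarith), by rw [ht, div_lt_one] <;> linarith⟩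
  by_contra hn
  have h1 : ((1 - t) * D.val k x + t * D.val k y) * D.val k x = 0 := by
    rw [show (1 - t) * D.val k x + t * D.val k y = 0 by linarith]; ring
  nlinarith [mul_pos (sub_pos.2 ht01.2) (mul_self_pos.2 (hx.2 k)),
    mul_nonneg ht01.1.le (not_lt.1 hn)]

variable [Finite R] [Finite ι]

lemma crossed_finite (x y : Point X κ) : (D.crossed Φ x y).Finite := by
  rw [crossed_eq]; exact Set.toFinite _

variable {D}

include hΦ in
lemma crossed_subset {x y z : Point X κ} (hx : D.Regular Φ x) (hy : D.Regular Φ y)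
    (hz : D.Regular Φ z) : D.crossed Φ x z ⊆ D.crossed Φ x y ∪ D.crossed Φ y z := by
  intro H hH
  rw [crossed_eq] at hH
  obtain ⟨k, hk, rfl⟩ := hH
  have hk : D.val k x * D.val k z < 0 := hk
  rw [Set.mem_union, hyp_mem_crossed hΦ hx hy, hyp_mem_crossed hΦ hy hz]
  have h := (D.regular_iff.1 hy).2 k
  by_contra! hc
  have h1 := mul_nonneg hc.1 hc.2
  have h2 := mul_self_pos.2 h
  nlinarith

include hΦ in
-- Cross the first hyperplane on a generic segment and repeat. By genericity the functions vanishing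
-- at the crossing are proportional, hence define a single hyperplane, so this is a legitimate step;
-- afterwards that hyperplane no longer separates.
lemma exists_geodesic {x y : Point X κ} (hx : D.Regular Φ x) (hy : D.Regular Φ y) :
    ∃ (q : List (Point X κ)) (y' : Point X κ), (x :: q).IsChain (D.Step Φ) ∧
      (x :: q).getLast? = some y' ∧ y'.2 ∈ Φ ∧ (∀ k, 0 < D.val k y' * D.val k y) ∧
      q.length = (D.crossed Φ x y).ncard := by
  induction hn : {k | D.val k x * D.val k y < 0}.ncard using Nat.strong_induction_on
    generalizing x with
  | _ n ih =>
    have hx' := D.regular_iff.1 hx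
    have hy' := D.regular_iff.1 hy
    by_cases hsep : ∃ k, D.val k x * D.val k y < 0
    · obtain ⟨m, hm, x₁, hx₁, ⟨k₀, hk₀⟩, h1, h2, h3⟩ := exists_first_crossing D.isAff_val
        hΦ.isFlat hx'.1 hy'.1 hx'.2 hy'.2 hsep
      have hx₁' : D.Regular Φ x₁ := by
        refine D.regular_iff.2 ⟨hx₁, fun k h0 => ?_⟩
        by_cases hk : D.val k m = 0
        · have := (h1 k hk).2; simp [h0] at this
        · have := (h2 k hk).2; simp [h0] at this
      have e1 : ∀ k, D.val k x * D.val k x₁ < 0 ↔ D.val k m = 0 := by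
        intro k
        constructor
        · intro h
          by_contra hk
          have := (h2 k hk).2
          linarith
        · intro hk
          obtain ⟨h4, h5⟩ := h1 k hk
          by_contra h6
          have h7 := mul_nonneg (not_lt.1 h6) h5.le
          nlinarith [mul_self_pos.2 ((D.regular_iff.1 hx₁').2 k)]
      have e2 : ∀ k, D.val k x * D.val k y < 0 ↔
          D.val k m = 0 ∨ D.val k x₁ * D.val k y < 0 := by
        intro k
        by_cases hk : D.val k m = 0
        · exact ⟨fun _ => .inl hk, fun _ => (h1 k hk).1⟩
        · have h4 := (h2 k hk).2
          have := mul_self_pos.2 (hy'.2 k)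
          constructor
          · intro h
            right
            by_contra h5
            nlinarith [mul_nonneg h4.le (not_lt.1 h5), mul_self_pos.2 ((D.regular_iff.1 hx₁').2 k)]
          · rintro (h | h)
            · exact absurd h hk
            · by_contra h5
              nlinarith [mul_nonneg h4.le (not_lt.1 h5), mul_self_pos.2 (hx'.2 k)]
      have hstep : D.crossed Φ x x₁ = {D.hyp Φ k₀} := by
        rw [crossed_eq]
        ext H
        simp only [Set.mem_image, Set.mem_ofPred_eq, Set.mem_singleton_iff, e1]
        constructor
        · rintro ⟨k, hk, rfl⟩
          ext p
          have h4 := h3 k k₀ hk hk₀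
          constructor
          · rintro ⟨hp, hp0⟩
            have := h4 p hp
            rw [hp0, mul_zero] at this
            exact ⟨hp, (mul_eq_zero.1 this).resolve_left (hx'.2 k)⟩
          · rintro ⟨hp, hp0⟩
            have := h4 p hp
            rw [hp0, mul_zero] at this
            exact ⟨hp, (mul_eq_zero.1 this.symm).resolve_left (hx'.2 k₀)⟩
        · rintro rfl
          exact ⟨k₀, hk₀, rfl⟩
      have hk₁ : D.hyp Φ k₀ ∉ D.crossed Φ x₁ y := by
        rw [hyp_mem_crossed hΦ hx₁' hy]
        exact not_lt.2 (h1 k₀ hk₀).2.le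
      have hcr : D.crossed Φ x y = insert (D.hyp Φ k₀) (D.crossed Φ x₁ y) := by
        rw [Set.insert_eq, ← hstep]
        simp only [crossed_eq, ← Set.image_union]
        congr 1
        ext k
        simp only [Set.mem_ofPred_eq, Set.mem_union, e1, e2]
      have hlt : {k | D.val k x₁ * D.val k y < 0}.ncard < n := by
        rw [← hn]
        refine Set.ncard_lt_ncard ⟨fun k hk => (e2 k).2 (.inr hk), fun h => ?_⟩ (Set.toFinite _)
        have : D.val k₀ x₁ * D.val k₀ y < 0 := h (a := k₀) ((e2 k₀).2 (.inl hk₀))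
        have := (h1 k₀ hk₀).2
        linarith
      obtain ⟨q, y', hq1, hq2, hq3, hq4, hq5⟩ := ih _ hlt hx₁' rfl
      refine ⟨x₁ :: q, y', ?_, ?_, hq3, hq4, ?_⟩
      · rw [List.isChain_cons_cons]
        exact ⟨⟨hx, hx₁', _, hstep⟩, hq1⟩
      · rw [List.getLast?_cons_cons]; exact hq2
      · rw [hcr, Set.ncard_insert_of_notMem hk₁ (D.crossed_finite _ _), List.length_cons, hq5]
    · push Not at hsep
      refine ⟨[], x, List.isChain_singleton _, rfl, hx'.1, fun k => ?_, ?_⟩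
      · exact lt_of_le_of_ne (hsep k) (mul_ne_zero (hx'.2 k) (hy'.2 k)).symm
      · rw [List.length_nil, eq_comm, Set.ncard_eq_zero (D.crossed_finite _ _), crossed_eq,
          Set.image_eq_empty]
        ext k
        simpa using hsep k

lemma regular_of_chain {x y : Point X κ} {q : List (Point X κ)} (hx : D.Regular Φ x)
    (h : (x :: q).IsChain (D.Step Φ)) (hy : (x :: q).getLast? = some y) : D.Regular Φ y := by
  induction q generalizing x with
  | nil => simp at hy; rwa [← hy]
  | cons z q ih =>
    rw [List.isChain_cons_cons] at h
    rw [List.getLast?_cons_cons] at hy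
    exact ih h.1.2.1 h.2 hy

include hΦ in
-- Every hyperplane separating the ends is crossed by some step, and each step crosses just one.
lemma ncard_crossed_le {x y : Point X κ} {q : List (Point X κ)} (hx : D.Regular Φ x)
    (h : (x :: q).IsChain (D.Step Φ)) (hy : (x :: q).getLast? = some y) :
    (D.crossed Φ x y).ncard ≤ q.length := by
  induction q generalizing x with
  | nil =>
    simp at hy
    rw [← hy, List.length_nil, Nat.le_zero, Set.ncard_eq_zero (D.crossed_finite _ _), crossed_eq,
      Set.image_eq_empty]
    ext k
    simp [mul_self_nonneg]
  | cons z q ih =>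
    rw [List.isChain_cons_cons] at h
    have hy0 := hy
    rw [List.getLast?_cons_cons] at hy
    obtain ⟨-, hz, H, hH⟩ := h.1
    have h1 := ih hz h.2 hy
    have hyr := regular_of_chain hz h.2 hy
    have h2 := crossed_subset hΦ hx hz hyr
    have h3 := Set.ncard_le_ncard h2 ((D.crossed_finite _ _).union (D.crossed_finite _ _))
    have h4 := Set.ncard_union_le (D.crossed Φ x z) (D.crossed Φ z y)
    have h5 : (D.crossed Φ x z).ncard = 1 := by rw [hH, Set.ncard_singleton]
    rw [List.length_cons]
    omega

include hΦ in
/-- A geodesic path does not cross a hyperplane twice. -/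
lemma geodesic_tail {x z y : Point X κ} {q : List (Point X κ)} (hx : D.Regular Φ x)
    (h : (x :: z :: q).IsChain (D.Step Φ)) (hy : (x :: z :: q).getLast? = some y)
    (hl : q.length + 1 ≤ (D.crossed Φ x y).ncard) :
    q.length ≤ (D.crossed Φ z y).ncard ∧
      ∀ k, D.val k x * D.val k z < 0 → 0 < D.val k z * D.val k y := by
  rw [List.isChain_cons_cons] at h
  rw [List.getLast?_cons_cons] at hy
  obtain ⟨-, hz, H, hH⟩ := h.1
  have hyr := regular_of_chain hz h.2 hy
  have h2 := crossed_subset hΦ hx hz hyr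
  have h3 := Set.ncard_le_ncard h2 ((D.crossed_finite _ _).union (D.crossed_finite _ _))
  have h4 := Set.ncard_union_le (D.crossed Φ x z) (D.crossed Φ z y)
  have h5 : (D.crossed Φ x z).ncard = 1 := by rw [hH, Set.ncard_singleton]
  refine ⟨by omega, fun k hk => ?_⟩
  have hkm : D.hyp Φ k ∈ D.crossed Φ x z := (hyp_mem_crossed hΦ hx hz k).2 hk
  have hn : ¬ D.val k z * D.val k y < 0 := by
    rw [← hyp_mem_crossed hΦ hz hyr]
    intro hk'
    have h6 : D.crossed Φ x z ⊆ D.crossed Φ z y := by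
      rw [hH] at hkm ⊢
      rw [Set.mem_singleton_iff] at hkm
      rw [← hkm]
      exact Set.singleton_subset_iff.2 hk'
    rw [Set.union_eq_self_of_subset_left h6] at h3
    have := ncard_crossed_le hΦ hz h.2 hy
    omega
  exact lt_of_le_of_ne (not_lt.1 hn)
    (mul_ne_zero ((D.regular_iff.1 hz).2 k) ((D.regular_iff.1 hyr).2 k)).symm

lemma image_hyp (a : R) (k : ι ⊕ R) : ∃ l, (∀ x, D.val l (act (D.roots.reflection a) x) =
    D.val k x) ∧ act (D.roots.reflection a) '' D.hyp Φ k = D.hyp Φ l := by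
  obtain ⟨l, hl⟩ : ∃ l, ∀ x, D.val l (act (D.roots.reflection a) x) = D.val k x := by
    rcases k with i | b
    · obtain ⟨i', hc, hw⟩ := D.exists_reflect a i
      exact ⟨.inl i', D.matterVal_act hc hw⟩
    · refine ⟨.inr (D.roots.reflectionPerm a b), fun x => ?_⟩
      exact (D.rootVal_act a _ x).trans (by rw [reflectionPerm_reflectionPerm]; rfl)
  refine ⟨l, hl, ?_⟩
  ext x
  constructor
  · rintro ⟨y, ⟨h1, h2⟩, rfl⟩
    exact ⟨h1, (hl y).trans h2⟩
  · rintro ⟨h1, h2⟩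
    refine ⟨act (D.roots.reflection a) x, ⟨h1, ?_⟩, D.act_reflection_act a x⟩
    rw [← hl, act_reflection_act]
    exact h2

lemma crossed_act_subset (a : R) (x y : Point X κ) :
    Set.image (act (D.roots.reflection a)) '' D.crossed Φ x y ⊆
      D.crossed Φ (act (D.roots.reflection a) x) (act (D.roots.reflection a) y) := by
  rintro _ ⟨H, hH, rfl⟩
  rw [crossed_eq] at hH ⊢
  obtain ⟨k, hk, rfl⟩ := hH
  obtain ⟨l, hl, e⟩ := D.image_hyp (Φ := Φ) a k
  refine ⟨l, ?_, e.symm⟩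
  change D.val l _ * D.val l _ < 0
  rw [hl, hl]
  exact hk

lemma image_act_image_act (a : R) (H : Set (Point X κ)) :
    act (D.roots.reflection a) '' (act (D.roots.reflection a) '' H) = H := by
  rw [Set.image_image]
  simp [act_reflection_act]

lemma crossed_act (a : R) (x y : Point X κ) :
    D.crossed Φ (act (D.roots.reflection a) x) (act (D.roots.reflection a) y) =
      Set.image (act (D.roots.reflection a)) '' D.crossed Φ x y := by
  apply Set.Subset.antisymm _ (D.crossed_act_subset a x y)
  intro H hH
  have := D.crossed_act_subset a _ _ (Set.mem_image_of_mem _ hH)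
  rw [act_reflection_act, act_reflection_act] at this
  exact ⟨_, this, image_act_image_act a H⟩

lemma regular_act (a : R) {x : Point X κ} (h : D.Regular Φ x) :
    D.Regular Φ (act (D.roots.reflection a) x) := by
  rw [regular_iff] at h ⊢
  refine ⟨h.1, fun k => ?_⟩
  obtain ⟨l, hl, -⟩ := D.image_hyp (Φ := Φ) a k
  have := hl (act (D.roots.reflection a) x)
  rw [act_reflection_act] at this
  rw [← this]
  exact h.2 l

lemma step_act (a : R) {x y : Point X κ} (h : D.Step Φ x y) :
    D.Step Φ (act (D.roots.reflection a) x) (act (D.roots.reflection a) y) := by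
  obtain ⟨h1, h2, H, hH⟩ := h
  refine ⟨D.regular_act a h1, D.regular_act a h2, act (D.roots.reflection a) '' H, ?_⟩
  rw [crossed_act, hH, Set.image_singleton]

lemma ncard_crossed_act (a : R) (x y : Point X κ) :
    (D.crossed Φ (act (D.roots.reflection a) x) (act (D.roots.reflection a) y)).ncard =
      (D.crossed Φ x y).ncard := by
  rw [crossed_act]
  apply Set.ncard_image_of_injective
  intro H H' h
  have := congrArg (Set.image (act (D.roots.reflection a))) h
  simpa only [image_act_image_act] using this

lemma chain_act (a : R) {p : List (Point X κ)} (h : p.IsChain (D.Step Φ)) :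
    (p.map (act (D.roots.reflection a))).IsChain (D.Step Φ) := by
  rw [List.isChain_map]
  exact h.imp fun x y hxy => D.step_act a hxy

end PathGeometry

end Steinberg.GaugeData
end

noncomputable section

namespace Steinberg.GaugeData

/-! ### Geodesic lists of turns -/

section Good

variable {R X Y ι κ : Type*} [AddCommGroup X] [AddCommGroup Y] {D : GaugeData R X Y ι κ}
  {Φ : Set (κ → ℝ)} (hΦ : IsFlavorSet Φ)

/-- `Good σ σ' v l`: there is a geodesic from `C'_{σ',1}` to the point `v` of the Weyl group orbit
of `C'_{σ,1}` whose folding has the turns `l`. -/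
def Good (σ : D.Obj Φ) : D.Obj Φ → Point X κ → List (D.Turn Φ) → Prop
  | _, v, [] => v ∈ D.posChamber Φ σ.sgn
  | σ', v, t :: l => D.rootVal t.root v < 0 ∧
      (∀ i, σ'.sgn i = D.sg v i → t.obj.sgn i = D.sg v i) ∧
      Good σ t.obj (act (D.roots.reflection t.root) v) l

/-- The translates of the points of the chamber of `σ` under the Weyl group. -/
def Target (σ : D.Obj Φ) (v : Point X κ) : Prop :=
  ∃ w : D.roots.weylGroup, ∃ z ∈ D.posChamber Φ σ.sgn, v = D.weylAct w z

variable {σ σ' τ : D.Obj Φ} {v : Point X κ}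

lemma Target.act (h : Target σ v) (a : R) : Target σ (act (D.roots.reflection a) v) := by
  obtain ⟨w, z, hz, rfl⟩ := h
  exact ⟨D.sref a * w, z, hz, by rw [weylAct_mul, weylAct_sref]⟩

lemma Target.weylAct (h : Target σ v) (w : D.roots.weylGroup) : Target σ (D.weylAct w v) := by
  obtain ⟨w', z, hz, rfl⟩ := h
  exact ⟨w * w', z, hz, by rw [weylAct_mul]⟩

lemma Good.of_prefix {l : List (D.Turn Φ)} (h : Good σ σ' v l)
    (hp : ∀ i, τ.sgn i = D.sg v i → σ'.sgn i = D.sg v i) : Good σ τ v l := by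
  cases l with
  | nil => exact h
  | cons t l => exact ⟨h.1, fun i hi => h.2.1 i (hp i hi), h.2.2⟩

lemma regular_of_mem [Finite R] {x : Point X κ} {s : ι → Bool} (hx : x ∈ D.posChamber Φ s) :
    D.Regular Φ x := by
  obtain ⟨h1, h2, -, h4⟩ := D.mem_posChamber_iff.1 hx
  exact ⟨h1, h2, D.rootVal_ne_zero h4⟩

variable [Finite R] [Finite ι]

lemma regular_weylAct {x : Point X κ} (hx : D.Regular Φ x) (w : D.roots.weylGroup) :
    D.Regular Φ (D.weylAct w x) := by
  obtain ⟨L, -, rfl⟩ := D.exists_wordProd w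
  induction L with
  | nil => simpa [wordProd, weylAct_one] using hx
  | cons a L ih =>
    rw [wordProd_cons, weylAct_mul, weylAct_sref]
    exact regular_act a ih

lemma Target.regular (h : Target σ v) : D.Regular Φ v := by
  obtain ⟨w, z, hz, rfl⟩ := h
  exact regular_weylAct (regular_of_mem hz) w

/-- A regular point with the signs of a translate of `C'_{σ,1}` lies in it. -/
lemma Target.of_same_signs {w : D.roots.weylGroup} {z v' : Point X κ}
    (hz : z ∈ D.posChamber Φ σ.sgn) (hv' : v'.2 ∈ Φ)
    (h : ∀ k, 0 < D.val k v' * D.val k (D.weylAct w z)) :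
    ∃ z' ∈ D.posChamber Φ σ.sgn, v' = D.weylAct w z' := by
  obtain ⟨h1, h2, h3, h4⟩ := D.mem_posChamber_iff.1 hz
  refine ⟨D.weylAct w⁻¹ v', D.mem_posChamber_iff.2 ?_, by
    rw [← weylAct_mul, mul_inv_cancel, weylAct_one]⟩
  have e : v' = D.weylAct w (D.weylAct w⁻¹ v') := by
    rw [← weylAct_mul, mul_inv_cancel, weylAct_one]
  obtain ⟨p, hp⟩ := D.weyl_perm w
  have key : ∀ i, 0 < D.matterVal i (D.weylAct w⁻¹ v') * D.matterVal i z := by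
    intro i
    have := h (.inl (p i))
    rw [e] at this
    change 0 < D.matterVal _ _ * D.matterVal _ _ at this
    rwa [D.matterVal_weylAct hp, D.matterVal_weylAct hp] at this
  refine ⟨hv', fun i h0 => ?_, ?_, fun a ha => ?_⟩
  · have := key i; simp [h0] at this
  · rw [h3]; exact funext fun i => (D.sg_eq_of_mul_pos (key i)).symm
  · have := h (.inr (D.idx w a))
    rw [e] at this
    change 0 < D.rootVal _ _ * D.rootVal _ _ at this
    rw [rootVal_weylAct, rootVal_weylAct] at this
    exact pos_of_mul_pos_left this (h4 a ha).le

/-- Each turn is a reflection in a simple root that is negative at `v`, which lowers the count by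
one; the list ends at a dominant point, where the count is zero. -/
lemma Good.length {l : List (D.Turn Φ)} (h : Good σ σ' v l) : l.length = D.negCount v := by
  induction l generalizing σ' v with
  | nil => exact (D.negCount_dominant h.2).symm
  | cons t l ih =>
    rw [List.length_cons, ih h.2.2, D.negCount_reflect t.root.2 h.1]

lemma Good.target_eq_one {w : D.roots.weylGroup} {z : Point X κ} (hz : z ∈ D.posChamber Φ σ.sgn)
    (h : Good σ σ' (D.weylAct w z) []) : w = 1 :=
  D.eq_one_of_dominant hz.2 h.2

/-- The hyperplane of a simple root is not the hyperplane of another positive root. -/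
lemma eq_of_ker_le (D : GaugeData R X Y ι κ) {a c : R} (ha : a ∈ D.base.support)
    (hc : D.base.IsPos c)
    (h : ∀ γ : X →ₗ[ℤ] ℝ, γ (D.roots.root a) = 0 → γ (D.roots.root c) = 0) : c = a := by
  classical
  by_contra hca
  -- On a positive root the functional `g` is the sum of the coefficients of the simple roots other
  -- than `a`; if it vanishes, each of them does.
  obtain ⟨g, hg⟩ := D.exists_functional fun d => if (d : R) = a then 0 else 1
  have hgc := h g (by rw [hg ⟨a, ha⟩]; simp)
  obtain ⟨f, -, hf, hsum⟩ := D.base.exists_root_eq_sum_int c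
  have hpos : 0 < f := by
    refine hf.resolve_right fun hneg => ?_
    have h3 : 0 < D.base.height c := hc
    rw [RootPairing.Base.height_eq_sum hsum] at h3
    have : ∑ j ∈ D.base.support, f j ≤ 0 := Finset.sum_nonpos fun j _ => hneg.le j
    omega
  have hs : g (D.roots.root c) = ∑ d ∈ D.base.support, (f d : ℝ) * (if d = a then 0 else 1) := by
    rw [hsum, map_sum]
    refine Finset.sum_congr rfl fun d hd => ?_
    rw [map_smul, hg ⟨d, hd⟩]
    simp
  rw [hgc, eq_comm, Finset.sum_eq_zero_iff_of_nonneg] at hs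
  · have hd0 : ∀ d ∈ D.base.support, d ≠ a → f d = 0 := by
      intro d hd hda
      simpa [hda] using hs d hd
    have hroot : D.roots.root c = f a • D.roots.root a := by
      rw [hsum]
      exact Finset.sum_eq_single_of_mem a ha fun d hd hda => by rw [hd0 d hd hda, zero_smul]
    -- Now `s_a c = -c`, although `s_a` keeps the positive roots other than `a` positive.
    have e : D.roots.reflectionPerm a c = D.roots.reflectionPerm c c := by
      apply D.roots.root.injective
      rw [RootPairing.root_reflectionPerm, RootPairing.root_reflectionPerm,
        RootPairing.reflection_apply_self, hroot, map_smul, RootPairing.reflection_apply_self,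
        smul_neg]
    exact D.not_isPos_reflect hc (e ▸ D.isPos_reflect hc ha hca)
  · intro d hd
    have : (0 : ℝ) ≤ f d := by exact_mod_cast hpos.le d
    split_ifs <;> simp [this]

/-! ### Geodesic paths and their foldings -/

include hΦ in
-- A geodesic crosses no hyperplane twice. For a step inside the Weyl chamber this says that the
-- next chamber lies between the current one and `v`. For a turn it says that the root is negative
-- at `v`; no matter hyperplane is crossed there, so by stability the reflected remainder starts in
-- the same chamber.
lemma folds_good {p : List (Point X κ)} {l : List (D.Turn Φ)} (hf : Folds p l)
    {x v : Point X κ} (hx : p.head? = some x) (hxσ : x ∈ D.posChamber Φ σ'.sgn)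
    (hv : p.getLast? = some v) (hvσ : Target σ v) (hc : p.IsChain (D.Step Φ))
    (hl : p.length ≤ (D.crossed Φ x v).ncard + 1) : Good σ σ' v l := by
  induction hf generalizing x v σ' with
  | single hd =>
    simp only [List.head?_cons, Option.some.injEq, List.getLast?_singleton] at hx hv
    subst hx hv
    obtain ⟨w, z, hz, rfl⟩ := hvσ
    have := D.eq_one_of_dominant hz.2 hd
    subst this
    rw [weylAct_one]
    exact hz
  | @step x' y p l hdx hdy hf ih =>
    simp only [List.head?_cons, Option.some.injEq] at hx
    subst hx
    have hxr := regular_of_mem hxσ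
    have hyr : D.Regular Φ y := (List.isChain_cons_cons.1 hc).1.2.1
    obtain ⟨h1, h2⟩ := geodesic_tail hΦ hxr hc hv (by simp at hl; omega)
    rw [List.getLast?_cons_cons] at hv
    let τ : D.Obj Φ := objAt hΦ (p := y) ⟨hyr.1, hyr.2.1, fun a ha => (hdy a ha).le⟩
    have hy : y ∈ D.posChamber Φ τ.sgn := D.mem_posChamber_iff.2 ⟨hyr.1, hyr.2.1, rfl, hdy⟩
    have hg : Good σ τ v l := ih rfl hy hv hvσ (List.isChain_cons_cons.1 hc).2 (by
      rw [List.length_cons]; omega)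
    refine hg.of_prefix fun i hi => ?_
    have hvr := hvσ.regular
    rw [(D.mem_posChamber_iff.1 hxσ).2.2.1] at hi
    by_cases h : D.sg y i = D.sg x' i
    · exact h.trans hi
    · have h3 := h2 (.inl i) (by
        rw [mul_comm]
        exact D.mul_neg_of_sg_ne (hyr.2.1 i) (hxr.2.1 i) h)
      exact D.sg_eq_of_mul_pos h3
  | @turn x' y p l t hxt hdy hf ih =>
    simp only [List.head?_cons, Option.some.injEq] at hx
    subst hx
    have hxr := regular_of_mem hxσ
    have hyr : D.Regular Φ y := (List.isChain_cons_cons.1 hc).1.2.1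
    obtain ⟨h1, h2⟩ := geodesic_tail hΦ hxr hc hv (by simp at hl; omega)
    rw [List.getLast?_cons_cons] at hv
    have hσt : σ' = t.obj := by
      ext1
      rw [(D.mem_posChamber_iff.1 hxσ).2.2.1, (D.mem_posChamber_iff.1 hxt).2.2.1]
    have hay : D.rootVal t.root y < 0 := by
      have := hdy t.root t.root.2
      rw [rootVal_act, rootVal_reflect_self] at this
      linarith
    have hax : D.rootVal t.root x' * D.rootVal t.root y < 0 :=
      mul_neg_of_pos_of_neg (hxσ.2 _ t.root.2) hay
    have hav : D.rootVal t.root v < 0 := by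
      have h3 : 0 < D.rootVal t.root y * D.rootVal t.root v := h2 (.inr t.root) hax
      nlinarith
    have hsame : ∀ i, ¬ D.matterVal i x' * D.matterVal i y < 0 := by
      intro i hi
      obtain ⟨-, -, H, hH⟩ := (List.isChain_cons_cons.1 hc).1
      have e1 : D.hyp Φ (.inl i) ∈ D.crossed Φ x' y := (hyp_mem_crossed hΦ hxr hyr _).2 hi
      have e2 : D.hyp Φ (.inr t.root) ∈ D.crossed Φ x' y :=
        (hyp_mem_crossed hΦ hxr hyr _).2 hax
      rw [hH, Set.mem_singleton_iff] at e1 e2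
      -- This point lies on every Coxeter hyperplane and on no matter hyperplane, so hyperplanes of
      -- the two kinds never coincide.
      obtain ⟨p₀, hp1, hp2, f, hf1, hf2⟩ := D.exists_center hΦ
      have e3 : p₀ ∈ D.hyp Φ (.inr t.root) := ⟨hp1, by
        change p₀.1 _ = 0
        rw [hp2]; rfl⟩
      rw [e2, ← e1] at e3
      have e4 : D.matterVal i p₀ = 0 := e3.2
      rw [hf2] at e4
      exact hf1 _ e4
    have hsg : D.sg y = t.obj.sgn := by
      rw [(D.mem_posChamber_iff.1 hxt).2.2.1]
      refine funext fun i => D.sg_eq_of_mul_pos ?_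
      rw [mul_comm]
      exact lt_of_le_of_ne (not_lt.1 (hsame i)) (mul_ne_zero (hxr.2.1 i) (hyr.2.1 i)).symm
    have hs : act (D.roots.reflection t.root) y ∈ D.chamber Φ t.obj.sgn := by
      rw [← t.stable]
      exact ⟨y, D.mem_chamber_iff.2 ⟨hyr.1, hyr.2.1, hsg.symm⟩, rfl⟩
    refine ⟨hav, fun i hi => hσt ▸ hi, ih rfl ⟨hs, hdy⟩ ?_ (hvσ.act _) ?_ ?_⟩
    · rw [List.getLast?_map, hv]; rfl
    · exact D.chain_act _ (List.isChain_cons_cons.1 hc).2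
    · rw [List.length_map, ncard_crossed_act, List.length_cons]
      omega

include hΦ in
-- A step that leaves the Weyl chamber crosses a single hyperplane, which is that of a simple root.
-- The point where the segment meets it has the matter signs of `x`; this makes the chamber stable
-- and provides the turn.
lemma exists_folds {x : Point X κ} {q : List (Point X κ)} (hx : D.Regular Φ x) (hd : D.Dominant x)
    (hc : (x :: q).IsChain (D.Step Φ)) : ∃ l : List (D.Turn Φ), Folds (x :: q) l := by
  induction hn : q.length generalizing x q with
  | zero =>
    rw [List.length_eq_zero_iff] at hn
    subst hn
    exact ⟨[], .single hd⟩
  | succ n ih =>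
    obtain _ | ⟨y, q⟩ := q
    · simp at hn
    rw [List.isChain_cons_cons] at hc
    obtain ⟨⟨-, hyr, H, hH⟩, hc⟩ := hc
    by_cases hdy : D.Dominant y
    · obtain ⟨l, hl⟩ := ih hyr hdy hc (by simpa using hn)
      exact ⟨l, .step hd hdy hl⟩
    · unfold Dominant at hdy
      push Not at hdy
      obtain ⟨a, ha, hay⟩ := hdy
      replace hay : D.rootVal a y < 0 := lt_of_le_of_ne hay (hyr.2.2 a)
      have hax : D.rootVal a x * D.rootVal a y < 0 := mul_neg_of_pos_of_neg (hd a ha) hay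
      have e2 : D.hyp Φ (.inr a) = H := by
        have : D.hyp Φ (.inr a) ∈ D.crossed Φ x y := (hyp_mem_crossed hΦ hx hyr _).2 hax
        rwa [hH, Set.mem_singleton_iff] at this
      obtain ⟨p₀, hp1, hp2, f, hf1, hf2⟩ := D.exists_center hΦ
      have hmat : ∀ i, 0 < D.matterVal i x * D.matterVal i y := by
        intro i
        refine lt_of_le_of_ne (not_lt.1 fun h => ?_)
          (mul_ne_zero (hx.2.1 i) (hyr.2.1 i)).symm
        have e1 : D.hyp Φ (.inl i) ∈ D.crossed Φ x y := (hyp_mem_crossed hΦ hx hyr _).2 h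
        rw [hH, Set.mem_singleton_iff, ← e2] at e1
        have e3 : p₀ ∈ D.hyp Φ (.inr a) := ⟨hp1, by
          change p₀.1 _ = 0
          rw [hp2]; rfl⟩
        rw [← e1] at e3
        have e4 : D.matterVal i p₀ = 0 := e3.2
        rw [hf2] at e4
        exact hf1 _ e4
      have hroot : ∀ b, D.base.IsPos b → b ≠ a → 0 < D.rootVal b y := by
        intro b hb hba
        by_contra h
        have hbx := D.rootVal_pos hb hd
        have hby : D.rootVal b y < 0 := lt_of_le_of_ne (not_lt.1 h) (hyr.2.2 b)
        have e1 : D.hyp Φ (.inr b) ∈ D.crossed Φ x y :=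
          (hyp_mem_crossed hΦ hx hyr _).2 (mul_neg_of_pos_of_neg hbx hby)
        rw [hH, Set.mem_singleton_iff, ← e2] at e1
        refine hba (D.eq_of_ker_le ha hb fun γ hγ => ?_)
        have : (γ, p₀.2) ∈ D.hyp Φ (.inr a) := ⟨hp1, hγ⟩
        rw [← e1] at this
        exact this.2
      obtain ⟨p₁, hp₁⟩ : ∃ p₁ : Point X κ, p₁ = x + (D.rootVal a x /
        (D.rootVal a x - D.rootVal a y)) • (y - x) := ⟨_, rfl⟩
      have hpos := hd a ha
      have ht0 : 0 < D.rootVal a x / (D.rootVal a x - D.rootVal a y) :=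
        div_pos hpos (by linarith)
      have ht1 : D.rootVal a x / (D.rootVal a x - D.rootVal a y) < 1 := by
        rw [div_lt_one (by linarith)]; linarith
      have hp₁a : D.rootVal a p₁ = 0 := by
        have : D.rootVal a x - D.rootVal a y ≠ 0 := by linarith
        rw [hp₁, rootVal_add_smul]; field_simp; ring
      have hp₁m : ∀ i, 0 < D.matterVal i p₁ * D.matterVal i x := by
        intro i
        rw [hp₁, matterVal_add_smul]
        nlinarith [mul_pos (sub_pos.2 ht1) (mul_self_pos.2 (hx.2.1 i)), mul_pos ht0 (hmat i)]
      have hsg : D.sg p₁ = D.sg x := funext fun i => D.sg_eq_of_mul_pos (hp₁m i)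
      have hstab : D.Stable Φ a (D.sg x) := by
        rw [← hsg]
        refine stable_of_rootVal_eq_zero hp₁a fun i h => ?_
        have := hp₁m i
        simp [h] at this
      let t : D.Turn Φ := ⟨⟨a, ha⟩, objAt hΦ (p := x) ⟨hx.1, hx.2.1, fun a ha => (hd a ha).le⟩,
        hstab⟩
      have hdy' : D.Dominant (act (D.roots.reflection a) y) := by
        intro b hb
        rw [rootVal_act]
        by_cases hba : b = a
        · rw [hba, rootVal_reflect_self]; linarith
        · refine hroot _ (D.isPos_reflect (D.base.isPos_of_mem_support hb) ha hba) fun h => ?_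
          have h1 := D.reflectionPerm_reflectionPerm a b
          rw [h] at h1
          have h2 := D.base.isPos_of_mem_support hb
          rw [← h1] at h2
          exact D.not_isPos_reflect (D.base.isPos_of_mem_support ha) h2
      obtain ⟨l, hl⟩ := ih (D.regular_act a hyr) hdy' (D.chain_act a hc)
        (by simpa using hn)
      refine ⟨t :: l, .turn t (D.mem_posChamber_iff.2 ⟨hx.1, hx.2.1, rfl, hd⟩) hdy' hl⟩

include hΦ in
-- A geodesic attains the lower bound given by the number of separating hyperplanes, and this number
-- does not depend on the points chosen in the two regions.
lemma exists_isFolding (σ' σ : D.Obj Φ) (w : D.roots.weylGroup) : ∃ l, IsFolding σ' σ w l := by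
  obtain ⟨x, hx⟩ := σ'.exists_point
  obtain ⟨z, hz⟩ := σ.exists_point
  have hxr := regular_of_mem hx
  have hvr := regular_weylAct (regular_of_mem hz) w
  obtain ⟨q, y', h1, h2, h3, h4, h5⟩ := exists_geodesic hΦ hxr hvr
  obtain ⟨z', hz', e⟩ := Target.of_same_signs hz h3 h4
  obtain ⟨l, hl⟩ := exists_folds hΦ hxr hx.2 h1
  refine ⟨l, x :: q, ⟨⟨h1, ⟨x, rfl, hx⟩, ⟨y', h2, z', hz', e⟩⟩, ?_⟩, hl⟩
  rintro r ⟨r1, ⟨x₂, rx, hx₂⟩, ⟨y₂, ry, z₂, hz₂, rfl⟩⟩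
  obtain _ | ⟨x₃, r⟩ := r
  · simp at rx
  simp only [List.head?_cons, Option.mem_some_iff] at rx
  subst rx
  have hle := ncard_crossed_le hΦ (regular_of_mem hx₂) r1 ry
  have hsame : ∀ {s : ι → Bool} {p q : Point X κ}, p ∈ D.posChamber Φ s → q ∈ D.posChamber Φ s →
      ∀ k, 0 < D.val k p * D.val k q := by
    intro s p q hp hq k
    have hp' := D.mem_posChamber_iff.1 hp
    have hq' := D.mem_posChamber_iff.1 hq
    rcases k with i | b
    · exact D.mul_pos_of_sg_eq (hp'.2.1 i) (hq'.2.1 i) (by rw [← hp'.2.2.1, ← hq'.2.2.1])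
    · by_cases hb : D.base.IsPos b
      · exact mul_pos (D.rootVal_pos hb hp.2) (D.rootVal_pos hb hq.2)
      · exact mul_pos_of_neg_of_neg (D.rootVal_neg hb hp.2) (D.rootVal_neg hb hq.2)
  have hsame2 : ∀ k, 0 < D.val k (D.weylAct w z₂) * D.val k (D.weylAct w z) := by
    have hs := hsame hz₂ hz
    obtain ⟨p, hp⟩ := D.weyl_perm w
    rintro (i | b)
    · obtain ⟨j, rfl⟩ := p.surjective i
      change 0 < D.matterVal _ _ * D.matterVal _ _
      rw [D.matterVal_weylAct hp, D.matterVal_weylAct hp]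
      exact hs (.inl j)
    · obtain ⟨c, rfl⟩ := (D.idx w).surjective b
      change 0 < D.rootVal _ _ * D.rootVal _ _
      rw [rootVal_weylAct, rootVal_weylAct]
      exact hs (.inr c)
  have hcr : D.crossed Φ x₃ (D.weylAct w z₂) = D.crossed Φ x (D.weylAct w z) := by
    rw [crossed_eq, crossed_eq]
    congr 1
    ext k
    have e1 := hsame hx₂ hx k
    have e2 := hsame2 k
    simp only [Set.mem_ofPred_eq]
    have e3 := mul_pos e1 e2
    constructor <;> intro h <;> by_contra h' <;> nlinarith
  rw [hcr] at hle
  simp only [List.length_cons]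
  omega

include hΦ in
-- A minimal path is not longer than a geodesic from the same point to the same region, so
-- `folds_good` applies to it.
lemma IsFolding.good {w : D.roots.weylGroup} {l : List (D.Turn Φ)} (h : IsFolding σ' σ w l) :
    ∃ z ∈ D.posChamber Φ σ.sgn, Good σ σ' (D.weylAct w z) l := by
  obtain ⟨p, ⟨⟨h1, ⟨x, hx, hxσ⟩, ⟨v, hv, z, hz, rfl⟩⟩, hmin⟩, hf⟩ := h
  refine ⟨z, hz, folds_good hΦ hf hx hxσ hv ⟨w, z, hz, rfl⟩ h1 ?_⟩
  have hvr := regular_weylAct (Φ := Φ) (regular_of_mem hz) w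
  obtain ⟨q, y', g1, g2, g3, g4, g5⟩ := exists_geodesic hΦ (regular_of_mem hxσ) hvr
  obtain ⟨z', hz', e⟩ := Target.of_same_signs hz g3 g4
  have := hmin (x :: q) ⟨g1, ⟨x, rfl, hxσ⟩, ⟨y', g2, z', hz', e⟩⟩
  rw [List.length_cons, g5] at this
  exact this

end Good

end Steinberg.GaugeData
end

noncomputable section

namespace Steinberg.GaugeData

/-! ### Systems of morphisms satisfying the relations -/

section Systems

variable {R X Y ι κ : Type*} [AddCommGroup X] [AddCommGroup Y]

/-- Morphisms of a preadditive category that satisfy the relations of `A_{I'}`, with the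
polynomials that occur as coefficients in the lower order terms left unspecified. -/
structure Sys (D : GaugeData R X Y ι κ) (Φ : Set (κ → ℝ)) (S : Type*) [CommRing S]
    (C : Type*) [Category C] [Preadditive C] where
  ob : D.Obj Φ → C
  P : ∀ σ, S → (ob σ ⟶ ob σ)
  wall : ∀ σ σ', ob σ' ⟶ ob σ
  psi : ∀ (a : D.base.support) (σ : D.Obj Φ), D.Stable Φ a σ.sgn → (ob σ ⟶ ob σ)
  P_one : ∀ σ, P σ 1 = 𝟙 _
  P_mul : ∀ σ f g, P σ (f * g) = P σ f ≫ P σ g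
  P_add : ∀ σ f g, P σ (f + g) = P σ f + P σ g
  wall_self : ∀ σ, wall σ σ = 𝟙 _
  wall_wall : ∀ σ σ' σ'' : D.Obj Φ, (∀ i, σ.sgn i = σ''.sgn i → σ'.sgn i = σ.sgn i) →
    wall σ' σ'' ≫ wall σ σ' = wall σ σ''
  wall_wall' : ∀ σ σ' σ'' : D.Obj Φ, ∃ g, wall σ' σ'' ≫ wall σ σ' = P σ'' g ≫ wall σ σ''
  wall_P : ∀ σ σ' f, wall σ σ' ≫ P σ f = P σ' f ≫ wall σ σ'
  psi_psi : ∀ a σ h, psi a σ h ≫ psi a σ h = 0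
  psi_P : ∀ a σ h f, ∃ g g', psi a σ h ≫ P σ f = P σ g ≫ psi a σ h + P σ g'
  braid : ∀ (a b : D.base.support) (σ : D.Obj Φ) (ha : D.Stable Φ a σ.sgn)
    (hb : D.Stable Φ b σ.sgn),
    altWord (M := End (ob σ)) (psi a σ ha) (psi b σ hb) (D.coxeterM a b) =
      altWord (M := End (ob σ)) (psi b σ hb) (psi a σ ha) (D.coxeterM a b)
  mixed : ∀ (a : D.base.support) (j : ι) (y : Point X κ), D.IsMixedPoint Φ a j y →
    ∀ (ρ τ σ σ' : D.Obj Φ), AdjacentTo ρ y → AdjacentTo τ y → AdjacentTo σ y → AdjacentTo σ' y →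
    (∀ i, D.matterVal i y = 0 → ρ.sgn i = true) → (∀ i, D.matterVal i y = 0 → τ.sgn i = false) →
    OppositeAt a y σ σ' → ∀ (sρ : D.Stable Φ a ρ.sgn) (sτ : D.Stable Φ a τ.sgn),
    ∃ g, wall τ σ ≫ psi a τ sτ ≫ wall σ' τ =
      wall ρ σ ≫ psi a ρ sρ ≫ wall σ' ρ + P σ g ≫ wall σ' σ

variable {D : GaugeData R X Y ι κ} {Φ : Set (κ → ℝ)} {S : Type*} [CommRing S]
  {C : Type*} [Category C] [Preadditive C] (A : Sys D Φ S C)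

namespace Sys

/-- The product attached to a list of turns. -/
def E (σ : D.Obj Φ) : (σ' : D.Obj Φ) → List (D.Turn Φ) → (A.ob σ' ⟶ A.ob σ)
  | σ', [] => A.wall σ σ'
  | σ', t :: l => A.wall t.obj σ' ≫ A.psi t.root t.obj t.stable ≫ E σ t.obj l

variable {A} {σ σ' τ ω : D.Obj Φ} {v : Point X κ}

lemma E_nil : A.E σ σ' [] = A.wall σ σ' := rfl

lemma E_cons (t : D.Turn Φ) (l : List (D.Turn Φ)) :
    A.E σ σ' (t :: l) = A.wall t.obj σ' ≫ A.psi t.root t.obj t.stable ≫ A.E σ t.obj l := rfl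

/-- The chamber of `ω` lies between those of `τ` and the first turn, so no matter hyperplane is
crossed back and the composition of walls has coefficient `1`. -/
lemma wall_comp_E {l : List (D.Turn Φ)} (h : Good σ ω v l)
    (hp : ∀ i, τ.sgn i = D.sg v i → ω.sgn i = D.sg v i) :
    A.wall ω τ ≫ A.E σ ω l = A.E σ τ l := by
  cases l with
  | nil =>
    refine A.wall_wall _ _ _ fun i hi => ?_
    rw [(D.mem_posChamber_iff.1 h).2.2.1] at hi ⊢
    exact hp i hi.symm
  | cons t l =>
    rw [E_cons, ← Category.assoc, A.wall_wall, ← E_cons]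
    intro i hi
    by_cases hω : ω.sgn i = D.sg v i
    · rw [hω, h.2.1 i hω]
    · have h1 : τ.sgn i ≠ D.sg v i := fun h' => hω (hp i h')
      rw [hi]
      cases h2 : ω.sgn i <;> cases h3 : τ.sgn i <;> cases h4 : D.sg v i <;> simp_all

lemma P_comm (σ : D.Obj Φ) (f g : S) : A.P σ f ≫ A.P σ g = A.P σ g ≫ A.P σ f := by
  rw [← A.P_mul, mul_comm, A.P_mul]

variable (A) in
/-- The span of the products with fewer than `n` turns. -/
def F (σ' σ : D.Obj Φ) (n : ℕ) : AddSubgroup (A.ob σ' ⟶ A.ob σ) :=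
  AddSubgroup.closure {h | ∃ f l, l.length < n ∧ h = A.P σ' f ≫ A.E σ σ' l}

variable (A) in
/-- The span of the products attached to foldings of geodesics with fewer than `n` turns. -/
def G (σ' σ : D.Obj Φ) (n : ℕ) : AddSubgroup (A.ob σ' ⟶ A.ob σ) :=
  AddSubgroup.closure {h | ∃ f l v, Target σ v ∧ Good σ σ' v l ∧ l.length < n ∧
    h = A.P σ' f ≫ A.E σ σ' l}

lemma mem_of_closure {M N : Type*} [AddGroup M] [AddGroup N] (Θ : M →+ N) {s : Set M}
    {T : AddSubgroup N} (h : ∀ x ∈ s, Θ x ∈ T) {x : M} (hx : x ∈ AddSubgroup.closure s) :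
    Θ x ∈ T :=
  (AddSubgroup.closure_le (T.comap Θ)).2 h hx

lemma F_mono {m n : ℕ} (h : m ≤ n) {x : A.ob σ' ⟶ A.ob σ} (hx : x ∈ A.F σ' σ m) :
    x ∈ A.F σ' σ n :=
  AddSubgroup.closure_mono (by rintro _ ⟨f, l, hl, rfl⟩; exact ⟨f, l, by omega, rfl⟩) hx

lemma G_mono {m n : ℕ} (h : m ≤ n) {x : A.ob σ' ⟶ A.ob σ} (hx : x ∈ A.G σ' σ m) :
    x ∈ A.G σ' σ n :=
  AddSubgroup.closure_mono
    (by rintro _ ⟨f, l, v, h1, h2, h3, rfl⟩; exact ⟨f, l, v, h1, h2, by omega, rfl⟩) hx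

lemma P_E_mem_F (f : S) {l : List (D.Turn Φ)} {n : ℕ} (hl : l.length < n) :
    A.P σ' f ≫ A.E σ σ' l ∈ A.F σ' σ n :=
  AddSubgroup.subset_closure ⟨f, l, hl, rfl⟩

lemma E_mem_F {l : List (D.Turn Φ)} {n : ℕ} (hl : l.length < n) : A.E σ σ' l ∈ A.F σ' σ n := by
  have := P_E_mem_F (A := A) (σ := σ) (σ' := σ') 1 hl
  rwa [A.P_one, Category.id_comp] at this

lemma E_mem_G {l : List (D.Turn Φ)} {n : ℕ} (hv : Target σ v) (h : Good σ σ' v l)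
    (hl : l.length < n) : A.E σ σ' l ∈ A.G σ' σ n := by
  refine AddSubgroup.subset_closure ⟨1, l, v, hv, h, hl, ?_⟩
  rw [A.P_one, Category.id_comp]

lemma F_P_comp (f : S) {n : ℕ} {x : A.ob σ' ⟶ A.ob σ} (hx : x ∈ A.F σ' σ n) :
    A.P σ' f ≫ x ∈ A.F σ' σ n := by
  refine mem_of_closure (Preadditive.leftComp _ (A.P σ' f)) ?_ hx
  rintro _ ⟨g, l, hl, rfl⟩
  change A.P σ' f ≫ A.P σ' g ≫ A.E σ σ' l ∈ _
  rw [← Category.assoc, ← A.P_mul]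
  exact P_E_mem_F _ hl

lemma G_P_comp (f : S) {n : ℕ} {x : A.ob σ' ⟶ A.ob σ} (hx : x ∈ A.G σ' σ n) :
    A.P σ' f ≫ x ∈ A.G σ' σ n := by
  refine mem_of_closure (Preadditive.leftComp _ (A.P σ' f)) ?_ hx
  rintro _ ⟨g, l, v, h1, h2, hl, rfl⟩
  change A.P σ' f ≫ A.P σ' g ≫ A.E σ σ' l ∈ _
  rw [← Category.assoc, ← A.P_mul]
  exact AddSubgroup.subset_closure ⟨_, l, v, h1, h2, hl, rfl⟩

lemma wall_comp_E_mem (l : List (D.Turn Φ)) :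
    ∃ g, A.wall ω τ ≫ A.E σ ω l = A.P τ g ≫ A.E σ τ l := by
  cases l with
  | nil => exact A.wall_wall' _ _ _
  | cons t l =>
    obtain ⟨g, hg⟩ := A.wall_wall' t.obj ω τ
    exact ⟨g, by rw [E_cons, ← Category.assoc, hg, Category.assoc, ← E_cons]⟩

lemma F_wall_comp {n : ℕ} {x : A.ob τ ⟶ A.ob σ} (hx : x ∈ A.F τ σ n) :
    A.wall τ σ' ≫ x ∈ A.F σ' σ n := by
  refine mem_of_closure (Preadditive.leftComp _ (A.wall τ σ')) ?_ hx
  rintro _ ⟨f, l, hl, rfl⟩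
  change A.wall τ σ' ≫ A.P τ f ≫ A.E σ τ l ∈ _
  obtain ⟨g, hg⟩ := wall_comp_E_mem (A := A) (σ := σ) (ω := τ) (τ := σ') l
  rw [← Category.assoc, A.wall_P, Category.assoc, hg]
  exact F_P_comp _ (P_E_mem_F _ hl)

/-- Moving a polynomial to the source through `psi` gives one term with the additional turn and one
in which it has disappeared. -/
lemma F_wall_psi_comp (t : D.Turn Φ) {n : ℕ} {x : A.ob t.obj ⟶ A.ob σ}
    (hx : x ∈ A.F t.obj σ n) :
    A.wall t.obj σ' ≫ A.psi t.root t.obj t.stable ≫ x ∈ A.F σ' σ (n + 1) := by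
  refine mem_of_closure ((Preadditive.leftComp _ (A.wall t.obj σ')).comp
    (Preadditive.leftComp _ (A.psi t.root t.obj t.stable))) ?_ hx
  rintro _ ⟨f, l, hl, rfl⟩
  change A.wall t.obj σ' ≫ A.psi t.root t.obj t.stable ≫ A.P t.obj f ≫ A.E σ t.obj l ∈ _
  obtain ⟨g, g', h⟩ := A.psi_P t.root t.obj t.stable f
  rw [← Category.assoc (A.psi _ _ _), h, Preadditive.add_comp, Preadditive.comp_add]
  refine add_mem ?_ (F_wall_comp (F_mono (Nat.le_succ n) (P_E_mem_F _ hl)))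
  rw [Category.assoc, ← Category.assoc, A.wall_P, Category.assoc, ← E_cons]
  exact P_E_mem_F _ (by simpa using hl)

lemma F_comp_P (f : S) {n : ℕ} {x : A.ob σ' ⟶ A.ob σ} (hx : x ∈ A.F σ' σ n) :
    x ≫ A.P σ f ∈ A.F σ' σ n := by
  refine mem_of_closure (Preadditive.rightComp _ (A.P σ f)) ?_ hx
  rintro _ ⟨g, l, hl, rfl⟩
  change (A.P σ' g ≫ A.E σ σ' l) ≫ A.P σ f ∈ _
  rw [Category.assoc]
  apply F_P_comp
  clear hx x
  induction l generalizing σ' n with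
  | nil =>
    rw [E_nil, A.wall_P, ← E_nil]
    exact P_E_mem_F _ hl
  | cons t l ih =>
    obtain _ | n := n
    · simp at hl
    rw [E_cons, Category.assoc, Category.assoc]
    exact F_wall_psi_comp t (ih (n := n) (by simpa using hl))

lemma F_comp_wall {n : ℕ} {x : A.ob σ' ⟶ A.ob σ} (hx : x ∈ A.F σ' σ n) :
    x ≫ A.wall τ σ ∈ A.F σ' τ n := by
  refine mem_of_closure (Preadditive.rightComp _ (A.wall τ σ)) ?_ hx
  rintro _ ⟨g, l, hl, rfl⟩
  change (A.P σ' g ≫ A.E σ σ' l) ≫ A.wall τ σ ∈ _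
  rw [Category.assoc]
  apply F_P_comp
  clear hx x
  induction l generalizing σ' n with
  | nil =>
    obtain ⟨g, hg⟩ := A.wall_wall' τ σ σ'
    rw [E_nil, hg, ← E_nil]
    exact P_E_mem_F _ hl
  | cons t l ih =>
    obtain _ | n := n
    · simp at hl
    rw [E_cons, Category.assoc, Category.assoc]
    exact F_wall_psi_comp t (ih (n := n) (by simpa using hl))

lemma F_comp_psi (a : D.base.support) (ha : D.Stable Φ a σ.sgn) {n : ℕ} {x : A.ob σ' ⟶ A.ob σ}
    (hx : x ∈ A.F σ' σ n) : x ≫ A.psi a σ ha ∈ A.F σ' σ (n + 1) := by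
  refine mem_of_closure (Preadditive.rightComp _ (A.psi a σ ha)) ?_ hx
  rintro _ ⟨g, l, hl, rfl⟩
  change (A.P σ' g ≫ A.E σ σ' l) ≫ A.psi a σ ha ∈ _
  rw [Category.assoc]
  apply F_P_comp
  clear hx x
  induction l generalizing σ' n with
  | nil =>
    have : A.E σ σ' [] ≫ A.psi a σ ha = A.E σ σ' [⟨a, σ, ha⟩] := by
      rw [E_cons, E_nil, E_nil, A.wall_self, Category.comp_id]
    rw [this]
    exact E_mem_F (by simpa using hl)
  | cons t l ih =>
    obtain _ | n := n
    · simp at hl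
    rw [E_cons, Category.assoc, Category.assoc]
    exact F_wall_psi_comp t (ih (n := n) (by simpa using hl))

lemma id_mem_F : 𝟙 (A.ob σ) ∈ A.F σ σ 1 := by
  have := E_mem_F (A := A) (σ := σ) (σ' := σ) (l := []) (n := 1) (by simp)
  rwa [E_nil, A.wall_self] at this

end Sys

end Systems

end Steinberg.GaugeData
end

open scoped Topology

noncomputable section

namespace Steinberg.GaugeData

/-! ### Coherence: first turns on one hyperplane or in one chamber -/

section Coherence

variable {R X Y ι κ : Type*} [AddCommGroup X] [AddCommGroup Y] {D : GaugeData R X Y ι κ}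
  {Φ : Set (κ → ℝ)} (hΦ : IsFlavorSet Φ) {σ σ' τ : D.Obj Φ} {v : Point X κ}

variable [Finite R] [Finite ι]

/-- All conditions depend on `v` only through signs, and reflections permute the functions
concerned. -/
lemma Good.congr {l : List (D.Turn Φ)} {v' : Point X κ} (h : Good σ σ' v l) (hv : v'.2 ∈ Φ)
    (hs : ∀ k, 0 < D.val k v * D.val k v') : Good σ σ' v' l := by
  have hsg : D.sg v = D.sg v' := funext fun i => D.sg_eq_of_mul_pos (hs (.inl i))
  induction l generalizing σ' v v' with
  | nil =>
    obtain ⟨-, -, h3, h4⟩ := D.mem_posChamber_iff.1 h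
    refine D.mem_posChamber_iff.2 ⟨hv, fun i h0 => ?_, h3.trans hsg, fun a ha => ?_⟩
    · have := hs (.inl i)
      simp [val, h0] at this
    · exact pos_of_mul_pos_right (hs (.inr a)) (h4 a ha).le
  | cons t l ih =>
    have hs' : ∀ k, 0 < D.val k (act (D.roots.reflection t.root) v) *
        D.val k (act (D.roots.reflection t.root) v') := by
      intro k
      obtain ⟨l, hl, -⟩ := D.image_hyp (Φ := Φ) t.root k
      have h1 := hl (act (D.roots.reflection t.root) v)
      have h2 := hl (act (D.roots.reflection t.root) v')
      rw [act_reflection_act] at h1 h2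
      rw [← h1, ← h2]
      exact hs l
    refine ⟨?_, fun i hi => hsg ▸ h.2.1 i (hsg ▸ hi), ih h.2.2 hv hs'
      (funext fun i => D.sg_eq_of_mul_pos (hs' (.inl i)))⟩
    have := hs (.inr t.root)
    exact neg_of_mul_pos_right this h.1.le

lemma val_weylAct_mul_pos {w : D.roots.weylGroup} {z z' : Point X κ} {s : ι → Bool}
    (hz : z ∈ D.posChamber Φ s) (hz' : z' ∈ D.posChamber Φ s) (k : ι ⊕ R) :
    0 < D.val k (D.weylAct w z) * D.val k (D.weylAct w z') := by
  obtain ⟨-, h2, h3, h4⟩ := D.mem_posChamber_iff.1 hz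
  obtain ⟨-, h2', h3', h4'⟩ := D.mem_posChamber_iff.1 hz'
  cases k with
  | inl i =>
    obtain ⟨p, hp⟩ := D.weyl_perm w
    obtain ⟨j, rfl⟩ := p.surjective i
    change 0 < D.matterVal _ _ * D.matterVal _ _
    rw [D.matterVal_weylAct hp, D.matterVal_weylAct hp]
    exact D.mul_pos_of_sg_eq (h2 j) (h2' j) (congrFun (h3.symm.trans h3') j)
  | inr a =>
    obtain ⟨b, rfl⟩ := (D.idx w).surjective a
    change 0 < D.rootVal _ _ * D.rootVal _ _
    rw [rootVal_weylAct, rootVal_weylAct]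
    by_cases hb : D.base.IsPos b
    · exact mul_pos (D.rootVal_pos hb h4) (D.rootVal_pos hb h4')
    · exact mul_pos_of_neg_of_neg (D.rootVal_neg hb h4) (D.rootVal_neg hb h4')

lemma Target.flavor (h : Target σ v) : v.2 ∈ Φ := h.regular.1

include hΦ in
lemma exists_good (h : Target σ v) (σ' : D.Obj Φ) : ∃ l, Good σ σ' v l := by
  obtain ⟨w, z, hz, rfl⟩ := id h
  obtain ⟨l, hl⟩ := exists_isFolding hΦ σ' σ w
  obtain ⟨z', hz', h'⟩ := hl.good hΦ
  exact ⟨l, h'.congr h.flavor (val_weylAct_mul_pos hz' hz)⟩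

/-- The chamber of `τ` lies between that of `σ'` and the point `v`, as far as the matter hyperplanes
are concerned. -/
def Between (σ' : D.Obj Φ) (v : Point X κ) (τ : D.Obj Φ) : Prop :=
  ∀ i, σ'.sgn i = D.sg v i → τ.sgn i = D.sg v i

include hΦ in
/-- The chamber next to `m` in the direction of `q`. -/
lemma exists_near {m q : Point X κ} {a : D.base.support} (hm : m.2 ∈ Φ) (hq : q.2 ∈ Φ)
    (ha : D.rootVal a m = 0) (hqa : 0 < D.rootVal a q)
    (hpos : ∀ b : D.base.support, b ≠ a → 0 < D.rootVal b m)
    (hJ : ∀ i, D.matterVal i m = 0 → D.matterVal i q ≠ 0) :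
    ∃ ω : D.Obj Φ, (∀ i, D.matterVal i m ≠ 0 → ω.sgn i = D.sg m i) ∧
      ∀ i, D.matterVal i m = 0 → ω.sgn i = D.sg q i := by
  have h1 : ∀ᶠ δ in 𝓝[>] (0 : ℝ), ∀ i, D.matterVal i m ≠ 0 →
      0 < (D.matterVal i m + δ * (D.matterVal i q - D.matterVal i m)) * D.matterVal i m := by
    refine Filter.eventually_all.2 fun i => ?_
    by_cases h : D.matterVal i m = 0
    · simp [h]
    · filter_upwards [eventually_same_sign h (D.matterVal i q - D.matterVal i m)] with δ hδ _
        using hδ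
  have h2 : ∀ᶠ δ in 𝓝[>] (0 : ℝ), ∀ b : D.base.support, b ≠ a →
      0 < D.rootVal b m + δ * (D.rootVal b q - D.rootVal b m) := by
    refine Filter.eventually_all.2 fun b => ?_
    by_cases h : b = a
    · simp [h]
    · filter_upwards [eventually_add_mul_pos (hpos b h) (D.rootVal b q - D.rootVal b m)]
        with δ hδ _ using hδ
  obtain ⟨δ, hδ1, hδ2, hδ0⟩ := (h1.and (h2.and self_mem_nhdsWithin)).exists
  have hδ0 : 0 < δ := hδ0
  have hv0 : ∀ i, D.matterVal i m = 0 → D.matterVal i (m + δ • (q - m)) = δ * D.matterVal i q := by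
    intro i hi
    rw [matterVal_add_smul, hi]
    ring
  have hF : D.Face Φ (m + δ • (q - m)) := by
    refine ⟨hΦ.isFlat m hm q hq δ, fun i => ?_, fun b hb => ?_⟩
    · by_cases hi : D.matterVal i m = 0
      · rw [hv0 i hi]
        exact mul_ne_zero hδ0.ne' (hJ i hi)
      · intro h0
        have := hδ1 i hi
        rw [← matterVal_add_smul, h0] at this
        simp at this
    · by_cases hba : b = a
      · subst hba
        rw [rootVal_add_smul, ha]
        nlinarith
      · rw [rootVal_add_smul]
        exact (hδ2 ⟨b, hb⟩ fun h => hba (congrArg Subtype.val h)).le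
  refine ⟨objAt hΦ hF, fun i hi => ?_, fun i hi => ?_⟩
  · refine D.sg_eq_of_mul_pos ?_
    rw [matterVal_add_smul]
    exact hδ1 i hi
  · refine D.sg_eq_of_mul_pos ?_
    rw [hv0 i hi]
    have := mul_self_pos.2 (hJ i hi)
    rw [mul_assoc]
    exact mul_pos hδ0 this

namespace Sys

variable {S : Type*} [CommRing S] {C : Type*} [Category C] [Preadditive C] (A : Sys D Φ S C)

/-- The products attached to the geodesic foldings with `n` turns to a given target agree up to
terms with fewer turns. -/
def Coh (σ : D.Obj Φ) (n : ℕ) : Prop :=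
  ∀ (σ' : D.Obj Φ) (v : Point X κ) (l l' : List (D.Turn Φ)), Target σ v → D.negCount v = n →
    Good σ σ' v l → Good σ σ' v l' → A.E σ σ' l - A.E σ σ' l' ∈ A.F σ' σ n

/-- The geodesic foldings with first turns `t`, `t'` have the same product up to terms with fewer
turns. -/
def Cong (σ σ' : D.Obj Φ) (v : Point X κ) (n : ℕ) (t t' : D.Turn Φ) : Prop :=
  ∀ l l' : List (D.Turn Φ), Good σ σ' v (t :: l) → Good σ σ' v (t' :: l') →
    A.E σ σ' (t :: l) - A.E σ σ' (t' :: l') ∈ A.F σ' σ n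

variable {A} {n : ℕ}

lemma Cong.symm {t t' : D.Turn Φ} (h : A.Cong σ σ' v n t t') : A.Cong σ σ' v n t' t :=
  fun l l' hl hl' => by
    have := neg_mem (h l' l hl' hl)
    rwa [neg_sub] at this

include hΦ in
-- The hypotheses on `t'` guarantee that some good list starts with it; without such a list the two
-- congruences could be vacuous.
lemma Cong.trans {t t' t'' : D.Turn Φ} (hv : Target σ v) (ht : D.rootVal t'.root v < 0)
    (ht' : Between σ' v t'.obj) (h : A.Cong σ σ' v n t t') (h' : A.Cong σ σ' v n t' t'') :
    A.Cong σ σ' v n t t'' := by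
  intro l l' hl hl'
  obtain ⟨l1, h1⟩ := exists_good hΦ (hv.act t'.root) t'.obj
  have := add_mem (h l l1 hl ⟨ht, ht', h1⟩) (h' l1 l' ⟨ht, ht', h1⟩ hl')
  rwa [sub_add_sub_cancel] at this

lemma Coh.tail (hn : A.Coh σ n) (hv : Target σ v) (hc : D.negCount v = n + 1) {t : D.Turn Φ} :
    A.Cong σ σ' v (n + 1) t t := by
  intro l l' h h'
  rw [E_cons, E_cons, ← Preadditive.comp_sub, ← Preadditive.comp_sub]
  refine F_wall_psi_comp t (hn _ _ _ _ (hv.act _) ?_ h.2.2 h'.2.2)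
  have := D.negCount_reflect t.root.2 h.1
  omega

/-- Coherence for the tails makes the choice of the lists after `t` and `t'` irrelevant, so one pair
of them decides. -/
lemma Coh.cong (hn : A.Coh σ n) (hv : Target σ v) (hc : D.negCount v = n + 1) {t t' : D.Turn Φ}
    {l l' : List (D.Turn Φ)} (hl : Good σ σ' v (t :: l)) (hl' : Good σ σ' v (t' :: l'))
    (h : A.E σ σ' (t :: l) - A.E σ σ' (t' :: l') ∈ A.F σ' σ (n + 1)) :
    A.Cong σ σ' v (n + 1) t t' := by
  intro l1 l1' h1 h1'
  have := add_mem (add_mem (hn.tail hv hc l1 l h1 hl) h) (hn.tail hv hc l' l1' hl' h1')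
  rwa [sub_add_sub_cancel, sub_add_sub_cancel] at this

include hΦ in
/-- Two faces of a Coxeter hyperplane separated by the matter hyperplanes through a codimension 2
subspace. -/
lemma Coh.mixed_step (hn : A.Coh σ n) (hv : Target σ v) (hc : D.negCount v = n + 1)
    {a : D.base.support} (ha : D.rootVal a v < 0) {j : ι} {m : Point X κ}
    (hm : D.IsMixedPoint Φ a j m) {ρ τ : D.Obj Φ} (hρ : D.Stable Φ a ρ.sgn)
    (hτ : D.Stable Φ a τ.sgn) (hρm : ∀ i, D.matterVal i m ≠ 0 → ρ.sgn i = D.sg m i)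
    (hτm : ∀ i, D.matterVal i m ≠ 0 → τ.sgn i = D.sg m i)
    (hρJ : ∀ i, D.matterVal i m = 0 → ρ.sgn i = true)
    (hτJ : ∀ i, D.matterVal i m = 0 → τ.sgn i = false)
    (hρv : Between σ' v ρ) (hτv : Between σ' v τ) :
    A.Cong σ σ' v (n + 1) ⟨a, τ, hτ⟩ ⟨a, ρ, hρ⟩ := by
  obtain ⟨x, hx⟩ := σ'.exists_point
  obtain ⟨x1, x2, x3, x4⟩ := D.mem_posChamber_iff.1 hx
  have hm1 : m.2 ∈ Φ := hm.mem_matter.1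
  have hma : D.rootVal a m = 0 := hm.mem_cox.2
  -- Of the chambers around `m`, `ω` is the one facing `σ'`.
  obtain ⟨ω, hω, hωJ⟩ := exists_near hΦ hm1 x1 hma (x4 a a.2) hm.pos fun i _ => x2 i
  -- The point `q` is opposite to `s_a x` with respect to `m`. The chamber `ω'` at `m` facing `q` is
  -- therefore such that `ω` and `s_a ω'` are opposite, as relation 4 requires.
  set q := m + (-1 : ℝ) • (act (D.roots.reflection a) x - m) with hq
  have hqu : ∀ i i', D.matterVal i m = 0 → D.cls i' = D.cls i →
      D.weight i' = D.roots.reflection a (D.weight i) →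
      D.matterVal i' m = 0 ∧ D.matterVal i' q = - D.matterVal i x := by
    intro i i' hi h1 h2
    have e : D.matterVal i' m = 0 := by
      rw [← D.act_eq_self hma, D.matterVal_act h1 h2, hi]
    refine ⟨e, ?_⟩
    rw [hq, matterVal_add_smul, e, D.matterVal_act h1 h2]
    ring
  have hpre : ∀ i, ∃ i', (D.cls i = D.cls i' ∧
      D.weight i = D.roots.reflection a (D.weight i')) := by
    intro i
    obtain ⟨i', h1, h2⟩ := D.exists_reflect a i
    exact ⟨i', h1.symm, D.reflect_symm h2⟩
  have hqJ : ∀ i i', D.matterVal i m = 0 → D.cls i = D.cls i' →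
      D.weight i = D.roots.reflection a (D.weight i') →
      D.matterVal i' m = 0 ∧ D.matterVal i q = - D.matterVal i' x := by
    intro i i' hi h1 h2
    have := (hqu i i' hi h1.symm (D.reflect_symm h2)).1
    exact ⟨this, (hqu i' i this h1 h2).2⟩
  have hqa : 0 < D.rootVal a q := by
    rw [hq, rootVal_add_smul, hma, rootVal_act, rootVal_reflect_self]
    linarith [x4 a a.2]
  obtain ⟨ω', hω', hωJ'⟩ := exists_near hΦ hm1 (hΦ.isFlat m hm1 (act (D.roots.reflection a) x) x1 (-1)) hma hqa
    hm.pos fun i hi => by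
      obtain ⟨i', h1, h2⟩ := hpre i
      rw [(hqJ i i' hi h1 h2).2]
      exact neg_ne_zero.2 (x2 i')
  have hadj : ∀ {θ : D.Obj Φ}, (∀ i, D.matterVal i m ≠ 0 → θ.sgn i = D.sg m i) →
      AdjacentTo θ m := fun h i hi => by rw [h i hi, sg_eq_true]
  have hsq : ∀ i i', D.matterVal i m = 0 → D.cls i = D.cls i' →
      D.weight i = D.roots.reflection a (D.weight i') → ω'.sgn i = !σ'.sgn i' := by
    intro i i' hi h1 h2
    rw [hωJ' i hi, x3]
    simp only [← hq, sg, (hqJ i i' hi h1 h2).2]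
    rcases lt_or_gt_of_ne (x2 i') with h | h <;> simp [h, h.le]
  have hopp : OppositeAt a m ω ω' := by
    intro i i' hi h1 h2
    rw [hsq i' i (hqu i i' hi h1 h2).1 h1 h2, hωJ i hi, x3]
  obtain ⟨g, hg⟩ := A.mixed a j m hm ρ τ ω ω' (hadj hρm) (hadj hτm) (hadj hω) (hadj hω') hρJ hτJ
    hopp hρ hτ
  obtain ⟨l, hl⟩ := exists_good hΦ (hv.act a) ω'
  have key : ∀ {θ : D.Obj Φ} (hθ : D.Stable Φ a θ.sgn)
      (_ : ∀ i, D.matterVal i m ≠ 0 → θ.sgn i = D.sg m i) (_ : Between σ' v θ),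
      Good σ σ' v (⟨a, θ, hθ⟩ :: l) ∧ A.E σ σ' (⟨a, θ, hθ⟩ :: l) =
        A.wall ω σ' ≫ (A.wall θ ω ≫ A.psi a θ hθ ≫ A.wall ω' θ) ≫ A.E σ ω' l := by
    intro θ hθ hθm hθv
    have hpf : ∀ i, θ.sgn i = D.sg (act (D.roots.reflection a) v) i →
        ω'.sgn i = D.sg (act (D.roots.reflection a) v) i := by
      intro i hi
      by_cases h0 : D.matterVal i m = 0
      · obtain ⟨i', h1, h2⟩ := hpre i
        have e : D.sg (act (D.roots.reflection a) v) i = D.sg v i' := by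
          simp only [sg, D.matterVal_act h1 h2]
        rw [e, hsq i i' h0 h1 h2]
        -- At a hyperplane through `m`, `ρ` and `τ` have different signs while both lie between `σ'`
        -- and `v`; so `σ'` and `v` differ there, and the opposite chamber `ω'` agrees with `s_a v`.
        by_contra hne
        have h3 : σ'.sgn i' = D.sg v i' := by
          revert hne
          cases σ'.sgn i' <;> cases D.sg v i' <;> simp
        have h4 := (hqJ i i' h0 h1 h2).1
        have h5 := (hρJ i' h4).symm.trans ((hρv i' h3).trans ((hτv i' h3).symm.trans (hτJ i' h4)))
        simp at h5
      · rw [hω' i h0, ← hθm i h0, hi]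
    refine ⟨⟨ha, hθv, hl.of_prefix hpf⟩, ?_⟩
    have e : A.wall θ σ' = A.wall ω σ' ≫ A.wall θ ω := by
      refine (A.wall_wall _ _ _ fun i hi => ?_).symm
      by_cases h0 : D.matterVal i m = 0
      · rw [hωJ i h0, hi, x3]
      · rw [hω i h0, hθm i h0]
    rw [E_cons, e, ← wall_comp_E hl hpf]
    simp only [Category.assoc]
  obtain ⟨h1, e1⟩ := key hρ hρm hρv
  obtain ⟨h2, e2⟩ := key hτ hτm hτv
  refine hn.cong hv hc h2 h1 ?_
  rw [e1, e2, hg, ← Preadditive.comp_sub, ← Preadditive.sub_comp, add_sub_cancel_left]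
  -- The correction term of relation 4 has only the turns of `l`, which are `n` in number.
  have hlen : l.length < n + 1 := by
    have := D.negCount_reflect a.2 ha
    have := hl.length
    omega
  apply F_wall_comp
  rw [Category.assoc]
  exact F_P_comp _ (F_wall_comp (E_mem_F hlen))

include hΦ in
/-- Any two faces of the hyperplane of a simple root through which geodesics to `v` can start. -/
lemma Coh.same_root (hε : D.Generic Φ) (hn : A.Coh σ n) (hv : Target σ v)
    (hc : D.negCount v = n + 1) {a : D.base.support} (ha : D.rootVal a v < 0) {τ τ' : D.Obj Φ}
    (hτ : D.Stable Φ a τ.sgn) (hτ' : D.Stable Φ a τ'.sgn) (hτv : Between σ' v τ)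
    (hτv' : Between σ' v τ') : A.Cong σ σ' v (n + 1) ⟨a, τ, hτ⟩ ⟨a, τ', hτ'⟩ := by
  generalize hd : {i | τ.sgn i ≠ τ'.sgn i}.ncard = d
  induction d using Nat.strong_induction_on generalizing τ with
  | _ d ih =>
  subst hd
  by_cases hne : τ = τ'
  · subst hne
    exact hn.tail hv hc
  obtain ⟨x, hx, hxs, hxa, hxb⟩ := hτ.exists_face hΦ
  obtain ⟨y, hy, hys, hya, hyb⟩ := hτ'.exists_face hΦ
  -- The segment from `x` to `y` runs inside the hyperplane of `a`, and the number of signs in which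
  -- the two faces differ decreases with every crossing.
  let P : Set (Point X κ) := {p | p.2 ∈ Φ ∧ D.rootVal a p = 0}
  have hP : IsFlat P := fun p hp q hq t =>
    ⟨hΦ.isFlat p hp.1 q hq.1 t, by rw [rootVal_add_smul, hp.2, hq.2]; ring⟩
  let u : ι ⊕ {b : D.base.support // b ≠ a} → Point X κ → ℝ :=
    Sum.elim D.matterVal fun b => D.rootVal b.1
  have hu : ∀ k, IsAff (u k) := by
    rintro (i | b)
    · exact D.isAff_matterVal i
    · exact D.isAff_rootVal _
  have hux : ∀ k, u k x ≠ 0 := by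
    rintro (i | b)
    · exact hx.matter i
    · exact (hxb _ b.1.2 fun h => b.2 (Subtype.ext h)).ne'
  have huy : ∀ k, u k y ≠ 0 := by
    rintro (i | b)
    · exact hy.matter i
    · exact (hyb _ b.1.2 fun h => b.2 (Subtype.ext h)).ne'
  have hsep : ∃ k, u k x * u k y < 0 := by
    by_contra! h
    refine hne (Obj.ext (funext fun i => ?_))
    rw [← hxs, ← hys]
    exact D.sg_eq_of_mul_pos
      (lt_of_le_of_ne (h (.inl i)) (mul_ne_zero (hx.matter i) (hy.matter i)).symm)
  obtain ⟨m, hm, x₁, hx₁, ⟨k, hk⟩, hJ, hJ', hprop⟩ :=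
    exists_first_crossing hu hP (x := x) (y := y) ⟨hx.flavor, hxa⟩ ⟨hy.flavor, hya⟩ hux huy hsep
  have hroot : ∀ b : D.base.support, b ≠ a → D.rootVal b m ≠ 0 := by
    intro b hb h0
    have h1 := (hJ (.inr ⟨b, hb⟩) h0).1
    have h2 := hxb b b.2 fun h => hb (Subtype.ext h)
    have h3 := hyb b b.2 fun h => hb (Subtype.ext h)
    exact absurd h1 (mul_pos h2 h3).le.not_gt
  obtain ⟨j, rfl⟩ : ∃ j, k = .inl j := by
    rcases k with j | b
    · exact ⟨j, rfl⟩
    · exact absurd hk (hroot b.1 b.2)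
  have hmix : D.IsMixedPoint Φ a j m := by
    refine ⟨⟨hm.1, hk⟩, hm, fun b hb => ?_, fun i hi p hp => ⟨hp.1.1, ?_⟩⟩
    · exact pos_of_mul_pos_left (hJ' (.inr ⟨b, hb⟩) (hroot b hb)).1
        (hxb b b.2 fun h => hb (Subtype.ext h)).le
    · have h1 := hprop (.inl j) (.inl i) hk hi p ⟨hp.1.1, hp.2.2⟩
      have h2 : D.matterVal j p = 0 := hp.1.2
      change D.matterVal j x * D.matterVal i p = D.matterVal i x * D.matterVal j p at h1
      rw [h2, mul_zero] at h1
      exact (mul_eq_zero.1 h1).resolve_left (hx.matter j)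
  -- By genericity of `ε` all matter hyperplanes through `m` belong to one class, so their functions
  -- agree at the central point. Being proportional on the hyperplane of `a`, they agree at `x`.
  -- Hence on either side of `m` their signs are all positive or all negative, and the faces are the
  -- `ρ` and `τ` of relation 4.
  have hcls : ∀ i, D.matterVal i m = 0 → D.matterVal i x = D.matterVal j x := by
    intro i hi
    have h1 := hε j i a ⟨m, hmix.mem_matter, hmix.mem_cox⟩ (hmix.codim_two i hi)
    obtain ⟨p, hp1, hp2, f, hf, hfp⟩ := D.exists_center hΦ
    have h2 := hprop (.inl j) (.inl i) hk hi p ⟨hp1, by simp [rootVal, hp2]⟩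
    change D.matterVal j x * D.matterVal i p = D.matterVal i x * D.matterVal j p at h2
    rw [hfp, hfp, ← h1] at h2
    exact (mul_right_cancel₀ (hf _) h2).symm
  have hF : D.Face Φ x₁ := by
    refine ⟨hx₁.1, fun i h0 => ?_, fun b hb => ?_⟩
    · by_cases hi : D.matterVal i m = 0
      · have := (hJ (.inl i) hi).2
        change 0 < D.matterVal i x₁ * _ at this
        simp [h0] at this
      · have := (hJ' (.inl i) hi).2
        change 0 < D.matterVal i x₁ * _ at this
        simp [h0] at this
    · by_cases hba : b = a
      · rw [hba, hx₁.2]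
      · have := (hJ' (.inr ⟨⟨b, hb⟩, fun h => hba (congrArg Subtype.val h)⟩)
          (hroot ⟨b, hb⟩ fun h => hba (congrArg Subtype.val h))).2
        exact (pos_of_mul_pos_left this (hxb b hb hba).le).le
  let τ₁ : D.Obj Φ := objAt hΦ hF
  have hτ₁J : ∀ i, D.matterVal i m = 0 → τ₁.sgn i = τ'.sgn i := fun i hi => by
    rw [← hys]
    exact D.sg_eq_of_mul_pos (hJ (.inl i) hi).2
  have hτ₁J' : ∀ i, D.matterVal i m ≠ 0 → τ₁.sgn i = τ.sgn i := fun i hi => by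
    rw [← hxs]
    exact D.sg_eq_of_mul_pos (hJ' (.inl i) hi).2
  have hττ' : ∀ i, D.matterVal i m = 0 → τ.sgn i = !τ'.sgn i := fun i hi => by
    rw [← hxs, ← hys]
    exact D.sg_eq_not_of_mul_neg (hJ (.inl i) hi).1
  have hτm : ∀ i, D.matterVal i m ≠ 0 → τ.sgn i = D.sg m i := fun i hi => by
    rw [← hxs]
    exact (D.sg_eq_of_mul_pos (hJ' (.inl i) hi).1).symm
  have hτ₁ : D.Stable Φ a τ₁.sgn := D.stable_of_rootVal_eq_zero hx₁.2 hF.matter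
  have hτ₁v : Between σ' v τ₁ := by
    intro i hi
    by_cases h0 : D.matterVal i m = 0
    · rw [hτ₁J i h0, hτv' i hi]
    · rw [hτ₁J' i h0, hτv i hi]
  have hstep : A.Cong σ σ' v (n + 1) ⟨a, τ₁, hτ₁⟩ ⟨a, τ', hτ'⟩ := by
    refine ih _ (Set.ncard_lt_ncard ?_ (Set.toFinite _)) hτ₁ hτ₁v rfl
    refine ⟨fun i hi => ?_, fun h => ?_⟩
    · by_cases h0 : D.matterVal i m = 0
      · exact absurd (hτ₁J i h0) hi
      · rwa [Set.mem_ofPred_eq, hτ₁J' i h0] at hi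
    · refine h (a := j) ?_ (hτ₁J j hk)
      rw [Set.mem_ofPred_eq, hττ' j hk]
      simp
  refine Cong.trans hΦ hv ha hτ₁v ?_ hstep
  have hsame : ∀ i, D.matterVal i m = 0 → τ.sgn i = τ.sgn j := by
    intro i hi
    rw [← hxs]
    simp only [sg, hcls i hi]
  have hm₁ : ∀ i, D.matterVal i m ≠ 0 → τ₁.sgn i = D.sg m i :=
    fun i hi => (hτ₁J' i hi).trans (hτm i hi)
  have hopp : ∀ i, D.matterVal i m = 0 → τ₁.sgn i = !τ.sgn j := fun i hi => by
    rw [hτ₁J i hi, ← hsame i hi, hττ' i hi, Bool.not_not]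
  cases hj : τ.sgn j with
  | true =>
    refine (hn.mixed_step hΦ hv hc ha hmix hτ hτ₁ hτm hm₁ (fun i hi => (hsame i hi).trans hj)
      (fun i hi => ?_) hτv hτ₁v).symm
    rw [hopp i hi, hj, Bool.not_true]
  | false =>
    refine hn.mixed_step hΦ hv hc ha hmix hτ₁ hτ hm₁ hτm (fun i hi => ?_)
      (fun i hi => (hsame i hi).trans hj) hτ₁v hτv
    rw [hopp i hi, hj, Bool.not_false]

/-- The list of `k` alternating turns in one chamber. -/
def altTurns (s t : D.Turn Φ) : ℕ → List (D.Turn Φ)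
  | 0 => []
  | k + 1 => s :: altTurns t s k

/-- The first turn is the innermost factor of the composite, whereas `altWord` starts with the
outermost one; so parity decides which root comes first. -/
lemma E_altTurns {η : D.Obj Φ} {a b : D.base.support} (ha : D.Stable Φ a η.sgn)
    (hb : D.Stable Φ b η.sgn) (l : List (D.Turn Φ)) (k : ℕ) :
    A.E σ η (altTurns ⟨a, η, ha⟩ ⟨b, η, hb⟩ k ++ l) =
      (show A.ob η ⟶ A.ob η from
        if Even k then altWord (M := End (A.ob η)) (A.psi b η hb) (A.psi a η ha) k
        else altWord (M := End (A.ob η)) (A.psi a η ha) (A.psi b η hb) k) ≫ A.E σ η l := by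
  induction k generalizing a b with
  | zero => exact (Category.id_comp _).symm
  | succ k ih =>
    change A.E σ η (_ :: (altTurns _ _ k ++ l)) = _
    rw [E_cons, A.wall_self, Category.id_comp, ih hb ha, ← Category.assoc]
    congr 1
    by_cases hk : Even k
    · rw [if_pos hk, if_neg (by simpa [Nat.even_add_one] using hk),
        altWord_succ_right, if_pos hk]
      rfl
    · rw [if_neg hk, if_pos (by simpa [Nat.even_add_one] using hk),
        altWord_succ_right, if_neg hk]
      rfl

/-- As all these turns take place in the chamber `η`, the betweenness conditions are automatic and
only the signs of the roots remain. -/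
lemma good_altTurns {η : D.Obj Φ} {s t : D.Turn Φ} (hs : s.obj = η) (ht : t.obj = η)
    {l : List (D.Turn Φ)} (k : ℕ)
    (hl : Good σ η (D.weylAct (altWord (D.sref s.root) (D.sref t.root) k)⁻¹ v) l)
    (hneg : ∀ j < k, D.rootVal (if Even j then s.root else t.root : D.base.support)
      (D.weylAct (altWord (D.sref s.root) (D.sref t.root) j)⁻¹ v) < 0) :
    Good σ η v (altTurns s t k ++ l) := by
  induction k generalizing s t v with
  | zero => simpa [altWord, altTurns, weylAct_one] using hl
  | succ k ih =>
    have e : ∀ j, D.weylAct (altWord (D.sref s.root) (D.sref t.root) (j + 1))⁻¹ v =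
        D.weylAct (altWord (D.sref t.root) (D.sref s.root) j)⁻¹
          (act (D.roots.reflection s.root) v) := by
      intro j
      rw [altWord_succ, mul_inv_rev, weylAct_mul, inv_eq_of_mul_eq_one_left (D.sref_mul_self _),
        weylAct_sref]
    refine ⟨?_, fun i hi => hs ▸ hi, ?_⟩
    · simpa [altWord, weylAct_one] using hneg 0 (Nat.succ_pos k)
    · rw [hs]
      refine ih ht hs (e k ▸ hl) fun j hj => ?_
      have := hneg (j + 1) (by omega)
      rw [e] at this
      by_cases h : Even j
      · rw [if_neg (by simpa [Nat.even_add_one] using h)] at this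
        rwa [if_pos h]
      · rw [if_pos (by simpa [Nat.even_add_one] using h)] at this
        rwa [if_neg h]

include hΦ in
-- Both turns begin an alternating word of `m` turns in `η`, and both words lead to the same
-- translate of `v`, after which the same list `l` is used. The braid relation identifies the two
-- products exactly.
lemma Coh.two_roots (hn : A.Coh σ n) (hv : Target σ v)
    (hc : D.negCount v = n + 1) {a b : D.base.support} (hab : a ≠ b) (ha : D.rootVal a v < 0)
    (hb : D.rootVal b v < 0) {η : D.Obj Φ} (hηa : D.Stable Φ a η.sgn) (hηb : D.Stable Φ b η.sgn)
    (hηv : Between σ' v η) : A.Cong σ σ' v (n + 1) ⟨a, η, hηa⟩ ⟨b, η, hηb⟩ := by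
  obtain ⟨k, hk⟩ : ∃ k, D.coxeterM a b = k + 1 :=
    Nat.exists_eq_succ_of_ne_zero (D.coxeterM_pos a b).ne'
  obtain ⟨l, hl⟩ := exists_good hΦ
    (hv.weylAct (altWord (D.sref a) (D.sref b) (D.coxeterM a b))⁻¹) η
  have h1 : Good σ η v (altTurns ⟨a, η, hηa⟩ ⟨b, η, hηb⟩ (k + 1) ++ l) := by
    rw [hk] at hl
    refine good_altTurns (s := ⟨a, η, hηa⟩) (t := ⟨b, η, hηb⟩) rfl rfl (k + 1) hl fun j hj => ?_
    exact D.rootVal_altWord_neg hab ha hb (by omega)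
  have h2 : Good σ η v (altTurns ⟨b, η, hηb⟩ ⟨a, η, hηa⟩ (k + 1) ++ l) := by
    rw [D.altWord_sref_eq a b, hk] at hl
    refine good_altTurns (s := ⟨b, η, hηb⟩) (t := ⟨a, η, hηa⟩) rfl rfl (k + 1) hl fun j hj => ?_
    exact D.rootVal_altWord_neg hab.symm hb ha (by rw [D.coxeterM_comm]; omega)
  have e : ∀ (s t : D.Turn Φ), s.obj = η → A.E σ σ' (altTurns s t (k + 1) ++ l) =
      A.wall η σ' ≫ A.E σ η (altTurns s t (k + 1) ++ l) := by
    rintro ⟨s, _, hs⟩ t rfl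
    change A.E σ σ' (_ :: _) = A.wall _ σ' ≫ A.E σ _ (_ :: _)
    rw [E_cons, E_cons, A.wall_self, Category.id_comp]
  refine hn.cong hv hc (h1.of_prefix hηv) (h2.of_prefix hηv) ?_
  change A.E σ σ' (altTurns ⟨a, η, hηa⟩ ⟨b, η, hηb⟩ (k + 1) ++ l) -
    A.E σ σ' (altTurns ⟨b, η, hηb⟩ ⟨a, η, hηa⟩ (k + 1) ++ l) ∈ _
  have hbr := A.braid a b η hηa hηb
  rw [hk] at hbr
  rw [e _ _ rfl, e _ _ rfl, E_altTurns, E_altTurns, hbr, sub_self]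
  exact zero_mem _

end Sys

end Coherence

end Steinberg.GaugeData
end

open scoped Topology

noncomputable section

namespace Steinberg.GaugeData

/-! ### Coherence in general, and spanning by geodesic foldings -/

section Spanning

variable {R X Y ι κ : Type*} [AddCommGroup X] [AddCommGroup Y] {D : GaugeData R X Y ι κ}
  {Φ : Set (κ → ℝ)} (hΦ : IsFlavorSet Φ) {σ σ' τ : D.Obj Φ} {v : Point X κ}
  [Finite R] [Finite ι]

lemma Good.between {t : D.Turn Φ} {l : List (D.Turn Φ)} (h : Good σ σ' v (t :: l)) :
    Between σ' v t.obj := h.2.1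

include hΦ in
/-- The segment from `v` to a point `r` of the closed positive Weyl chamber enters the latter through
the hyperplanes of the roots `c` for which `-α_c(r) / α_c(v)` is minimal. -/
lemma exists_entry (hv : v.2 ∈ Φ) {r : Point X κ} (hr : r.2 ∈ Φ)
    (hr0 : ∀ c ∈ D.base.support, 0 ≤ D.rootVal c r) {c : R} (hc : D.rootVal c v < 0)
    (hcs : c ∈ D.base.support)
    (hmin : ∀ d ∈ D.base.support, D.rootVal d v < 0 →
      D.rootVal c v * D.rootVal d r ≤ D.rootVal d v * D.rootVal c r) :
    ∃ η : D.Obj Φ, (∀ i, 0 < D.matterVal i r * D.matterVal i v → η.sgn i = D.sg v i) ∧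
      ∀ d ∈ D.base.support, D.rootVal d v < 0 →
        D.rootVal c v * D.rootVal d r = D.rootVal d v * D.rootVal c r →
        D.Stable Φ d η.sgn := by
  have hcr := hr0 c hcs
  have hden : 0 < D.rootVal c r - D.rootVal c v := by linarith
  -- This is the parameter at which the root `c` vanishes on the segment from `v` to `r`; by
  -- minimality the other simple roots are nonnegative there.
  obtain ⟨s, hs⟩ : ∃ s, s = - D.rootVal c v / (D.rootVal c r - D.rootVal c v) := ⟨_, rfl⟩
  have hs0 : 0 < s := hs ▸ div_pos (by linarith) hden
  have hs1 : s ≤ 1 := hs ▸ (div_le_one hden).2 (by linarith)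
  have hse : s * (D.rootVal c r - D.rootVal c v) = - D.rootVal c v := by
    rw [hs]; exact div_mul_cancel₀ _ hden.ne'
  set e := v + s • (r - v) with he
  have hval : ∀ d, (D.rootVal c r - D.rootVal c v) * D.rootVal d e =
      D.rootVal d v * D.rootVal c r - D.rootVal c v * D.rootVal d r := by
    intro d
    rw [he, rootVal_add_smul]
    linear_combination (D.rootVal d r - D.rootVal d v) * hse
  have hroot : ∀ d ∈ D.base.support, 0 ≤ D.rootVal d e := by
    intro d hd
    rcases lt_or_ge (D.rootVal d v) 0 with h | h
    · refine nonneg_of_mul_nonneg_right (a := D.rootVal c r - D.rootVal c v) ?_ hden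
      rw [hval]
      linarith [hmin d hd h]
    · rw [he, rootVal_add_smul]
      nlinarith [hr0 d hd]
  -- A small move towards the central point leaves the matter hyperplanes and only rescales the
  -- roots, so roots that vanish continue to do so.
  obtain ⟨p, hp1, hp2, f, hf, hfp⟩ := D.exists_center hΦ
  have hpr : ∀ d, D.rootVal d p = 0 := fun d => by simp [rootVal, hp2]
  have h1 : ∀ᶠ δ in 𝓝[>] (0 : ℝ), ∀ i, D.matterVal i e + δ * (D.matterVal i p - D.matterVal i e) ≠ 0
      ∧ (D.matterVal i e ≠ 0 →
        0 < (D.matterVal i e + δ * (D.matterVal i p - D.matterVal i e)) * D.matterVal i e) := by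
    refine Filter.eventually_all.2 fun i => Filter.Eventually.and ?_ ?_
    · refine eventually_add_mul_ne ?_
      by_cases h : D.matterVal i e = 0
      · right
        rw [h, sub_zero, hfp]
        exact hf _
      · exact Or.inl h
    · by_cases h : D.matterVal i e = 0
      · simp [h]
      · filter_upwards [eventually_same_sign h (D.matterVal i p - D.matterVal i e)] with δ hδ _
          using hδ
  obtain ⟨δ, hδ, hδ1⟩ := (h1.and eventually_lt_one).exists
  have hroot' : ∀ d, D.rootVal d (e + δ • (p - e)) = (1 - δ) * D.rootVal d e := by
    intro d
    rw [rootVal_add_smul, hpr]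
    ring
  have hF : D.Face Φ (e + δ • (p - e)) := by
    refine ⟨hΦ.isFlat e (hΦ.isFlat v hv r hr s) p hp1 δ, fun i => ?_, fun d hd => ?_⟩
    · rw [matterVal_add_smul]
      exact (hδ i).1
    · rw [hroot']
      exact mul_nonneg (by linarith) (hroot d hd)
  refine ⟨objAt hΦ hF, fun i hi => ?_, fun d hd hdv hdc => ?_⟩
  · have hei : 0 < D.matterVal i e * D.matterVal i v := by
      rw [he, matterVal_add_smul]
      have h2 : 0 < D.matterVal i v * D.matterVal i v :=
        mul_self_pos.2 fun h => by simp [h] at hi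
      nlinarith
    have h3 := (hδ i).2 fun h => by simp [h] at hei
    rw [← matterVal_add_smul] at h3
    exact (D.sg_eq_of_mul_pos h3).trans (D.sg_eq_of_mul_pos hei)
  · refine D.stable_of_rootVal_eq_zero ?_ hF.matter
    have h2 := hval d
    rw [hdc, sub_self] at h2
    rw [hroot', (mul_eq_zero.1 h2).resolve_left hden.ne', mul_zero]

namespace Sys

variable {S : Type*} [CommRing S] {C : Type*} [Category C] [Preadditive C] {A : Sys D Φ S C}
  {n : ℕ}

include hΦ in
-- A point `r` moves along a segment from the face of `t` to the face of `t'`. The simple hyperplane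
-- through which the segment from `v` to `r` enters the Weyl chamber passes from `a` to `b`. When it
-- changes, two roots occur at once, and `Coh.two_roots` links them; `Coh.same_root` makes the face
-- on each hyperplane irrelevant.
lemma Coh.turns (hε : D.Generic Φ) (hn : A.Coh σ n) (hv : Target σ v)
    (hc : D.negCount v = n + 1) {t t' : D.Turn Φ} (ht : D.rootVal t.root v < 0)
    (ht' : D.rootVal t'.root v < 0) (htv : Between σ' v t.obj) (htv' : Between σ' v t'.obj) :
    A.Cong σ σ' v (n + 1) t t' := by
  obtain ⟨a, τ, hτ⟩ := t
  obtain ⟨b, τ', hτ'⟩ := t'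
  by_contra hcon
  obtain ⟨z, hz, hzs, hza, -⟩ := hτ.exists_face hΦ
  obtain ⟨y, hy, hys, hyb, -⟩ := hτ'.exists_face hΦ
  obtain ⟨v1, v2, v3⟩ := hv.regular
  -- `Rel c` says that all admissible turns at `c` are congruent to the first one.
  let Rel : D.base.support → Prop := fun c => D.rootVal c v < 0 ∧
    ∀ (η : D.Obj Φ) (hη : D.Stable Φ c η.sgn), Between σ' v η →
      A.Cong σ σ' v (n + 1) ⟨a, τ, hτ⟩ ⟨c, η, hη⟩
  have hRa : Rel a := ⟨ht, fun η hη hηv => hn.same_root hΦ hε hv hc ht hτ hη htv hηv⟩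
  have hRb : ¬ Rel b := fun h => hcon (h.2 τ' hτ' htv')
  -- For `s` in `[0, 1]` and `c` negative at `v`, membership in `T c` means that the segment from
  -- `v` to the point with parameter `s` enters the closed Weyl chamber through the hyperplane of
  -- `c`.
  let T : D.base.support → Set ℝ := fun c => {s | ∀ d : D.base.support, D.rootVal d v < 0 →
    D.rootVal c v * D.rootVal d (z + s • (y - z)) ≤ D.rootVal d v * D.rootVal c (z + s • (y - z))}
  have hTc : ∀ c, IsClosed (T c) := by
    intro c
    simp only [T, rootVal_add_smul, Set.ofPred_forall]
    refine isClosed_iInter fun d => isClosed_iInter fun _ => isClosed_le ?_ ?_ <;> fun_prop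
  have hcover : ∀ s : ℝ, ∃ c : D.base.support, D.rootVal c v < 0 ∧ s ∈ T c := by
    intro s
    have : Finite {c : D.base.support // D.rootVal c v < 0} := inferInstance
    have : Nonempty {c : D.base.support // D.rootVal c v < 0} := ⟨⟨a, ht⟩⟩
    obtain ⟨c, hc⟩ := Finite.exists_min fun c : {c : D.base.support // D.rootVal c v < 0} =>
      D.rootVal c (z + s • (y - z)) / (- D.rootVal c v)
    refine ⟨c.1, c.2, fun d hd => ?_⟩
    have := hc ⟨d, hd⟩
    have hc' := c.2
    rw [div_le_div_iff₀ (by linarith) (by linarith)] at this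
    linarith
  have hpre : _root_.IsPreconnected (Set.Icc (0 : ℝ) 1) := isPreconnected_Icc
  rw [isPreconnected_closed_iff] at hpre
  -- The interval is covered by two closed sets, for the roots with and without `Rel`. The first
  -- contains `0` and the second contains `1`, so they meet.
  obtain ⟨s, ⟨hs0, hs1⟩, hsU, hsV⟩ := hpre (⋃ c ∈ {c | Rel c}, T c)
    (⋃ c ∈ {c : D.base.support | D.rootVal c v < 0 ∧ ¬ Rel c}, T c)
    (Set.Finite.isClosed_biUnion (Set.toFinite _) fun c _ => hTc c)
    (Set.Finite.isClosed_biUnion (Set.toFinite _) fun c _ => hTc c)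
    (fun s _ => by
      obtain ⟨c, hc, hs⟩ := hcover s
      by_cases h : Rel c
      · exact Or.inl (Set.mem_biUnion (x := c) h hs)
      · exact Or.inr (Set.mem_biUnion (x := c) ⟨hc, h⟩ hs))
    ⟨0, by simp, Set.mem_biUnion (x := a) hRa fun d hd => by
      rw [zero_smul, add_zero, hza, mul_zero]
      exact mul_nonpos_of_nonpos_of_nonneg ht.le (hz.root d d.2)⟩
    ⟨1, by simp, Set.mem_biUnion (x := b) ⟨ht', hRb⟩ fun d hd => by
      rw [one_smul, add_sub_cancel, hyb, mul_zero]
      exact mul_nonpos_of_nonpos_of_nonneg ht'.le (hy.root d d.2)⟩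
  simp only [Set.mem_iUnion, Set.mem_ofPred_eq] at hsU hsV
  obtain ⟨c, hRc, hTcs⟩ := hsU
  obtain ⟨d, ⟨hdv, hRd⟩, hTds⟩ := hsV
  set r := z + s • (y - z) with hr
  have hr0 : ∀ e ∈ D.base.support, 0 ≤ D.rootVal e r := by
    intro e he
    rw [hr, rootVal_add_smul]
    nlinarith [hz.root e he, hy.root e he]
  obtain ⟨η, hη, hst⟩ := exists_entry hΦ v1 (hΦ.isFlat z hz.flavor y hy.flavor s) hr0 hRc.1 c.2
    fun e he hev => hTcs ⟨e, he⟩ hev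
  have hηc := hst c c.2 hRc.1 rfl
  have hηd := hst d d.2 hdv (le_antisymm (hTcs d hdv) (hTds c hRc.1))
  have hηv : Between σ' v η := by
    intro i hi
    refine hη i ?_
    have h1 := D.mul_pos_of_sg_eq (hz.matter i) (v2 i) (by rw [hzs]; exact htv i hi)
    have h2 := D.mul_pos_of_sg_eq (hy.matter i) (v2 i) (by rw [hys]; exact htv' i hi)
    rw [matterVal_add_smul]
    rcases eq_or_lt_of_le hs0 with h | h
    · rw [← h]
      linarith
    · nlinarith [mul_pos h h2]
  have hcd : c ≠ d := by
    rintro rfl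
    exact hRd hRc
  refine hRd ⟨hdv, fun θ hθ hθv => ?_⟩
  exact ((hRc.2 η hηc hηv).trans hΦ hv hRc.1 hηv
    (hn.two_roots hΦ hv hc hcd hRc.1 hdv hηc hηd hηv)).trans hΦ hv hdv hηv
    (hn.same_root hΦ hε hv hc hdv hηd hθ hηv hθv)

include hΦ in
variable (A) in
theorem coh (hε : D.Generic Φ) (σ : D.Obj Φ) (n : ℕ) : A.Coh σ n := by
  induction n with
  | zero =>
    intro σ' v l l' _ hn hl hl'
    rw [List.eq_nil_of_length_eq_zero (hl.length.trans hn),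
      List.eq_nil_of_length_eq_zero (hl'.length.trans hn), sub_self]
    exact zero_mem _
  | succ n ih =>
    intro σ' v l l' hv hn hl hl'
    obtain ⟨t, l, rfl⟩ := List.exists_cons_of_length_eq_add_one (hl.length.trans hn)
    obtain ⟨t', l', rfl⟩ := List.exists_cons_of_length_eq_add_one (hl'.length.trans hn)
    exact ih.turns hΦ hε hv hn hl.1 hl'.1 hl.between hl'.between l l' hl hl'

include hΦ in
-- If the root is positive at `v`, prepending the turn gives a good list for the reflected target.
-- If it is negative, coherence allows the list to be replaced by one that begins with the same
-- turn, so that the leading term contains `psi ≫ psi = 0`.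
lemma psi_comp_mem (hε : D.Generic Φ) (hFG : ∀ τ, A.F τ σ n ≤ A.G τ σ n) (t : D.Turn Φ)
    {x : A.ob t.obj ⟶ A.ob σ} (hx : x ∈ A.G t.obj σ n) :
    A.psi t.root t.obj t.stable ≫ x ∈ A.G t.obj σ (n + 1) := by
  refine mem_of_closure (Preadditive.leftComp _ (A.psi t.root t.obj t.stable)) ?_ hx
  rintro _ ⟨f, l, v, hv, hl, hln, rfl⟩
  change A.psi t.root t.obj t.stable ≫ A.P t.obj f ≫ A.E σ t.obj l ∈ _
  obtain ⟨g, g', h⟩ := A.psi_P t.root t.obj t.stable f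
  rw [← Category.assoc, h, Preadditive.add_comp, Category.assoc]
  refine add_mem (G_P_comp _ ?_) (G_P_comp _ (E_mem_G hv hl (by omega)))
  have hE : ∀ l, A.E σ t.obj (t :: l) = A.psi t.root t.obj t.stable ≫ A.E σ t.obj l := fun l => by
    rw [E_cons, A.wall_self, Category.id_comp]
  rcases lt_or_gt_of_ne (hv.regular.2.2 t.root) with h0 | h0
  · obtain ⟨l', hl'⟩ := exists_good hΦ (hv.act t.root) t.obj
    have hgood : Good σ t.obj v (t :: l') := ⟨h0, fun _ hi => hi, hl'⟩
    have h1 := A.coh hΦ hε σ _ _ _ l (t :: l') hv rfl hl hgood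
    have h2 := F_wall_psi_comp (σ' := t.obj) t h1
    rw [A.wall_self, Category.id_comp, Preadditive.comp_sub, hE,
      ← Category.assoc (A.psi _ _ _), A.psi_psi, Limits.zero_comp, sub_zero] at h2
    have := hl.length
    exact G_mono (Nat.le_succ n) (hFG _ (F_mono (by omega) h2))
  · rw [← hE]
    refine E_mem_G (hv.act t.root) (v := act (D.roots.reflection t.root) v)
      ⟨?_, fun _ hi => hi, ?_⟩ (by simpa using hln)
    · rw [rootVal_act, rootVal_reflect_self]
      linarith
    · rwa [act_reflection_act]

include hΦ in
-- The walls are crossed one hyperplane at a time. A crossing towards `v` prolongs a good list. For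
-- a crossing away from `v`, coherence replaces the list by one that first crosses back, and the
-- crossing to and fro is a polynomial.
lemma wall_comp_mem (hε : D.Generic Φ) (hFG : ∀ τ, A.F τ σ n ≤ A.G τ σ n) (τ σ' : D.Obj Φ)
    {x : A.ob τ ⟶ A.ob σ} (hx : x ∈ A.G τ σ (n + 1)) :
    A.wall τ σ' ≫ x ∈ A.G σ' σ (n + 1) := by
  generalize hd : {i | τ.sgn i ≠ σ'.sgn i}.ncard = d
  induction d using Nat.strong_induction_on generalizing σ' with
  | _ d ih =>
  subst hd
  by_cases hne : τ = σ'
  · subst hne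
    rwa [A.wall_self, Category.id_comp]
  obtain ⟨p, hp⟩ := σ'.exists_point
  obtain ⟨q, hq⟩ := τ.exists_point
  obtain ⟨p1, p2, p3, p4⟩ := D.mem_posChamber_iff.1 hp
  obtain ⟨q1, q2, q3, q4⟩ := D.mem_posChamber_iff.1 hq
  have hsep : ∃ k, D.val k p * D.val k q < 0 := by
    by_contra! h
    refine hne (Obj.ext (funext fun i => ?_))
    rw [p3, q3]
    exact (D.sg_eq_of_mul_pos
      (lt_of_le_of_ne (h (.inl i)) (mul_ne_zero (p2 i) (q2 i)).symm)).symm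
  obtain ⟨m, hm, x₁, hx₁, ⟨k, hk⟩, hJ, hJ', hprop⟩ := exists_first_crossing D.isAff_val
    hΦ.isFlat (x := p) (y := q) p1 q1 ((D.regular_iff).1 (regular_of_mem hp)).2
    ((D.regular_iff).1 (regular_of_mem hq)).2 hsep
  have hroot : ∀ b : R, D.val (.inr b) m ≠ 0 := by
    intro b h0
    have h1 := (hJ (.inr b) h0).1
    by_cases hb : D.base.IsPos b
    · exact absurd h1 (mul_pos (D.rootVal_pos hb p4) (D.rootVal_pos hb q4)).le.not_gt
    · exact absurd h1 (mul_pos_of_neg_of_neg (D.rootVal_neg hb p4) (D.rootVal_neg hb q4)).le.not_gt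
  obtain ⟨j, rfl⟩ : ∃ j, k = .inl j := by
    rcases k with j | b
    · exact ⟨j, rfl⟩
    · exact absurd hk (hroot b)
  have hF : D.Face Φ x₁ := by
    refine ⟨hx₁, fun i h0 => ?_, fun b hb => ?_⟩
    · by_cases hi : D.val (.inl i) m = 0
      · have := (hJ (.inl i) hi).2
        change 0 < D.matterVal i x₁ * _ at this
        simp [h0] at this
      · have := (hJ' (.inl i) hi).2
        change 0 < D.matterVal i x₁ * _ at this
        simp [h0] at this
    · exact (pos_of_mul_pos_left (hJ' (.inr b) (hroot b)).2 (p4 b hb).le).le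
  let τ₁ : D.Obj Φ := objAt hΦ hF
  have hτ₁J : ∀ i, D.matterVal i m = 0 → τ₁.sgn i = τ.sgn i := fun i hi => by
    rw [q3]
    exact D.sg_eq_of_mul_pos (hJ (.inl i) hi).2
  have hτ₁J' : ∀ i, D.matterVal i m ≠ 0 → τ₁.sgn i = σ'.sgn i := fun i hi => by
    rw [p3]
    exact D.sg_eq_of_mul_pos (hJ' (.inl i) hi).2
  have hττ' : ∀ i, D.matterVal i m = 0 → τ.sgn i = !σ'.sgn i := fun i hi => by
    rw [p3, q3]
    exact D.sg_eq_not_of_mul_neg (by rw [mul_comm]; exact (hJ (.inl i) hi).1)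
  have hstep : A.wall τ τ₁ ≫ x ∈ A.G τ₁ σ (n + 1) := by
    refine ih _ (Set.ncard_lt_ncard ?_ (Set.toFinite _)) τ₁ rfl
    refine ⟨fun i hi => ?_, fun h => ?_⟩
    · by_cases h0 : D.matterVal i m = 0
      · exact absurd (hτ₁J i h0).symm hi
      · rwa [Set.mem_ofPred_eq, hτ₁J' i h0] at hi
    · refine h (a := j) ?_ (hτ₁J j hk).symm
      rw [Set.mem_ofPred_eq, hττ' j hk]
      simp
  have hw : A.wall τ₁ σ' ≫ A.wall τ τ₁ = A.wall τ σ' := by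
    refine A.wall_wall _ _ _ fun i hi => ?_
    by_cases h0 : D.matterVal i m = 0
    · exact hτ₁J i h0
    · rw [hτ₁J' i h0, hi]
  rw [← hw, Category.assoc]
  refine mem_of_closure (Preadditive.leftComp _ (A.wall τ₁ σ')) ?_ hstep
  rintro _ ⟨f, l, v, hv, hl, hln, rfl⟩
  change A.wall τ₁ σ' ≫ A.P τ₁ f ≫ A.E σ τ₁ l ∈ _
  rw [← Category.assoc, A.wall_P, Category.assoc]
  apply G_P_comp
  have hvm := hv.regular.2.1
  -- The functions vanishing at `m` are proportional, so `v` lies on the side of `σ'` for all of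
  -- them or for none.
  have hsame : ∀ i, D.matterVal i m = 0 → (D.sg v i = σ'.sgn i ↔ D.sg v j = σ'.sgn j) := by
    have aux : ∀ i, D.matterVal i m = 0 →
        (D.sg v i = σ'.sgn i ↔ 0 < D.matterVal i p * D.matterVal i v) := fun i _ => by
      rw [p3]
      refine ⟨fun h => D.mul_pos_of_sg_eq (p2 i) (hvm i) h.symm,
        fun h => (D.sg_eq_of_mul_pos h).symm⟩
    intro i hi
    rw [aux i hi, aux j hk]
    have h1 := hprop (.inl i) (.inl j) hi hk v hv.flavor
    change D.matterVal i p * D.matterVal j v = D.matterVal j p * D.matterVal i v at h1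
    have h2 : (D.matterVal i p * D.matterVal i v) * (D.matterVal j p * D.matterVal j v) =
      (D.matterVal i p * D.matterVal j v) * (D.matterVal i p * D.matterVal j v) := by
      linear_combination - (D.matterVal i p * D.matterVal j v) * h1
    have h3 : 0 < (D.matterVal i p * D.matterVal i v) * (D.matterVal j p * D.matterVal j v) :=
      h2 ▸ mul_self_pos.2 (mul_ne_zero (p2 i) (hvm j))
    exact ⟨fun h => pos_of_mul_pos_right h3 h.le, fun h => pos_of_mul_pos_left h3 h.le⟩
  by_cases hj : D.sg v j = σ'.sgn j
  -- The target is on the side of `σ'`, so the crossing to `τ₁` is superfluous.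
  · obtain ⟨l', hl'⟩ := exists_good hΦ hv σ'
    have hpf : ∀ i, τ₁.sgn i = D.sg v i → σ'.sgn i = D.sg v i := by
      intro i hi
      by_cases h0 : D.matterVal i m = 0
      · exact ((hsame i h0).2 hj).symm
      · rwa [← hτ₁J' i h0]
    have h1 := A.coh hΦ hε σ _ _ _ l l' hv rfl hl (hl'.of_prefix hpf)
    rw [← wall_comp_E hl' hpf] at h1
    have h2 := F_wall_comp (σ' := σ') h1
    rw [Preadditive.comp_sub] at h2
    have hlen := hl.length
    have hlen' := hl'.length
    have h3 := G_mono (Nat.le_succ n) (hFG _ (F_mono (by omega) h2))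
    have h4 : A.wall τ₁ σ' ≫ A.wall σ' τ₁ ≫ A.E σ σ' l' ∈ A.G σ' σ (n + 1) := by
      obtain ⟨g, hg⟩ := A.wall_wall' σ' τ₁ σ'
      rw [← Category.assoc, hg, A.wall_self, Category.comp_id]
      exact G_P_comp _ (E_mem_G hv hl' (by omega))
    have h5 := add_mem h3 h4
    rwa [sub_add_cancel] at h5
  · have hpf : ∀ i, σ'.sgn i = D.sg v i → τ₁.sgn i = D.sg v i := by
      intro i hi
      by_cases h0 : D.matterVal i m = 0
      · exact absurd hi.symm fun h => hj ((hsame i h0).1 h)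
      · rwa [hτ₁J' i h0]
    rw [wall_comp_E hl hpf]
    exact E_mem_G hv (hl.of_prefix hpf) hln

include hΦ in
lemma F_le_G (hε : D.Generic Φ) (n : ℕ) (σ' : D.Obj Φ) : A.F σ' σ n ≤ A.G σ' σ n := by
  induction n generalizing σ' with
  | zero =>
    refine (AddSubgroup.closure_le _).2 ?_
    rintro _ ⟨f, l, hl, rfl⟩
    omega
  | succ n ih =>
    refine (AddSubgroup.closure_le _).2 ?_
    rintro _ ⟨f, l, hl, rfl⟩
    refine G_P_comp _ ?_
    cases l with
    | nil =>
      obtain ⟨p, hp⟩ := σ.exists_point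
      exact E_mem_G ⟨1, p, hp, (D.weylAct_one p).symm⟩ hp hl
    | cons t l =>
      rw [E_cons]
      exact wall_comp_mem hΦ hε ih _ _
        (psi_comp_mem hΦ hε ih t (ih _ (E_mem_F (by simpa using hl))))

include hΦ in
/-- The products attached to geodesic foldings, one for each element of the Weyl group, span. -/
theorem exists_expansion (hε : D.Generic Φ) [Fintype D.roots.weylGroup]
    {l : D.roots.weylGroup → List (D.Turn Φ)} {z : D.roots.weylGroup → Point X κ}
    (hz : ∀ w, z w ∈ D.posChamber Φ σ.sgn) (hl : ∀ w, Good σ σ' (D.weylAct w (z w)) (l w)) (n : ℕ)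
    {x : A.ob σ' ⟶ A.ob σ} (hx : x ∈ A.F σ' σ n) :
    ∃ g : D.roots.weylGroup → S, x = ∑ w, A.P σ' (g w) ≫ A.E σ σ' (l w) := by
  classical
  have hP0 : A.P σ' 0 = 0 := by simpa using A.P_add σ' 0 0
  let T : AddSubgroup (A.ob σ' ⟶ A.ob σ) :=
    { carrier := {x | ∃ g : D.roots.weylGroup → S, x = ∑ w, A.P σ' (g w) ≫ A.E σ σ' (l w)}
      zero_mem' := ⟨0, by simp [hP0]⟩
      add_mem' := by
        rintro _ _ ⟨g, rfl⟩ ⟨g', rfl⟩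
        refine ⟨g + g', ?_⟩
        simp only [Pi.add_apply, A.P_add, Preadditive.add_comp, Finset.sum_add_distrib]
      neg_mem' := by
        rintro _ ⟨g, rfl⟩
        refine ⟨-g, ?_⟩
        rw [← Finset.sum_neg_distrib]
        refine Finset.sum_congr rfl fun w _ => ?_
        rw [← Preadditive.neg_comp]
        congr 1
        have := A.P_add σ' (g w) (-g w)
        rw [add_neg_cancel, hP0] at this
        exact neg_eq_of_add_eq_zero_right this.symm }
  have hTP : ∀ f, ∀ x ∈ T, A.P σ' f ≫ x ∈ T := by
    rintro f _ ⟨g, rfl⟩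
    refine ⟨fun w => f * g w, ?_⟩
    rw [Preadditive.comp_sum]
    refine Finset.sum_congr rfl fun w _ => ?_
    rw [A.P_mul, Category.assoc]
  have hTE : ∀ w, A.E σ σ' (l w) ∈ T := by
    intro w
    refine ⟨fun w' => if w' = w then 1 else 0, ?_⟩
    rw [Finset.sum_eq_single w]
    · simp [A.P_one]
    · intro w' _ h
      simp [h, hP0]
    · simp
  suffices h : ∀ n, A.F σ' σ n ≤ T from h n hx
  intro n
  induction n with
  | zero =>
    refine (AddSubgroup.closure_le _).2 ?_
    rintro _ ⟨f, l, hl, rfl⟩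
    omega
  | succ n ih =>
    refine (F_le_G hΦ hε _ _).trans ((AddSubgroup.closure_le _).2 ?_)
    rintro _ ⟨f, l', v, ⟨w, p, hp, rfl⟩, hgood, hln, rfl⟩
    refine hTP _ _ ?_
    have hv' : Target σ (D.weylAct w (z w)) := ⟨w, _, hz w, rfl⟩
    have hgood' := hgood.congr hv'.flavor (val_weylAct_mul_pos hp (hz w))
    -- The given folding and the chosen one for `w` differ by terms with fewer turns, to which the
    -- induction applies.
    have h1 := A.coh hΦ hε σ _ _ _ l' (l w) hv' rfl hgood' (hl w)
    have hlen := hgood'.length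
    have h2 := add_mem (ih (F_mono (by omega) h1)) (hTE w)
    rwa [sub_add_cancel] at h2

end Sys

end Spanning

end Steinberg.GaugeData
end

noncomputable section

namespace Steinberg.GaugeData

/-! ### The polynomial representation -/

section Polynomial

variable {R X Y ι κ : Type*} [AddCommGroup X] [AddCommGroup Y]

variable (X κ) in
/-- The integral polynomials on `𝔱` and on the flavors. -/
abbrev ExtSym : Type _ := SymmetricAlgebra ℤ (X × (κ → ℤ))

/-- The polynomial defined by a character and a linear function of the flavor. -/
abbrev extChar (μ : X × (κ → ℤ)) : ExtSym X κ := SymmetricAlgebra.ι ℤ (X × (κ → ℤ)) μ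

/-- The action of an automorphism of the character lattice. -/
def extAct (g : X ≃ₗ[ℤ] X) : ExtSym X κ →ₐ[ℤ] ExtSym X κ :=
  SymmetricAlgebra.lift
    (SymmetricAlgebra.ι ℤ (X × (κ → ℤ)) ∘ₗ LinearMap.prodMap (g : X →ₗ[ℤ] X) LinearMap.id)

lemma extAct_char (g : X ≃ₗ[ℤ] X) (μ : X × (κ → ℤ)) :
    extAct g (extChar μ) = extChar (g μ.1, μ.2) :=
  SymmetricAlgebra.lift_ι_apply _ _

lemma extAct_mul (g h : X ≃ₗ[ℤ] X) (f : ExtSym X κ) :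
    extAct (g * h) f = extAct g (extAct h f) := by
  change _ = ((extAct g).comp (extAct h)) f
  congr 1
  refine SymmetricAlgebra.algHom_ext (LinearMap.ext fun μ => ?_)
  simp [extAct_char]

lemma extAct_one (f : ExtSym X κ) : extAct (1 : X ≃ₗ[ℤ] X) f = f := by
  change _ = AlgHom.id ℤ _ f
  congr 1
  refine SymmetricAlgebra.algHom_ext (LinearMap.ext fun μ => ?_)
  simp [extAct_char]

variable (D : GaugeData R X Y ι κ)

/-- The perfect pairing embeds `X` into the dual of `Y`, which has no torsion. -/
lemma free_charLattice (D : GaugeData R X Y ι κ) [Module.Finite ℤ X] : Module.Free ℤ X := by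
  have : Module.IsTorsionFree ℤ X := by
    have e : Function.Injective D.roots.toLinearMap :=
      (D.roots.toPerfPair).injective
    exact e.moduleIsTorsionFree _ fun n x => map_smul D.roots.toLinearMap n x
  exact Module.free_of_finite_type_torsion_free'

lemma isDomain_extSym (D : GaugeData R X Y ι κ) [Module.Finite ℤ X] [Finite κ] :
    IsDomain (ExtSym X κ) := by
  have := D.free_charLattice
  infer_instance

/-- The map to the trivial square-zero extension recovers the linear part. -/
lemma extChar_injective : Function.Injective (extChar (X := X) (κ := κ)) := by
  let _ : Module ℤᵐᵒᵖ (X × (κ → ℤ)) := Module.compHom _ ((RingHom.id ℤ).fromOpposite mul_comm)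
  have : IsCentralScalar ℤ (X × (κ → ℤ)) := ⟨fun _ _ => rfl⟩
  refine Function.LeftInverse.injective (g := fun x => TrivSqZeroExt.snd
    (SymmetricAlgebra.lift (TrivSqZeroExt.inrHom ℤ (X × (κ → ℤ))) x)) fun μ => ?_
  simp [extChar]

lemma extChar_ne_zero {μ : X × (κ → ℤ)} (h : μ ≠ 0) : extChar μ ≠ 0 :=
  fun h0 => h (extChar_injective (h0.trans (map_zero _).symm))

/-- A root as a polynomial. -/
def extRoot (a : R) : ExtSym X κ := extChar (D.roots.root a, 0)

/-- A weight of the representation, including the flavor. -/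
def extWeight (i : ι) : ExtSym X κ := by
  classical exact extChar (D.weight i, Pi.single (D.cls i) 1)

lemma extRoot_ne_zero (a : R) : D.extRoot a ≠ (0 : ExtSym X κ) :=
  extChar_ne_zero fun h => D.roots.ne_zero a (congrArg Prod.fst h)

lemma extWeight_ne_zero (i : ι) : D.extWeight i ≠ 0 := by
  classical
  refine extChar_ne_zero fun h => ?_
  have := congrFun (congrArg Prod.snd h) (D.cls i)
  simp at this

lemma extAct_weight {g : X ≃ₗ[ℤ] X} {i i' : ι} (hc : D.cls i' = D.cls i)
    (hw : D.weight i' = g (D.weight i)) : extAct g (D.extWeight i) = D.extWeight i' := by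
  rw [extWeight, extAct_char, extWeight, hc, hw]

lemma extAct_reflection_char (a : R) (μ : X × (κ → ℤ)) :
    extAct (D.roots.reflection a) (extChar μ) =
      extChar μ - (D.roots.coroot' a μ.1 : ℤ) • D.extRoot a := by
  rw [extAct_char, extRoot, ← map_smul, ← map_sub]
  congr 1
  refine Prod.ext ?_ (by simp)
  simp [RootPairing.reflection_apply]

lemma extAct_extRoot (a : R) :
    extAct (D.roots.reflection a) (D.extRoot a : ExtSym X κ) = - D.extRoot a := by
  rw [extRoot, extAct_char, ← map_neg]
  simp [RootPairing.reflection_apply_self]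

lemma extAct_extAct (a : R) (f : ExtSym X κ) :
    extAct (D.roots.reflection a) (extAct (D.roots.reflection a) f) = f := by
  rw [← extAct_mul]
  have : D.roots.reflection a * D.roots.reflection a = 1 := by
    ext χ; simp
  rw [this, extAct_one]

lemma extRoot_dvd (a : R) (f : ExtSym X κ) :
    D.extRoot a ∣ extAct (D.roots.reflection a) f - f := by
  induction f using SymmetricAlgebra.induction with
  | algebraMap r => simp
  | ι μ =>
    have := D.extAct_reflection_char a μ
    rw [extChar] at this
    rw [this, sub_sub_cancel_left, ← neg_smul]
    exact dvd_smul_of_dvd _ dvd_rfl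
  | mul f g hf hg =>
    have h := dvd_add (hf.mul_right (extAct (D.roots.reflection a) g)) (hg.mul_left f)
    rw [map_mul]
    convert h using 1
    ring
  | add f g hf hg =>
    have h := dvd_add hf hg
    rw [map_add]
    convert h using 1
    ring

/-- The Demazure operator on integral polynomials. -/
def extDem (a : R) (f : ExtSym X κ) : ExtSym X κ := (D.extRoot_dvd a f).choose

lemma extDem_spec (a : R) (f : ExtSym X κ) :
    extAct (D.roots.reflection a) f - f = D.extRoot a * D.extDem a f :=
  (D.extRoot_dvd a f).choose_spec

variable [IsDomain (ExtSym X κ)]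

lemma extDem_eq {a : R} {f g : ExtSym X κ}
    (h : extAct (D.roots.reflection a) f - f = D.extRoot a * g) : D.extDem a f = g :=
  mul_left_cancel₀ (D.extRoot_ne_zero a) ((D.extDem_spec a f).symm.trans h)

lemma extDem_add (a : R) (f g : ExtSym X κ) :
    D.extDem a (f + g) = D.extDem a f + D.extDem a g := by
  refine D.extDem_eq ?_
  rw [mul_add, ← extDem_spec, ← extDem_spec, map_add]
  ring

lemma extDem_mul (a : R) (f g : ExtSym X κ) :
    D.extDem a (f * g) =
      extAct (D.roots.reflection a) f * D.extDem a g + D.extDem a f * g := by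
  refine D.extDem_eq ?_
  have h1 := D.extDem_spec a f
  have h2 := D.extDem_spec a g
  rw [map_mul]
  linear_combination extAct (D.roots.reflection a) f * h2 + g * h1

lemma extDem_algebraMap (a : R) (n : ℤ) : D.extDem a (algebraMap ℤ _ n : ExtSym X κ) = 0 :=
  D.extDem_eq (by simp)

lemma extDem_one (a : R) : D.extDem a (1 : ExtSym X κ) = 0 := D.extDem_eq (by simp)

lemma extDem_char (a : R) (μ : X × (κ → ℤ)) :
    D.extDem a (extChar μ) = algebraMap ℤ _ (-(D.roots.coroot' a μ.1 : ℤ)) := by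
  refine D.extDem_eq ?_
  rw [D.extAct_reflection_char, mul_comm, ← Algebra.smul_def, neg_smul]
  ring

/-- The reflection changes the sign of both numerator and denominator in `(s_a f - f) / a`. -/
lemma extAct_extDem (a : R) (f : ExtSym X κ) :
    extAct (D.roots.reflection a) (D.extDem a f) = D.extDem a f := by
  have h := congrArg (extAct (D.roots.reflection a)) (D.extDem_spec a f)
  rw [map_sub, map_mul, extAct_extAct, extAct_extRoot] at h
  refine (D.extDem_eq ?_).symm
  linear_combination -h

lemma extDem_extDem (a : R) (f : ExtSym X κ) : D.extDem a (D.extDem a f) = 0 :=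
  D.extDem_eq (by rw [extAct_extDem, sub_self, mul_zero])

/-- The Demazure operator as an additive map. -/
def demOp (a : R) : Module.End ℤ (ExtSym X κ) :=
  (AddMonoidHom.mk' (D.extDem a) (D.extDem_add a)).toIntLinearMap

lemma demOp_apply (a : R) (f : ExtSym X κ) : D.demOp a f = D.extDem a f := rfl

end Polynomial

end Steinberg.GaugeData
end

noncomputable section

namespace Steinberg.GaugeData

/-! ### The relations of the polynomial representation -/

section PolynomialRelations

variable {R X Y ι κ : Type*} [AddCommGroup X] [AddCommGroup Y] (D : GaugeData R X Y ι κ)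

/-- The action of the Weyl group on integral polynomials. -/
def extWeyl (w : D.roots.weylGroup) : ExtSym X κ →ₐ[ℤ] ExtSym X κ :=
  extAct (RootPairing.Equiv.weightHom D.roots (w : RootPairing.Aut D.roots))

lemma extWeyl_mul (v w : D.roots.weylGroup) (f : ExtSym X κ) :
    D.extWeyl (v * w) f = D.extWeyl v (D.extWeyl w f) := by
  have e := map_mul (RootPairing.Equiv.weightHom D.roots) v.1 w.1
  rw [extWeyl, Subgroup.coe_mul, e, extAct_mul]
  rfl

lemma extWeyl_one (f : ExtSym X κ) : D.extWeyl 1 f = f := by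
  have e := map_one (RootPairing.Equiv.weightHom D.roots)
  rw [extWeyl, Subgroup.coe_one, e, extAct_one]

lemma extWeyl_sref (a : R) (f : ExtSym X κ) :
    D.extWeyl (D.sref a) f = extAct (D.roots.reflection a) f := by
  rw [extWeyl, weightHom_sref]

lemma extWeyl_char (w : D.roots.weylGroup) (μ : X × (κ → ℤ)) :
    D.extWeyl w (extChar μ) =
      extChar (RootPairing.Equiv.weightHom D.roots w.1 μ.1, μ.2) :=
  extAct_char _ _

lemma extWeyl_root (w : D.roots.weylGroup) (a : R) :
    D.extWeyl w (D.extRoot a : ExtSym X κ) = D.extRoot (D.idx w a) := by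
  rw [extRoot, extWeyl_char, extRoot, root_idx]

variable [IsDomain (ExtSym X κ)]

lemma exists_extDem_char (a : R) (w : D.roots.weylGroup) (μ : X × (κ → ℤ)) :
    ∃ n : ℤ, D.extDem a (D.extWeyl w (extChar μ)) = algebraMap ℤ _ n := by
  rw [extWeyl_char]
  exact ⟨_, D.extDem_char _ _⟩

lemma extDem_intCast_mul (a : R) (n : ℤ) (f : ExtSym X κ) :
    D.extDem a (algebraMap ℤ _ n * f) = algebraMap ℤ _ n * D.extDem a f := by
  rw [extDem_mul, extDem_algebraMap, AlgHom.commutes, zero_mul, add_zero]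

/-- Moving a linear form through the word by the Leibniz rule leaves the twisted form and terms with
one operator deleted, whose coefficients are constants. Deleting an inner operator makes two equal
ones adjacent, and their product is zero; so only the first and the last deletion survive. -/
lemma altWord_demOp_mul (a b : R) (μ : X × (κ → ℤ)) (f : ExtSym X κ) (j : ℕ) :
    altWord (D.demOp a) (D.demOp b) (j + 2) (extChar μ * f) =
      D.extWeyl (altWord (D.sref a) (D.sref b) (j + 2)) (extChar μ) *
        altWord (D.demOp a) (D.demOp b) (j + 2) f +
      D.extDem a (D.extWeyl (altWord (D.sref b) (D.sref a) (j + 1)) (extChar μ)) *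
        altWord (D.demOp b) (D.demOp a) (j + 1) f +
      D.extDem (if Even j then b else a) (extChar μ) *
        altWord (D.demOp a) (D.demOp b) (j + 1) f := by
  induction j generalizing a b with
  | zero =>
    obtain ⟨n, hn⟩ := D.exists_extDem_char b 1 μ
    rw [extWeyl_one] at hn
    simp only [altWord, mul_one, Module.End.mul_apply, demOp_apply, extWeyl_mul, extWeyl_sref,
      Even.zero, if_true]
    rw [D.extDem_mul b, D.extDem_add, D.extDem_mul a, hn, D.extDem_intCast_mul]
  | succ j ih =>
    obtain ⟨n, hn⟩ := D.exists_extDem_char b (altWord (D.sref a) (D.sref b) (j + 1)) μ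
    obtain ⟨n', hn'⟩ := D.exists_extDem_char (if Even j then a else b) 1 μ
    rw [extWeyl_one] at hn'
    have hsq : altWord (D.demOp a) (D.demOp b) (j + 1) f =
        D.extDem a (altWord (D.demOp b) (D.demOp a) j f) := rfl
    have e : (if Even (j + 1) then b else a) = if Even j then a else b := by
      by_cases h : Even j <;> simp [h, Nat.even_add_one]
    rw [e, altWord_succ _ _ (j + 2), Module.End.mul_apply, ih b a, demOp_apply, D.extDem_add,
      D.extDem_add, D.extDem_mul a, hn, hn', D.extDem_intCast_mul, D.extDem_intCast_mul, hsq,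
      D.extDem_extDem, mul_zero, add_zero, altWord_succ _ _ (j + 2), extWeyl_mul, extWeyl_sref]
    rfl

variable [Finite R]

lemma eq_of_sref_eq {a c : R} (ha : a ∈ D.base.support) (hc : D.base.IsPos c)
    (h : D.sref a = D.sref c) : c = a := by
  by_contra hca
  have h1 := D.isPos_reflect hc ha hca
  rw [← idx_sref, h, idx_sref] at h1
  exact D.not_isPos_reflect hc h1

/-- The equality of the two words of length `m` says that the shorter word conjugates the last
reflection to `s_a`, and a positive root is determined by its reflection if that is simple. -/
lemma idx_altWord_last (a b : D.base.support) {k : ℕ} (hk : k + 1 = D.coxeterM a b) :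
    D.idx (altWord (D.sref b) (D.sref a) k) (if Even k then b else a : D.base.support) = a := by
  refine D.eq_of_sref_eq a.2 (D.isPos_altWord b a (by rw [coxeterM_comm]; omega)) ?_
  have h1 := D.mul_sref (w := altWord (D.sref b) (D.sref a) k) (a := (if Even k then b else a :
    D.base.support)) rfl
  have h2 := D.altWord_sref_eq a b
  rw [← hk, altWord_succ, altWord_succ_right (D.sref b)] at h2
  have e : D.sref ((if Even k then b else a : D.base.support) : R) =
      if Even k then D.sref b else D.sref a := by split_ifs <;> rfl
  rw [e] at h1
  exact mul_right_cancel (h2.trans h1)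

/-- Apply the word to the defining equation of the right-hand Demazure operator: it carries the root
to `a` and fixes the constant. Thus the coefficient of the first deletion for one word is that of
the last deletion for the other. -/
lemma extDem_altWord_last (a b : D.base.support) {k : ℕ} (hk : k + 1 = D.coxeterM a b)
    (μ : X × (κ → ℤ)) :
    D.extDem a (D.extWeyl (altWord (D.sref b) (D.sref a) k) (extChar μ)) =
      D.extDem (if Even k then b else a : D.base.support) (extChar μ) := by
  have hi := D.idx_altWord_last a b hk
  refine D.extDem_eq ?_
  obtain ⟨n, hn⟩ := D.exists_extDem_char (if Even k then b else a : D.base.support) 1 μ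
  rw [extWeyl_one] at hn
  have h := congrArg (D.extWeyl (altWord (D.sref b) (D.sref a) k))
    (D.extDem_spec (if Even k then b else a : D.base.support) (extChar μ))
  rw [hn, map_sub, map_mul, AlgHom.commutes, extWeyl_root, hi, ← hn, ← extWeyl_sref,
    ← extWeyl_mul, D.mul_sref hi, extWeyl_mul, extWeyl_sref] at h
  exact h

lemma two_le_coxeterM {a b : D.base.support} (hab : a ≠ b) : 2 ≤ D.coxeterM a b := by
  have h0 := D.coxeterM_pos a b
  by_contra h
  have h1 := D.altWord_sref_eq a b
  rw [show D.coxeterM a b = 1 by omega] at h1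
  simp only [altWord, mul_one] at h1
  exact hab (Subtype.ext (D.eq_of_sref_eq a.2 (D.base.isPos_of_mem_support b.2) h1)).symm

/-- The braid relations of the Demazure operators. -/
theorem demOp_braid (a b : D.base.support) :
    altWord (D.demOp (κ := κ) a) (D.demOp b) (D.coxeterM a b) =
      altWord (D.demOp (κ := κ) b) (D.demOp a) (D.coxeterM a b) := by
  by_cases hab : a = b
  · rw [hab]
  obtain ⟨j, hj⟩ := Nat.exists_eq_add_of_le' (D.two_le_coxeterM hab)
  have hj' : j + 2 = D.coxeterM b a := by rw [D.coxeterM_comm, hj]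
  -- Agreement at `g` implies agreement at `f * g`; starting from `g = 1`, where both words vanish,
  -- this reaches every polynomial, and only linear `f` need work.
  have key : ∀ f g : ExtSym X κ,
      altWord (D.demOp a) (D.demOp b) (j + 2) g = altWord (D.demOp b) (D.demOp a) (j + 2) g →
      altWord (D.demOp a) (D.demOp b) (j + 2) (f * g) =
        altWord (D.demOp b) (D.demOp a) (j + 2) (f * g) := by
    intro f
    induction f using SymmetricAlgebra.induction with
    | algebraMap r =>
      intro g hg
      rw [← Algebra.smul_def, map_smul, map_smul, hg]
    | ι μ =>
      intro g hg
      have h1 := D.extDem_altWord_last a b (k := j + 1) hj.symm μ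
      have h2 := D.extDem_altWord_last b a (k := j + 1) hj' μ
      have e : ∀ c d : D.base.support, ((if Even (j + 1) then c else d : D.base.support) : R) =
          if Even j then (d : R) else c := by
        intro c d
        by_cases h : Even j <;> simp [h, Nat.even_add_one]
      rw [e] at h1 h2
      have h3 := D.altWord_sref_eq a b
      rw [hj] at h3
      rw [D.altWord_demOp_mul, D.altWord_demOp_mul, h1, h2, h3, hg]
      ring
    | mul f f' hf hf' =>
      intro g hg
      rw [mul_assoc]
      exact hf _ (hf' _ hg)
    | add f f' hf hf' =>
      intro g hg
      rw [add_mul, map_add, map_add, hf _ hg, hf' _ hg]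
  rw [hj]
  refine LinearMap.ext fun f => ?_
  have h0 : ∀ c d : R, altWord (D.demOp c) (D.demOp d) (j + 2) (1 : ExtSym X κ) = 0 := by
    intro c d
    rw [altWord_succ_right, Module.End.mul_apply]
    split_ifs <;> rw [demOp_apply, extDem_one, map_zero]
  have := key f 1 ((h0 a b).trans (h0 b a).symm)
  rwa [mul_one] at this

end PolynomialRelations

/-! ### Products of weights and relation 4 for polynomials -/

section Products

variable {R X Y ι κ : Type*} [AddCommGroup X] [AddCommGroup Y] (D : GaugeData R X Y ι κ)
  {Φ : Set (κ → ℝ)} [Finite ι]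

/-- The product of the extended weights over the indices satisfying `p`. -/
def extProd (p : ι → Prop) : ExtSym X κ :=
  ∏ i ∈ (Set.toFinite {i | p i}).toFinset, D.extWeight i

lemma extProd_eq [Fintype ι] (p : ι → Prop) [DecidablePred p] :
    D.extProd p = ∏ i, if p i then D.extWeight i else 1 := by
  rw [← Finset.prod_filter]
  refine Finset.prod_congr ?_ fun _ _ => rfl
  ext i
  simp

lemma extProd_ne_zero [IsDomain (ExtSym X κ)] (p : ι → Prop) : D.extProd p ≠ 0 :=
  Finset.prod_ne_zero_iff.2 fun i _ => D.extWeight_ne_zero i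

lemma extProd_of_forall_not {p : ι → Prop} (h : ∀ i, ¬ p i) : D.extProd p = 1 := by
  refine Finset.prod_eq_one fun i hi => absurd ?_ (h i)
  simpa using hi

lemma extAct_extProd {a : R} {p q : ι → Prop}
    (h : ∀ i i', D.cls i' = D.cls i → D.weight i' = D.roots.reflection a (D.weight i) →
      (q i' ↔ p i)) :
    extAct (D.roots.reflection a) (D.extProd p) = D.extProd q := by
  classical
  obtain ⟨e, he⟩ := D.weyl_stable a
  rw [extProd, map_prod]
  refine Finset.prod_equiv e (fun i => ?_) fun i _ => D.extAct_weight (he i).1 (he i).2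
  simp [h i (e i) (he i).1 (he i).2]

/-- The polynomial by which crossing walls acts. -/
def extWall (σ σ' : D.Obj Φ) : ExtSym X κ :=
  D.extProd fun i => σ.sgn i = true ∧ σ'.sgn i = false

lemma extWall_mul (σ σ' σ'' : D.Obj Φ) : D.extWall σ σ' * D.extWall σ' σ'' =
    (D.extProd fun i => σ.sgn i = σ''.sgn i ∧ σ'.sgn i ≠ σ.sgn i) * D.extWall σ σ'' := by
  classical
  have := Fintype.ofFinite ι
  simp only [extWall, extProd_eq, ← Finset.prod_mul_distrib]
  refine Finset.prod_congr rfl fun i _ => ?_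
  cases σ.sgn i <;> cases σ'.sgn i <;> cases σ''.sgn i <;> simp

lemma extWall_self (σ : D.Obj Φ) : D.extWall σ σ = 1 :=
  D.extProd_of_forall_not fun i => by cases σ.sgn i <;> simp

/-- The relation for a Coxeter hyperplane and matter hyperplanes through a codimension 2 subspace. -/
theorem extDem_mixed [IsDomain (ExtSym X κ)] {a : D.base.support} {y : Point X κ} (hy : D.rootVal a y = 0)
    {ρ τ σ σ' : D.Obj Φ} (hρ : AdjacentTo ρ y) (hτ : AdjacentTo τ y) (hσ : AdjacentTo σ y)
    (hσ' : AdjacentTo σ' y) (hρ_pos : ∀ i, D.matterVal i y = 0 → ρ.sgn i = true)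
    (hτ_neg : ∀ i, D.matterVal i y = 0 → τ.sgn i = false) (hopp : OppositeAt a y σ σ')
    (f : ExtSym X κ) :
    D.extWall σ' τ * D.extDem a (D.extWall τ σ * f) =
      D.extWall σ' ρ * D.extDem a (D.extWall ρ σ * f) -
        D.extDem a (D.extProd fun i =>
          D.matterVal i y = 0 ∧ σ.sgn i = false ∧ σ'.sgn i = false) * (D.extWall σ' σ * f) := by
  have hs : ∀ i i', D.cls i' = D.cls i → D.weight i' = D.roots.reflection a (D.weight i) →
      D.matterVal i' y = D.matterVal i y := by
    intro i i' h1 h2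
    conv_lhs => rw [← D.act_eq_self hy, D.matterVal_act h1 h2]
  have hopp' : ∀ i i', D.matterVal i y = 0 → D.cls i' = D.cls i →
      D.weight i' = D.roots.reflection a (D.weight i) →
      σ'.sgn i' = !σ.sgn i ∧ σ'.sgn i = !σ.sgn i' := fun i i' h0 h1 h2 =>
    ⟨hopp i i' h0 h1 h2, hopp i' i ((hs i i' h1 h2).trans h0) h1.symm (D.reflect_symm h2)⟩
  have hadj : ∀ {ω ω' : D.Obj Φ}, AdjacentTo ω y → AdjacentTo ω' y → ∀ i, D.matterVal i y ≠ 0 →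
      ω.sgn i = ω'.sgn i := fun h h' i hi => by
    rw [Bool.eq_iff_iff, h i hi, h' i hi]
  have e1 : D.extWall τ σ = 1 := D.extProd_of_forall_not fun i ⟨h1, h2⟩ => by
    by_cases h0 : D.matterVal i y = 0
    · simp [hτ_neg i h0] at h1
    · simp [← hadj hτ hσ i h0, h1] at h2
  have e2 : D.extWall σ' ρ = 1 := D.extProd_of_forall_not fun i ⟨h1, h2⟩ => by
    by_cases h0 : D.matterVal i y = 0
    · simp [hρ_pos i h0] at h2
    · simp [← hadj hσ' hρ i h0, h1] at h2
  have e3 : extAct (D.roots.reflection a) (D.extWall ρ σ) = D.extWall σ' τ := by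
    refine D.extAct_extProd fun i i' h1 h2 => ?_
    by_cases h0 : D.matterVal i y = 0
    · rw [hρ_pos i h0, hτ_neg i' ((hs i i' h1 h2).trans h0), (hopp' i i' h0 h1 h2).1]
      cases σ.sgn i <;> simp
    · rw [hadj hσ' hτ i' (by rwa [hs i i' h1 h2]), hadj hρ hσ i h0]
      cases σ.sgn i <;> cases τ.sgn i' <;> simp
  have e4 : extAct (D.roots.reflection a) (D.extWall σ' σ) = D.extWall σ' σ := by
    refine D.extAct_extProd fun i i' h1 h2 => ?_
    by_cases h0 : D.matterVal i y = 0
    · rw [(hopp' i i' h0 h1 h2).1, (hopp' i i' h0 h1 h2).2]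
      cases σ.sgn i <;> cases σ.sgn i' <;> simp
    · rw [hadj hσ' hσ i' (by rwa [hs i i' h1 h2]), hadj hσ' hσ i h0]
      cases σ.sgn i <;> cases σ.sgn i' <;> simp
  have e5 : D.extWall ρ σ = (D.extProd fun i =>
      D.matterVal i y = 0 ∧ σ.sgn i = false ∧ σ'.sgn i = false) * D.extWall σ' σ := by
    classical
    have := Fintype.ofFinite ι
    simp only [extWall, extProd_eq, ← Finset.prod_mul_distrib]
    refine Finset.prod_congr rfl fun i _ => ?_
    by_cases h0 : D.matterVal i y = 0
    · simp only [h0, hρ_pos i h0]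
      cases σ.sgn i <;> cases σ'.sgn i <;> simp
    · simp only [h0, hadj hρ hσ i h0, hadj hσ' hσ i h0]
      cases σ.sgn i <;> simp
  set c := D.extProd fun i => D.matterVal i y = 0 ∧ σ.sgn i = false ∧ σ'.sgn i = false with hc
  have e6 : D.extDem a (D.extWall σ' σ) = 0 := D.extDem_eq (by rw [e4, sub_self, mul_zero])
  -- What remains is the Leibniz rule for `extWall ρ σ` times `f`, in which `s_a` carries this
  -- factor to `extWall σ' τ`.
  rw [e1, e2, one_mul, one_mul, D.extDem_mul a (D.extWall ρ σ), e3]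
  have e7 : D.extDem a (D.extWall ρ σ) = D.extDem a c * D.extWall σ' σ := by
    rw [e5, D.extDem_mul, e6, mul_zero, zero_add]
  rw [e7]
  ring

end Products

end Steinberg.GaugeData
end

noncomputable section

namespace Steinberg.GaugeData

/-! ### Independence of the operators of geodesic foldings -/

section PolynomialSystem

variable {R X Y ι κ : Type*} [AddCommGroup X] [AddCommGroup Y] (D : GaugeData R X Y ι κ)
  (Φ : Set (κ → ℝ)) [Finite R] [Finite ι] [IsDomain (ExtSym X κ)]

/-- The operators on integral polynomials given by the crossings of walls and the Demazure
operators. -/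
def polySys : Sys D Φ (ExtSym X κ) (SingleObj (Module.End ℤ (ExtSym X κ))) where
  ob _ := SingleObj.star _
  P _ f := LinearMap.mulLeft ℤ f
  wall σ σ' := LinearMap.mulLeft ℤ (D.extWall σ σ')
  psi a _ _ := D.demOp a
  P_one _ := LinearMap.mulLeft_one ℤ _
  P_mul _ f g := LinearMap.ext fun x => by
    change f * g * x = g * (f * x)
    ring
  P_add _ f g := LinearMap.ext fun x => add_mul f g x
  wall_self σ := by
    rw [D.extWall_self]
    exact LinearMap.mulLeft_one ℤ _
  wall_wall σ σ' σ'' h := LinearMap.ext fun x => by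
    change D.extWall σ σ' * (D.extWall σ' σ'' * x) = D.extWall σ σ'' * x
    rw [← mul_assoc, extWall_mul, D.extProd_of_forall_not fun i hi => hi.2 (h i hi.1), one_mul]
  wall_wall' σ σ' σ'' := ⟨D.extProd fun i => σ.sgn i = σ''.sgn i ∧ σ'.sgn i ≠ σ.sgn i,
    LinearMap.ext fun x => by
      change D.extWall σ σ' * (D.extWall σ' σ'' * x) = D.extWall σ σ'' * (_ * x)
      rw [← mul_assoc, extWall_mul]
      ring⟩
  wall_P σ σ' f := LinearMap.ext fun x => mul_left_comm f (D.extWall σ σ') x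
  psi_psi a σ h := LinearMap.ext fun x => D.extDem_extDem a x
  psi_P a σ h f := by
    -- Solve the Leibniz rule for the product of `s_a f` and `x`, using `s_a s_a f = f`.
    refine ⟨extAct (D.roots.reflection a) f, - D.extDem a (extAct (D.roots.reflection a) f),
      LinearMap.ext fun x => ?_⟩
    change f * D.extDem a x = D.extDem a (extAct (D.roots.reflection a) f * x) +
      - D.extDem a (extAct (D.roots.reflection a) f) * x
    rw [D.extDem_mul, extAct_extAct]
    ring
  braid a b σ ha hb := D.demOp_braid a b
  mixed a j y hy ρ τ σ σ' hρ hτ hσ hσ' hρ_pos hτ_neg hopp sρ sτ := by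
    refine ⟨- D.extDem a (D.extProd fun i =>
      D.matterVal i y = 0 ∧ σ.sgn i = false ∧ σ'.sgn i = false), LinearMap.ext fun x => ?_⟩
    change D.extWall σ' τ * D.extDem a (D.extWall τ σ * x) =
      D.extWall σ' ρ * D.extDem a (D.extWall ρ σ * x) + D.extWall σ' σ * (- D.extDem a _ * x)
    rw [D.extDem_mixed hy.mem_cox.2 hρ hτ hσ hσ' hρ_pos hτ_neg hopp]
    ring

variable {D Φ} {σ σ' : D.Obj Φ}

lemma negCount_act_le {v : Point X κ} {a : R} (ha : a ∈ D.base.support) (hv : D.rootVal a v ≠ 0) :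
    D.negCount (act (D.roots.reflection a) v) ≤ D.negCount v + 1 := by
  rcases lt_or_gt_of_ne hv with h | h
  · have := D.negCount_reflect ha h
    omega
  · have h' : D.rootVal a (act (D.roots.reflection a) v) < 0 := by
      rw [rootVal_act, rootVal_reflect_self]
      linarith
    have := D.negCount_reflect ha h'
    rw [act_reflection_act] at this
    omega

lemma extWeyl_ne_zero {f : ExtSym X κ} (hf : f ≠ 0) (w : D.roots.weylGroup) :
    D.extWeyl w f ≠ 0 := fun h => hf (by
  have := congrArg (D.extWeyl w⁻¹) h
  rwa [← extWeyl_mul, inv_mul_cancel, extWeyl_one, map_zero] at this)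

variable (D Φ) in
/-- The operator attached to a list of turns. -/
def foldOp (σ σ' : D.Obj Φ) (l : List (D.Turn Φ)) : Module.End ℤ (ExtSym X κ) :=
  (polySys D Φ).E σ σ' l

/-- The operator of a geodesic folding is a combination of Weyl group elements over the field of
fractions, triangular with respect to the length. -/
lemma exists_weyl_expansion [Fintype D.roots.weylGroup] {p : Point X κ}
    (hp : p ∈ D.posChamber Φ σ.sgn) {l : List (D.Turn Φ)} {w : D.roots.weylGroup}
    (h : Good σ σ' (D.weylAct w p) l) :
    ∃ (d : ExtSym X κ) (c : D.roots.weylGroup → ExtSym X κ), d ≠ 0 ∧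
      (∀ x, d * foldOp D Φ σ σ' l x =
        ∑ u, c u * D.extWeyl u⁻¹ x) ∧ c w ≠ 0 ∧
      ∀ u, c u ≠ 0 → u = w ∨ D.negCount (D.weylAct u p) < D.negCount (D.weylAct w p) := by
  classical
  induction l generalizing σ' w with
  | nil =>
    obtain rfl : w = 1 := Good.target_eq_one hp h
    refine ⟨1, Pi.single 1 (D.extWall σ σ'), one_ne_zero, fun x => ?_, ?_, fun u hu => ?_⟩
    · rw [Finset.sum_eq_single 1]
      · rw [Pi.single_eq_same, inv_one, extWeyl_one, one_mul]
        rfl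
      · intro u _ hu
        rw [Pi.single_eq_of_ne hu, zero_mul]
      · simp
    · rw [Pi.single_eq_same]
      exact D.extProd_ne_zero _
    · left
      by_contra h1
      exact hu (Pi.single_eq_of_ne h1 _)
  | cons t l ih =>
    obtain ⟨h1, -, h3⟩ := h
    rw [← weylAct_sref, ← weylAct_mul] at h3
    obtain ⟨d, c, hd, hE, hc, hcu⟩ := ih h3
    set s := D.sref t.root with hs
    have hss : s * s = 1 := D.sref_mul_self _
    have hlen : D.negCount (D.weylAct (s * w) p) + 1 = D.negCount (D.weylAct w p) := by
      rw [weylAct_mul, hs, weylAct_sref]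
      exact D.negCount_reflect t.root.2 h1
    have hle : ∀ u, D.negCount (D.weylAct u p) ≤ D.negCount (D.weylAct (s * u) p) + 1 := by
      intro u
      have h4 := negCount_act_le (D := D) (v := D.weylAct (s * u) p) t.root.2
        ((regular_weylAct (regular_of_mem hp) _).2.2 _)
      rwa [← weylAct_sref, ← weylAct_mul, ← hs, ← mul_assoc, hss, one_mul] at h4
    -- Writing the Demazure operator as `(s - 1) / α` and applying `u⁻¹` produces the denominator
    -- `u⁻¹ α`. All of them are cleared by their product, and `r u` is the cofactor of the one at
    -- `u`.
    let e : D.roots.weylGroup → ExtSym X κ := fun u => D.extWeyl u⁻¹ (D.extRoot t.root)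
    have he : ∀ u, e u ≠ 0 := fun u => extWeyl_ne_zero (D.extRoot_ne_zero _) _
    let r : D.roots.weylGroup → ExtSym X κ := fun u => ∏ u' ∈ Finset.univ.erase u, e u'
    have hr : ∀ u, r u ≠ 0 := fun u => Finset.prod_ne_zero_iff.2 fun u' _ => he u'
    have hre : ∀ u, (∏ u', e u') = r u * e u := fun u =>
      (Finset.prod_erase_mul _ _ (Finset.mem_univ u)).symm
    set q := D.extWall t.obj σ' with hq
    refine ⟨d * ∏ u, e u, fun u => (c (s * u) * r (s * u) - c u * r u) * D.extWeyl u⁻¹ q,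
      mul_ne_zero hd (Finset.prod_ne_zero_iff.2 fun u _ => he u), fun x => ?_, ?_, fun u hu => ?_⟩
    · have e1 : foldOp D Φ σ σ' (t :: l) x =
        foldOp D Φ σ t.obj l
          (D.extDem t.root (q * x)) := rfl
      rw [e1, mul_right_comm, hE, Finset.sum_mul]
      have e2 : ∀ u, c u * D.extWeyl u⁻¹ (D.extDem t.root (q * x)) * ∏ u', e u' =
          c u * r u * D.extWeyl (s * u)⁻¹ (q * x) - c u * r u * D.extWeyl u⁻¹ (q * x) := by
        intro u
        have h5 := congrArg (D.extWeyl u⁻¹) (D.extDem_spec t.root (q * x))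
        rw [map_sub, map_mul _ (D.extRoot _), ← extWeyl_sref, ← extWeyl_mul, ← hs] at h5
        have h6 : (s * u)⁻¹ = u⁻¹ * s := by
          rw [mul_inv_rev, inv_eq_of_mul_eq_one_left hss]
        rw [h6, hre u, ← mul_sub, h5]
        ring
      rw [Finset.sum_congr rfl fun u _ => e2 u, Finset.sum_sub_distrib]
      have e3 : ∑ u, c u * r u * D.extWeyl (s * u)⁻¹ (q * x) =
          ∑ u, c (s * u) * r (s * u) * D.extWeyl u⁻¹ (q * x) := by
        refine Fintype.sum_equiv (Equiv.mulLeft s) _ _ fun u => ?_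
        rw [Equiv.coe_mulLeft, ← mul_assoc s s u, hss, one_mul]
      rw [e3, ← Finset.sum_sub_distrib]
      refine Finset.sum_congr rfl fun u _ => ?_
      rw [map_mul]
      ring
    -- All `u` occurring for the tail are no longer than `s w`, which is shorter than `w`; so the
    -- leading coefficient at `w` comes from `s w` alone.
    · have h0 : c w = 0 := by
        by_contra h0
        rcases hcu w h0 with h6 | h6
        · rw [← h6] at hlen
          omega
        · omega
      simp only [h0, zero_mul, sub_zero]
      exact mul_ne_zero (mul_ne_zero hc (hr _)) (extWeyl_ne_zero (D.extProd_ne_zero _) _)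
    · by_cases h6 : c u = 0
      · have h7 : c (s * u) ≠ 0 := fun h7 => hu (by simp [h6, h7])
        rcases hcu _ h7 with h8 | h8
        · exact Or.inl (mul_left_cancel h8)
        · have := hle u
          right
          omega
      · right
        rcases hcu u h6 with h8 | h8
        · rw [h8]
          omega
        · omega

/-- Dedekind's independence of characters, the Weyl group acting faithfully on `X`. -/
lemma extWeyl_linearIndependent :
    LinearIndependent (ExtSym X κ) (fun w : D.roots.weylGroup =>
      (fun x : ExtSym X κ => D.extWeyl w⁻¹ x)) := by
  refine (linearIndependent_monoidHom (ExtSym X κ) (ExtSym X κ)).comp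
    (fun w : D.roots.weylGroup => ((D.extWeyl w⁻¹ : ExtSym X κ →ₐ[ℤ] ExtSym X κ) :
      ExtSym X κ →* ExtSym X κ)) fun v w h => inv_injective (D.weylGroup_ext fun χ => ?_)
  have h1 : D.extWeyl v⁻¹ (extChar (χ, 0)) = D.extWeyl w⁻¹ (extChar (χ, 0)) :=
    DFunLike.congr_fun h _
  rw [extWeyl_char, extWeyl_char] at h1
  exact congrArg Prod.fst (extChar_injective h1)

theorem polySys_independent [Fintype D.roots.weylGroup] {p : Point X κ}
    (hp : p ∈ D.posChamber Φ σ.sgn) {l : D.roots.weylGroup → List (D.Turn Φ)}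
    (hl : ∀ w, Good σ σ' (D.weylAct w p) (l w)) {g : D.roots.weylGroup → ExtSym X κ}
    (h : ∑ w, (polySys D Φ).P σ' (g w) ≫ (polySys D Φ).E σ σ' (l w) = 0) : g = 0 := by
  classical
  choose d c hd hE hc hcu using fun w => exists_weyl_expansion hp (hl w)
  have h1 : ∀ u, ∑ w, (∏ w' ∈ Finset.univ.erase w, d w') * c w u * D.extWeyl u⁻¹ (g w) = 0 := by
    refine fun u => Fintype.linearIndependent_iff.1 (extWeyl_linearIndependent (D := D) (κ := κ))
      (fun u => ∑ w, (∏ w' ∈ Finset.univ.erase w, d w') * c w u * D.extWeyl u⁻¹ (g w)) ?_ u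
    funext x
    rw [Finset.sum_apply]
    simp only [Pi.smul_apply, smul_eq_mul, Finset.sum_mul, Pi.zero_apply]
    rw [Finset.sum_comm]
    have h2 : ∑ w, foldOp D Φ σ σ' (l w) (g w * x) =
        0 := by
      have := congrArg (fun T : Module.End ℤ (ExtSym X κ) => T x) h
      exact (LinearMap.sum_apply _ _ _).symm.trans this
    rw [← mul_zero (∏ w, d w), ← h2, Finset.mul_sum]
    refine Finset.sum_congr rfl fun w _ => ?_
    rw [← Finset.prod_erase_mul _ _ (Finset.mem_univ w), mul_assoc, hE, Finset.mul_sum]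
    refine Finset.sum_congr rfl fun u _ => ?_
    rw [map_mul]
    ring
  by_contra hg
  obtain ⟨w₀, hw₀⟩ := Function.ne_iff.1 hg
  have : Nonempty {w // g w ≠ 0} := ⟨⟨w₀, hw₀⟩⟩
  -- For a longest `w` with `g w ≠ 0`, triangularity leaves only the term of `w` in the coefficient
  -- of `w⁻¹`.
  obtain ⟨⟨w, hw⟩, hmax⟩ := Finite.exists_max fun w : {w // g w ≠ 0} =>
    D.negCount (D.weylAct w.1 p)
  have h2 := h1 w
  rw [Finset.sum_eq_single w] at h2
  · exact mul_ne_zero (mul_ne_zero (Finset.prod_ne_zero_iff.2 fun w' _ => hd w') (hc w))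
      (extWeyl_ne_zero hw _) h2
  · intro w' _ hne
    by_cases hg' : g w' = 0
    · rw [hg', map_zero, mul_zero]
    · by_cases hc' : c w' w = 0
      · rw [hc', mul_zero, zero_mul]
      · have h3 := hmax ⟨w', hg'⟩
        dsimp only at h3
        rcases hcu w' w hc' with h4 | h4
        · exact absurd h4.symm hne
        · omega
  · simp

end PolynomialSystem

end Steinberg.GaugeData
end

noncomputable section

namespace Steinberg.GaugeData

/-! ### The bimodules of morphisms -/

section Bimodules

variable {R X Y ι κ : Type*} [AddCommGroup X] [AddCommGroup Y] {D : GaugeData R X Y ι κ}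
  {Φ : Set (κ → ℝ)} {S : Type*} [CommRing S] {C : Type*} [Category C] [Preadditive C]
  (A : Sys D Φ S C)

namespace Sys

/-- The span of the products attached to lists of turns. -/
def total (σ' σ : D.Obj Φ) : AddSubgroup (A.ob σ' ⟶ A.ob σ) where
  carrier := {x | ∃ n, x ∈ A.F σ' σ n}
  zero_mem' := ⟨0, zero_mem _⟩
  add_mem' := by
    rintro x y ⟨m, hx⟩ ⟨n, hy⟩
    exact ⟨m + n, add_mem (F_mono (by omega) hx) (F_mono (by omega) hy)⟩
  neg_mem' := by
    rintro x ⟨n, hx⟩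
    exact ⟨n, neg_mem hx⟩

/-- The span of the products attached to lists of turns, as a type. -/
def Bimod (σ' σ : D.Obj Φ) : Type _ := A.total σ' σ

instance (σ' σ : D.Obj Φ) : AddCommGroup (A.Bimod σ' σ) :=
  inferInstanceAs (AddCommGroup (A.total σ' σ))

variable {A} {σ σ' τ : D.Obj Φ}

@[ext] lemma Bimod.ext {x y : A.Bimod σ' σ} (h : x.1 = y.1) : x = y := Subtype.ext h

lemma P_zero (σ : D.Obj Φ) : A.P σ 0 = 0 := by simpa using A.P_add σ 0 0

instance (σ' σ : D.Obj Φ) : Module S (A.Bimod σ' σ) where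
  smul f x := ⟨A.P σ' f ≫ x.1, x.2.choose, F_P_comp f x.2.choose_spec⟩
  one_smul x := Bimod.ext (by
    change A.P σ' 1 ≫ x.1 = x.1
    rw [A.P_one, Category.id_comp])
  mul_smul f g x := Bimod.ext (by
    change A.P σ' (f * g) ≫ x.1 = A.P σ' f ≫ A.P σ' g ≫ x.1
    rw [A.P_mul, Category.assoc])
  smul_zero f := Bimod.ext Limits.comp_zero
  smul_add f x y := Bimod.ext (Preadditive.comp_add ..)
  add_smul f g x := Bimod.ext (by
    change A.P σ' (f + g) ≫ x.1 = A.P σ' f ≫ x.1 + A.P σ' g ≫ x.1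
    rw [A.P_add, Preadditive.add_comp])
  zero_smul x := Bimod.ext (by
    change A.P σ' 0 ≫ x.1 = 0
    rw [P_zero, Limits.zero_comp])

lemma Bimod.smul_val (f : S) (x : A.Bimod σ' σ) : (f • x).1 = A.P σ' f ≫ x.1 := rfl

variable (A) in
/-- Composition with a morphism that preserves the spans. -/
def post (σ' : D.Obj Φ) (h : A.ob σ ⟶ A.ob τ)
    (hh : ∀ x ∈ A.total σ' σ, x ≫ h ∈ A.total σ' τ) : A.Bimod σ' σ →ₗ[S] A.Bimod σ' τ where
  toFun x := ⟨x.1 ≫ h, hh _ x.2⟩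
  map_add' _ _ := Bimod.ext (Preadditive.add_comp ..)
  map_smul' _ _ := Bimod.ext (Category.assoc ..)

variable (A) in
/-- The left action of a polynomial. -/
def postP (σ' σ : D.Obj Φ) (f : S) : A.Bimod σ' σ →ₗ[S] A.Bimod σ' σ :=
  A.post σ' (A.P σ f) fun _ ⟨n, hx⟩ => ⟨n, F_comp_P f hx⟩

variable (A) in
/-- Crossing walls on the left. -/
def postWall (σ' τ σ : D.Obj Φ) : A.Bimod σ' σ →ₗ[S] A.Bimod σ' τ :=
  A.post σ' (A.wall τ σ) fun _ ⟨n, hx⟩ => ⟨n, F_comp_wall hx⟩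

variable (A) in
/-- The left action of the morphism of a simple root. -/
def postPsi (σ' : D.Obj Φ) (a : D.base.support) (σ : D.Obj Φ) (h : D.Stable Φ a σ.sgn) :
    A.Bimod σ' σ →ₗ[S] A.Bimod σ' σ :=
  A.post σ' (A.psi a σ h) fun _ ⟨n, hx⟩ => ⟨n + 1, F_comp_psi a h hx⟩

lemma postP_val (f : S) (x : A.Bimod σ' σ) : (A.postP σ' σ f x).1 = x.1 ≫ A.P σ f := rfl

lemma postWall_val (x : A.Bimod σ' σ) : (A.postWall σ' τ σ x).1 = x.1 ≫ A.wall τ σ := rfl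

lemma postPsi_val (a : D.base.support) (h : D.Stable Φ a σ.sgn) (x : A.Bimod σ' σ) :
    (A.postPsi σ' a σ h x).1 = x.1 ≫ A.psi a σ h := rfl

variable (A) in
/-- The product attached to a list of turns as an element of the bimodule. -/
def bimodE (σ' σ : D.Obj Φ) (l : List (D.Turn Φ)) : A.Bimod σ' σ :=
  ⟨A.E σ σ' l, _, E_mem_F (Nat.lt_succ_self _)⟩

variable (A) in
/-- The identity as an element of the bimodule. -/
def bimodOne (σ : D.Obj Φ) : A.Bimod σ σ := ⟨𝟙 _, _, id_mem_F⟩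

lemma postP_bimodOne (f : S) : A.postP σ σ f (A.bimodOne σ) = f • A.bimodOne σ :=
  Bimod.ext ((Category.id_comp _).trans (Category.comp_id _).symm)

/-- A polynomial that commutes with all the generators acts in the same way on both sides. -/
lemma postP_eq_smul {z : S} (hz : ∀ a σ h, A.psi a σ h ≫ A.P σ z = A.P σ z ≫ A.psi a σ h)
    (x : A.Bimod σ' σ) : A.postP σ' σ z x = z • x := by
  have hE : ∀ (l : List (D.Turn Φ)) (σ' : D.Obj Φ),
      A.E σ σ' l ≫ A.P σ z = A.P σ' z ≫ A.E σ σ' l := by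
    intro l
    induction l with
    | nil => exact fun σ' => A.wall_P _ _ _
    | cons t l ih =>
      intro σ'
      rw [E_cons, Category.assoc, Category.assoc, ih, ← Category.assoc (A.psi _ _ _), hz,
        Category.assoc, ← Category.assoc, A.wall_P, Category.assoc]
  refine Bimod.ext ?_
  rw [postP_val, Bimod.smul_val, ← sub_eq_zero]
  obtain ⟨x, n, hx⟩ := x
  refine AddSubgroup.mem_bot.1 (mem_of_closure (T := ⊥)
    (Preadditive.rightComp _ (A.P σ z) - Preadditive.leftComp _ (A.P σ' z)) ?_ hx)
  rintro _ ⟨f, l, -, rfl⟩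
  rw [AddSubgroup.mem_bot]
  change (A.P σ' f ≫ A.E σ σ' l) ≫ A.P σ z - A.P σ' z ≫ A.P σ' f ≫ A.E σ σ' l = 0
  rw [Category.assoc, hE, ← Category.assoc, P_comm, Category.assoc, sub_self]

variable (A) in
/-- The left action as a ring homomorphism. -/
def postPHom (σ' σ : D.Obj Φ) : S →+* Module.End S (A.Bimod σ' σ) where
  toFun := A.postP σ' σ
  map_one' := LinearMap.ext fun x => Bimod.ext (by
    change x.1 ≫ A.P σ 1 = x.1
    rw [A.P_one, Category.comp_id])
  map_mul' f g := LinearMap.ext fun x => Bimod.ext (by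
    change x.1 ≫ A.P σ (f * g) = (x.1 ≫ A.P σ g) ≫ A.P σ f
    rw [mul_comm, A.P_mul, Category.assoc])
  map_zero' := LinearMap.ext fun x => Bimod.ext (by
    change x.1 ≫ A.P σ 0 = 0
    rw [P_zero, Limits.comp_zero])
  map_add' f g := LinearMap.ext fun x => Bimod.ext (by
    change x.1 ≫ A.P σ (f + g) = x.1 ≫ A.P σ f + x.1 ≫ A.P σ g
    rw [A.P_add, Preadditive.comp_add])

lemma postPsi_altWord (a b : D.base.support) (ha : D.Stable Φ a σ.sgn) (hb : D.Stable Φ b σ.sgn)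
    (n : ℕ) (x : A.Bimod σ' σ) :
    (altWord (M := Module.End S (A.Bimod σ' σ)) (A.postPsi σ' a σ ha) (A.postPsi σ' b σ hb) n
      x).1 = x.1 ≫ (altWord (M := End (A.ob σ)) (A.psi a σ ha) (A.psi b σ hb) n : End (A.ob σ)) := by
  induction n generalizing a b with
  | zero => exact (Category.comp_id _).symm
  | succ n ih =>
    rw [altWord_succ, altWord_succ, Module.End.mul_apply, postPsi_val, ih, Category.assoc]
    rfl

/-- The products attached to geodesic foldings form a basis, if they are independent. -/
lemma exists_basis_bimod [Finite R] [Finite ι] (hΦ : IsFlavorSet Φ) (hε : D.Generic Φ)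
    [Fintype D.roots.weylGroup] {l : D.roots.weylGroup → List (D.Turn Φ)} {p : Point X κ}
    (hp : p ∈ D.posChamber Φ σ.sgn) (hl : ∀ w, Good σ σ' (D.weylAct w p) (l w))
    (hind : ∀ g : D.roots.weylGroup → S, ∑ w, A.P σ' (g w) ≫ A.E σ σ' (l w) = 0 → g = 0) :
    ∃ B : Module.Basis D.roots.weylGroup S (A.Bimod σ' σ), ∀ w, B w = A.bimodE σ' σ (l w) := by
  have hval : ∀ g : D.roots.weylGroup → S, (∑ w, g w • A.bimodE σ' σ (l w)).1 =
      ∑ w, A.P σ' (g w) ≫ A.E σ σ' (l w) := by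
    intro g
    exact map_sum (A.total σ' σ).subtype (fun w => g w • A.bimodE σ' σ (l w)) Finset.univ
  have hli : LinearIndependent S fun w => A.bimodE σ' σ (l w) := by
    refine Fintype.linearIndependent_iff.2 fun g hg => congrFun (hind g ?_)
    rw [← hval, hg]
    rfl
  refine ⟨Module.Basis.mk hli fun x _ => ?_, fun w => Module.Basis.mk_apply _ _ _⟩
  obtain ⟨n, hx⟩ := x.2
  obtain ⟨g, hg⟩ := exists_expansion hΦ hε (fun _ => hp) hl n hx
  have : x = ∑ w, g w • A.bimodE σ' σ (l w) := Bimod.ext (hg.trans (hval g).symm)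
  rw [this]
  exact sum_mem fun w _ => Submodule.smul_mem _ _ (Submodule.subset_span ⟨w, rfl⟩)

end Sys

end Bimodules

end Steinberg.GaugeData
end

noncomputable section

namespace Steinberg.GaugeData

/-! ### Specialization to the coefficient field -/

section Specialization

variable {R X Y ι κ : Type*} [AddCommGroup X] [AddCommGroup Y] (D : GaugeData R X Y ι κ)
  (𝕜 : Type*) [Field 𝕜]

variable (X κ) in
/-- The reduction of integral polynomials to the coefficient field, which forgets the flavors. -/
def reduce : ExtSym X κ →ₐ[ℤ] Sym X 𝕜 :=
  SymmetricAlgebra.lift ((SymmetricAlgebra.ι 𝕜 (𝕜 ⊗[ℤ] X)).restrictScalars ℤ ∘ₗ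
    TensorProduct.mk ℤ 𝕜 X 1 ∘ₗ LinearMap.fst ℤ X (κ → ℤ))

instance : Algebra (ExtSym X κ) (Sym X 𝕜) := (reduce X κ 𝕜).toRingHom.toAlgebra

instance : SMulCommClass (ExtSym X κ) 𝕜 (Sym X 𝕜) :=
  ⟨fun f r x => by rw [Algebra.smul_def f, Algebra.smul_def f, mul_smul_comm]⟩

lemma algebraMap_extChar (μ : X × (κ → ℤ)) :
    algebraMap (ExtSym X κ) (Sym X 𝕜) (extChar μ) = charS 𝕜 μ.1 :=
  SymmetricAlgebra.lift_ι_apply _ _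

lemma algebraMap_intCast (n : ℤ) :
    algebraMap (ExtSym X κ) (Sym X 𝕜) (algebraMap ℤ _ n) = algebraMap 𝕜 _ (n : 𝕜) := by
  simp

lemma actS_charS (g : X ≃ₗ[ℤ] X) (χ : X) : actS 𝕜 g (charS 𝕜 χ) = charS 𝕜 (g χ) := by
  simp [actS, charS]

lemma algebraMap_extAct (g : X ≃ₗ[ℤ] X) (f : ExtSym X κ) :
    algebraMap (ExtSym X κ) (Sym X 𝕜) (extAct g f) = actS 𝕜 g (algebraMap _ _ f) := by
  induction f using SymmetricAlgebra.induction with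
  | algebraMap r => rw [AlgHom.commutes, algebraMap_intCast, AlgHom.commutes]
  | ι μ => rw [extAct_char, algebraMap_extChar, algebraMap_extChar, actS_charS]
  | mul f g hf hg => rw [map_mul, map_mul, map_mul, map_mul, hf, hg]
  | add f g hf hg => rw [map_add, map_add, map_add, map_add, hf, hg]

lemma algebraMap_extProd [Finite ι] (p : ι → Prop) :
    algebraMap (ExtSym X κ) (Sym X 𝕜) (D.extProd p) = D.weightProd 𝕜 p := by
  rw [extProd, map_prod]
  exact Finset.prod_congr rfl fun i _ => algebraMap_extChar _ _

variable {𝕜} in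
-- The quotient is unique because the root remains nonzero in the domain `S`; here the hypothesis on
-- `𝕜` enters.
lemma demazure_eq {a : R} (ha : charS 𝕜 (D.roots.root a) ≠ 0) {f g : Sym X 𝕜}
    (h : actS 𝕜 (D.roots.reflection a) f - f = charS 𝕜 (D.roots.root a) * g) :
    D.demazure 𝕜 a f = g :=
  mul_left_cancel₀ ha ((D.demazure_spec 𝕜 a f).symm.trans h)

variable {𝕜} in
lemma demazure_algebraMap {a : R} (ha : charS 𝕜 (D.roots.root a) ≠ 0) (f : ExtSym X κ) :
    D.demazure 𝕜 a (algebraMap _ _ f) = algebraMap _ _ (D.extDem a f) := by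
  refine D.demazure_eq ha ?_
  rw [← algebraMap_extAct, ← map_sub, extDem_spec, map_mul, extRoot, algebraMap_extChar]

variable {𝕜} in
lemma demazure_add {a : R} (ha : charS 𝕜 (D.roots.root a) ≠ 0) (f g : Sym X 𝕜) :
    D.demazure 𝕜 a (f + g) = D.demazure 𝕜 a f + D.demazure 𝕜 a g := by
  refine D.demazure_eq ha ?_
  rw [mul_add, ← demazure_spec, ← demazure_spec, map_add]
  ring

variable {𝕜} in
lemma demazure_smul {a : R} (ha : charS 𝕜 (D.roots.root a) ≠ 0) (r : 𝕜) (f : Sym X 𝕜) :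
    D.demazure 𝕜 a (r • f) = r • D.demazure 𝕜 a f := by
  refine D.demazure_eq ha ?_
  rw [mul_smul_comm, ← demazure_spec, map_smul, smul_sub]

lemma ι_tmul (r : 𝕜) (χ : X) :
    SymmetricAlgebra.ι 𝕜 (𝕜 ⊗[ℤ] X) (r ⊗ₜ[ℤ] χ) = r • charS 𝕜 χ := by
  rw [charS, ← map_smul, TensorProduct.smul_tmul', smul_eq_mul, mul_one]

variable (Φ : Set (κ → ℝ)) [Finite R] [Finite ι] [IsDomain (ExtSym X κ)]

variable {Φ}

/-- The specialized bimodule. -/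
abbrev SpecMod (σ' σ : D.Obj Φ) : Type _ :=
  Sym X 𝕜 ⊗[ExtSym X κ] (D.polySys Φ).Bimod σ' σ

variable {D}

/-- The left action of integral polynomials on the specialized bimodule. -/
def specLeft (σ' σ : D.Obj Φ) :
    ExtSym X κ →+* Module.End (Sym X 𝕜) (D.SpecMod 𝕜 σ' σ) :=
  (Module.End.baseChangeHom (ExtSym X κ) (Sym X 𝕜)
    ((D.polySys Φ).Bimod σ' σ)).toRingHom.comp ((D.polySys Φ).postPHom σ' σ)

lemma specLeft_tmul (σ' σ : D.Obj Φ) (f : ExtSym X κ) (t : Sym X 𝕜)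
    (x : (D.polySys Φ).Bimod σ' σ) :
    specLeft 𝕜 σ' σ f (t ⊗ₜ x) = t ⊗ₜ[ExtSym X κ] ((D.polySys Φ).postP σ' σ f x) := rfl

/-- The left action of integral polynomials as an algebra homomorphism. -/
def specLeftAlg (σ' σ : D.Obj Φ) :
    ExtSym X κ →ₐ[ℤ] Module.End (Sym X 𝕜) (D.SpecMod 𝕜 σ' σ) :=
  { specLeft 𝕜 σ' σ with
    commutes' := fun n => by
      change specLeft 𝕜 σ' σ (algebraMap ℤ _ n) = _
      rw [eq_intCast, eq_intCast, map_intCast] }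

lemma specLeftAlg_commute (σ' σ : D.Obj Φ) (r : 𝕜) (f : ExtSym X κ) :
    Commute (Algebra.ofId 𝕜 (Module.End (Sym X 𝕜) (D.SpecMod 𝕜 σ' σ)) r)
      (specLeftAlg 𝕜 σ' σ f) :=
  Algebra.commute_algebraMap_left r _

/-- The left action on the specialized bimodule. -/
def leftAct (σ' σ : D.Obj Φ) : Sym X 𝕜 →ₐ[𝕜] Module.End (Sym X 𝕜) (D.SpecMod 𝕜 σ' σ) :=
  (Algebra.TensorProduct.lift (Algebra.ofId 𝕜 (Module.End (Sym X 𝕜) (D.SpecMod 𝕜 σ' σ)))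
    (specLeftAlg 𝕜 σ' σ) (specLeftAlg_commute 𝕜 σ' σ)).comp
  (SymmetricAlgebra.lift ((SymmetricAlgebra.ι ℤ (X × (κ → ℤ)) ∘ₗ
    LinearMap.inl ℤ X (κ → ℤ)).baseChange 𝕜))

lemma leftAct_charS (σ' σ : D.Obj Φ) (χ : X) :
    leftAct 𝕜 σ' σ (charS 𝕜 χ) = specLeft 𝕜 σ' σ (extChar (χ, 0)) := by
  rw [leftAct, AlgHom.comp_apply, charS, SymmetricAlgebra.lift_ι_apply,
    LinearMap.baseChange_tmul, Algebra.TensorProduct.lift_tmul, map_one, one_mul]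
  rfl

/-- Flavors are invariant under the Weyl group and so commute with all generators. Their left action
is therefore the right action, which the reduction to `S` makes zero. -/
lemma specLeft_flavor (σ' σ : D.Obj Φ) (z : κ → ℤ) :
    specLeft (κ := κ) 𝕜 σ' σ (extChar (0, z)) = 0 := by
  refine LinearMap.ext fun x => ?_
  induction x using TensorProduct.induction_on with
  | zero => rw [map_zero, map_zero]
  | add x y hx hy => rw [map_add, hx, hy, map_add]
  | tmul t x =>
    rw [specLeft_tmul, Sys.postP_eq_smul, TensorProduct.tmul_smul, TensorProduct.smul_tmul',
      Algebra.smul_def, algebraMap_extChar, charS, TensorProduct.tmul_zero, map_zero, zero_mul,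
      TensorProduct.zero_tmul]
    · rfl
    · intro a σ h
      refine LinearMap.ext fun f => ?_
      change extChar (0, z) * D.extDem a f = D.extDem a (extChar (0, z) * f)
      have e : extAct (D.roots.reflection a) (extChar (0, z)) = extChar (0, z) := by
        rw [extAct_char, map_zero]
      rw [D.extDem_mul, e, D.extDem_eq (f := extChar (0, z)) (g := 0) (by rw [e]; ring), zero_mul,
        add_zero]

/-- Because the flavors act by zero, the left action factors through the reduction. This transports
the relations of the integral operators to the specialized ones. -/
lemma leftAct_algebraMap (σ' σ : D.Obj Φ) (f : ExtSym X κ) :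
    leftAct 𝕜 σ' σ (algebraMap _ _ f) = specLeft 𝕜 σ' σ f := by
  induction f using SymmetricAlgebra.induction with
  | algebraMap r => simp
  | ι μ =>
    have e : (SymmetricAlgebra.ι ℤ (X × (κ → ℤ))) μ = extChar (μ.1, 0) + extChar (0, μ.2) := by
      rw [← map_add]
      simp
    rw [algebraMap_extChar, leftAct_charS, e, map_add, specLeft_flavor, add_zero]
  | mul f g hf hg => rw [map_mul, map_mul, map_mul, hf, hg]
  | add f g hf hg => rw [map_add, map_add, map_add, hf, hg]

lemma leftAct_one_tmul (σ : D.Obj Φ) (f t : Sym X 𝕜) :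
    leftAct 𝕜 σ σ f (t ⊗ₜ (D.polySys Φ).bimodOne σ) = (f * t) ⊗ₜ (D.polySys Φ).bimodOne σ := by
  induction f using SymmetricAlgebra.induction generalizing t with
  | algebraMap r =>
    rw [AlgHom.commutes, Module.algebraMap_end_apply, TensorProduct.smul_tmul', Algebra.smul_def]
  | ι x =>
    induction x using TensorProduct.induction_on with
    | zero => rw [map_zero, map_zero, zero_mul, TensorProduct.zero_tmul, LinearMap.zero_apply]
    | add x y hx hy =>
      rw [map_add, map_add, add_mul, TensorProduct.add_tmul, LinearMap.add_apply, hx, hy]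
    | tmul r χ =>
      rw [ι_tmul, map_smul, leftAct_charS, LinearMap.smul_apply, specLeft_tmul,
        Sys.postP_bimodOne, TensorProduct.tmul_smul, TensorProduct.smul_tmul',
        TensorProduct.smul_tmul', Algebra.smul_def (extChar (χ, (0 : κ → ℤ))), algebraMap_extChar,
        smul_mul_assoc]
  | mul f g hf hg => rw [map_mul, Module.End.mul_apply, hg, hf, mul_assoc]
  | add f g hf hg => rw [map_add, LinearMap.add_apply, hf, hg, add_mul, TensorProduct.add_tmul]

end Specialization

end Steinberg.GaugeData
end

noncomputable section

namespace Steinberg.GaugeData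

/-! ### The specialized bimodules as representations of the category -/

section FreeLift

variable (𝕜 : Type*) [Field 𝕜] {C E : Type*} [Category C] [Category E] [Preadditive E]
  [Linear 𝕜 E]

/-- The coefficients of a morphism of the linear completion. -/
def freeCoeff (A B : C) : (Free.of 𝕜 A ⟶ Free.of 𝕜 B) →ₗ[𝕜] ((A ⟶ B) →₀ 𝕜) where
  toFun f := f
  map_add' _ _ := rfl
  map_smul' _ _ := rfl

/-- A morphism as a morphism of the linear completion. -/
def freeHom {A B : C} (f : A ⟶ B) : Free.of 𝕜 A ⟶ Free.of 𝕜 B :=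
  (Free.embedding 𝕜 C).map f

lemma freeHom_id (A : C) : freeHom 𝕜 (𝟙 A) = 𝟙 (Free.of 𝕜 A) :=
  (Free.embedding 𝕜 C).map_id A

lemma freeHom_comp {A B B' : C} (f : A ⟶ B) (g : B ⟶ B') :
    freeHom 𝕜 (f ≫ g) = freeHom 𝕜 f ≫ freeHom 𝕜 g :=
  (Free.embedding 𝕜 C).map_comp f g

lemma freeCoeff_freeHom {A B : C} (f : A ⟶ B) :
    freeCoeff 𝕜 A B (freeHom 𝕜 f) = Finsupp.single f 1 := rfl

lemma freeCoeff_injective (A B : C) : Function.Injective (freeCoeff 𝕜 A B) := fun _ _ h => h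

lemma freeCoeff_surjective (A B : C) : Function.Surjective (freeCoeff 𝕜 A B) := fun f => ⟨f, rfl⟩

lemma free_induction {A B : C} {p : (Free.of 𝕜 A ⟶ Free.of 𝕜 B) → Prop} (zero : p 0)
    (add : ∀ f g, p f → p g → p (f + g)) (smul : ∀ (r : 𝕜) (f : A ⟶ B), p (r • freeHom 𝕜 f))
    (f : Free.of 𝕜 A ⟶ Free.of 𝕜 B) : p f := by
  have h : ∀ (c : (A ⟶ B) →₀ 𝕜) (f : Free.of 𝕜 A ⟶ Free.of 𝕜 B), freeCoeff 𝕜 A B f = c →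
      p f := by
    intro c
    induction c using Finsupp.induction_linear with
    | zero =>
      intro f hf
      rwa [freeCoeff_injective 𝕜 A B (hf.trans (map_zero _).symm)]
    | add c d hc hd =>
      intro f hf
      obtain ⟨g, hg⟩ := freeCoeff_surjective 𝕜 A B c
      obtain ⟨k, hk⟩ := freeCoeff_surjective 𝕜 A B d
      rw [freeCoeff_injective 𝕜 A B (a₁ := f) (a₂ := g + k) (by rw [hf, map_add, hg, hk])]
      exact add _ _ (hc _ hg) (hd _ hk)
    | single a r =>
      intro f hf
      rw [freeCoeff_injective 𝕜 A B (a₁ := f) (a₂ := r • freeHom 𝕜 a) (by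
        rw [hf, map_smul, freeCoeff_freeHom, Finsupp.smul_single, smul_eq_mul, mul_one])]
      exact smul _ _
  exact h _ f rfl

/-- The linear extension of a functor on morphisms. -/
def freeMap (F : C ⥤ E) (A B : C) :
    (Free.of 𝕜 A ⟶ Free.of 𝕜 B) →ₗ[𝕜] (F.obj A ⟶ F.obj B) :=
  Finsupp.linearCombination 𝕜 (fun f => F.map f) ∘ₗ freeCoeff 𝕜 A B

lemma freeMap_freeHom (F : C ⥤ E) {A B : C} (f : A ⟶ B) :
    freeMap 𝕜 F A B (freeHom 𝕜 f) = F.map f := by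
  rw [freeMap, LinearMap.comp_apply, freeCoeff_freeHom, Finsupp.linearCombination_single, one_smul]

lemma freeMap_id (F : C ⥤ E) (A : C) :
    freeMap 𝕜 F A A (𝟙 (Free.of 𝕜 A)) = 𝟙 (F.obj A) := by
  rw [← freeHom_id, freeMap_freeHom, F.map_id]

lemma freeMap_comp (F : C ⥤ E) {A B B' : C} (f : Free.of 𝕜 A ⟶ Free.of 𝕜 B)
    (g : Free.of 𝕜 B ⟶ Free.of 𝕜 B') :
    freeMap 𝕜 F A B' (f ≫ g) = freeMap 𝕜 F A B f ≫ freeMap 𝕜 F B B' g := by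
  induction f using free_induction with
  | zero => simp only [Limits.zero_comp, map_zero]
  | add f f' hf hf' => rw [Preadditive.add_comp, map_add, map_add, Preadditive.add_comp, hf, hf']
  | smul r f =>
    induction g using free_induction with
    | zero => simp only [Limits.comp_zero, map_zero]
    | add g g' hg hg' =>
      rw [Preadditive.comp_add, map_add, map_add, Preadditive.comp_add, hg, hg']
    | smul r' g =>
      rw [Linear.smul_comp, Linear.comp_smul, ← freeHom_comp, map_smul, map_smul, map_smul,
        map_smul, freeMap_freeHom, freeMap_freeHom, freeMap_freeHom, F.map_comp,
        Linear.smul_comp, Linear.comp_smul]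

/-- A functor to a linear category extends to the linear completion. -/
def freeLift (F : C ⥤ E) : Free 𝕜 C ⥤ E where
  obj A := F.obj A
  map {A B} f := freeMap 𝕜 F A B f
  map_id A := freeMap_id 𝕜 F A
  map_comp f g := freeMap_comp 𝕜 F f g

lemma freeLift_map_add (F : C ⥤ E) {A B : Free 𝕜 C} (f g : A ⟶ B) :
    (freeLift 𝕜 F).map (f + g) = (freeLift 𝕜 F).map f + (freeLift 𝕜 F).map g :=
  map_add (freeMap 𝕜 F A B) f g

lemma freeLift_map_smul (F : C ⥤ E) {A B : Free 𝕜 C} (r : 𝕜) (f : A ⟶ B) :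
    (freeLift 𝕜 F).map (r • f) = r • (freeLift 𝕜 F).map f :=
  map_smul (freeMap 𝕜 F A B) r f

lemma freeLift_map_embedding (F : C ⥤ E) {A B : C} (f : A ⟶ B) :
    (freeLift 𝕜 F).map ((Free.embedding 𝕜 C).map f) = F.map f :=
  freeMap_freeHom 𝕜 F f

end FreeLift

/-! ### Representations of the category from operators satisfying its relations -/

section Representation

variable {R X Y ι κ : Type*} [AddCommGroup X] [AddCommGroup Y]

/-- A representation of `A_{I'}`: operators that satisfy the defining relations. -/
structure Rep (D : GaugeData R X Y ι κ) (Φ : Set (κ → ℝ)) (𝕜 : Type*) [Field 𝕜] [Finite ι]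
    (M : D.Obj Φ → Type*) [∀ σ, AddCommGroup (M σ)] [∀ σ, Module 𝕜 (M σ)] where
  act : ∀ σ, Sym X 𝕜 →ₐ[𝕜] Module.End 𝕜 (M σ)
  wall : ∀ τ σ, M σ →ₗ[𝕜] M τ
  psi : ∀ (a : D.base.support) (σ : D.Obj Φ), D.Stable Φ a σ.sgn → (M σ →ₗ[𝕜] M σ)
  wall_self : ∀ σ, wall σ σ = LinearMap.id
  wall_wall : ∀ τ ρ σ, wall τ ρ ∘ₗ wall ρ σ = act τ (tripleProd 𝕜 τ ρ σ) ∘ₗ wall τ σ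
  act_wall : ∀ τ σ f, act τ f ∘ₗ wall τ σ = wall τ σ ∘ₗ act σ f
  psi_psi : ∀ a σ h, psi a σ h ∘ₗ psi a σ h = 0
  psi_act : ∀ (a : D.base.support) (σ h) (μ : 𝕜 ⊗[ℤ] X),
    psi a σ h ∘ₗ act σ (SymmetricAlgebra.ι 𝕜 _ μ) =
      act σ (actS 𝕜 (D.roots.reflection a) (SymmetricAlgebra.ι 𝕜 _ μ)) ∘ₗ psi a σ h +
        act σ (D.demazure 𝕜 a (SymmetricAlgebra.ι 𝕜 _ μ))
  braid : ∀ (a b : D.base.support) (σ : D.Obj Φ) (ha : D.Stable Φ a σ.sgn)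
    (hb : D.Stable Φ b σ.sgn),
    altWord (M := Module.End 𝕜 (M σ)) (psi a σ ha) (psi b σ hb) (D.coxeterM a b) =
      altWord (M := Module.End 𝕜 (M σ)) (psi b σ hb) (psi a σ ha) (D.coxeterM a b)
  mixed : ∀ (a : D.base.support) (y : Point X κ), D.rootVal a y = 0 →
    ∀ (ρ τ σ σ' : D.Obj Φ), AdjacentTo ρ y → AdjacentTo τ y → AdjacentTo σ y → AdjacentTo σ' y →
    (∀ i, D.matterVal i y = 0 → ρ.sgn i = true) → (∀ i, D.matterVal i y = 0 → τ.sgn i = false) →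
    OppositeAt a y σ σ' → ∀ (sρ : D.Stable Φ a ρ.sgn) (sτ : D.Stable Φ a τ.sgn),
    wall σ' τ ∘ₗ psi a τ sτ ∘ₗ wall τ σ =
      wall σ' ρ ∘ₗ psi a ρ sρ ∘ₗ wall ρ σ -
        act σ' (D.demazure 𝕜 a (D.weightProd 𝕜 fun i =>
          D.matterVal i y = 0 ∧ σ.sgn i = false ∧ σ'.sgn i = false)) ∘ₗ wall σ' σ

lemma map_altProd {C E : Type*} [Category C] [Category E] (F : C ⥤ E) {c : C} (f g : End c)
    (n : ℕ) : F.map (altProd f g n : End c) =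
      altWord (M := End (F.obj c)) (F.map f) (F.map g) n := by
  rw [altProd_eq]
  exact map_altWord (F.mapEnd c) f g n

namespace Rep

variable {D : GaugeData R X Y ι κ} {Φ : Set (κ → ℝ)} {𝕜 : Type*} [Field 𝕜] [Finite ι]
  {M : D.Obj Φ → Type*} [∀ σ, AddCommGroup (M σ)] [∀ σ, Module 𝕜 (M σ)] (V : Rep D Φ 𝕜 M)

/-- The operators of the generators. -/
def gen : ∀ {σ τ : D.Obj Φ}, D.Gen Φ 𝕜 σ τ → (M σ →ₗ[𝕜] M τ)
  | _, _, .poly σ f => V.act σ f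
  | _, _, .wall σ τ => V.wall σ τ
  | _, _, .psi a σ h => V.psi a σ h

/-- The module of an object. -/
@[nolint unusedArguments]
def modOb (_ : Rep D Φ 𝕜 M) (σ : D.Obj Φ) : ModuleCat 𝕜 := ModuleCat.of 𝕜 (M σ)

/-- A generator as a morphism of modules. -/
def genHom {σ τ : D.Obj Φ} (g : D.Gen Φ 𝕜 σ τ) : V.modOb σ ⟶ V.modOb τ := ModuleCat.ofHom (V.gen g)

/-- The functor on the free category. -/
def free : D.FreeCat Φ 𝕜 ⥤ ModuleCat 𝕜 :=
  freeLift 𝕜 (Paths.lift (V := D.Vertex Φ 𝕜)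
    { obj := V.modOb
      map := V.genHom })

/-- The operator of a morphism of the free category. -/
def freeOp {σ τ : D.Obj Φ} (f : fob 𝕜 σ ⟶ fob 𝕜 τ) : M σ →ₗ[𝕜] M τ := (V.free.map f).hom

variable {σ τ ρ : D.Obj Φ}

lemma free_map_eq {f g : fob 𝕜 σ ⟶ fob 𝕜 τ} (h : V.freeOp f = V.freeOp g) :
    V.free.map f = V.free.map g := ModuleCat.hom_ext h

lemma freeOp_comp (f : fob 𝕜 σ ⟶ fob 𝕜 τ) (g : fob 𝕜 τ ⟶ fob 𝕜 ρ) :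
    V.freeOp (f ≫ g) = V.freeOp g ∘ₗ V.freeOp f :=
  congrArg ModuleCat.Hom.hom (V.free.map_comp f g)

lemma freeOp_id : V.freeOp (𝟙 (fob 𝕜 σ)) = LinearMap.id :=
  congrArg ModuleCat.Hom.hom (V.free.map_id (fob 𝕜 σ))

lemma freeOp_add (f g : fob 𝕜 σ ⟶ fob 𝕜 τ) : V.freeOp (f + g) = V.freeOp f + V.freeOp g :=
  congrArg ModuleCat.Hom.hom (freeLift_map_add 𝕜 _ f g)

lemma freeOp_smul (r : 𝕜) (f : fob 𝕜 σ ⟶ fob 𝕜 τ) : V.freeOp (r • f) = r • V.freeOp f :=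
  congrArg ModuleCat.Hom.hom (freeLift_map_smul 𝕜 _ r f)

lemma freeOp_zero : V.freeOp (0 : fob 𝕜 σ ⟶ fob 𝕜 τ) = 0 := by
  have h := V.freeOp_smul 0 (0 : fob 𝕜 σ ⟶ fob 𝕜 τ)
  rwa [zero_smul, zero_smul] at h

lemma freeOp_sub (f g : fob 𝕜 σ ⟶ fob 𝕜 τ) : V.freeOp (f - g) = V.freeOp f - V.freeOp g := by
  rw [eq_sub_iff_add_eq, ← freeOp_add, sub_add_cancel]

lemma freeOp_fgen (g : D.Gen Φ 𝕜 σ τ) : V.freeOp (fgen 𝕜 g) = V.gen g := by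
  refine congrArg ModuleCat.Hom.hom ((freeLift_map_embedding 𝕜 _ _).trans ?_)
  exact Category.id_comp (V.genHom g)

lemma freeOp_fpoly (f : Sym X 𝕜) : V.freeOp (fpoly 𝕜 σ f) = V.act σ f := V.freeOp_fgen _

lemma freeOp_fwall : V.freeOp (fwall 𝕜 τ σ) = V.wall τ σ := V.freeOp_fgen _

lemma freeOp_fpsi (a : D.base.support) (h : D.Stable Φ a σ.sgn) :
    V.freeOp (fpsi 𝕜 a σ h) = V.psi a σ h := V.freeOp_fgen _

lemma freeOp_altProd (f g : fob 𝕜 σ ⟶ fob 𝕜 σ) (n : ℕ) :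
    V.freeOp (altProd (c := fob 𝕜 σ) f g n) =
      altWord (M := Module.End 𝕜 (M σ)) (V.freeOp f) (V.freeOp g) n := by
  induction n generalizing f g with
  | zero => exact V.freeOp_id
  | succ n ih =>
    rw [altWord_succ, ← ih]
    exact V.freeOp_comp _ _

lemma free_basic {A B : D.FreeCat Φ 𝕜} {f g : A ⟶ B} (h : BasicRel D Φ 𝕜 f g) :
    V.free.map f = V.free.map g := by
  cases h with
  | poly_algebraMap σ r =>
    refine V.free_map_eq ?_
    rw [freeOp_fpoly, AlgHom.commutes, freeOp_smul, freeOp_id]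
    rfl
  | poly_add σ f g =>
    refine V.free_map_eq ?_
    rw [freeOp_add, freeOp_fpoly, freeOp_fpoly, freeOp_fpoly, map_add]
  | poly_mul σ f g =>
    refine V.free_map_eq ?_
    rw [freeOp_comp, freeOp_fpoly, freeOp_fpoly, freeOp_fpoly, map_mul, Module.End.mul_eq_comp]
  | wall_self σ =>
    refine V.free_map_eq ?_
    rw [freeOp_fwall, V.wall_self, freeOp_id]
  | wall_wall σ τ ρ =>
    refine V.free_map_eq ?_
    rw [freeOp_comp, freeOp_comp, freeOp_fwall, freeOp_fwall, freeOp_fwall, freeOp_fpoly,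
      V.wall_wall]
  | wall_poly σ τ μ =>
    refine V.free_map_eq ?_
    rw [freeOp_comp, freeOp_comp, freeOp_fwall, freeOp_fpoly, freeOp_fpoly, V.act_wall]
  | psi_sq a σ h =>
    refine V.free_map_eq ?_
    rw [freeOp_comp, freeOp_fpsi, freeOp_zero, V.psi_psi]
  | psi_poly a σ h μ =>
    refine V.free_map_eq ?_
    rw [freeOp_sub, freeOp_comp, freeOp_comp, freeOp_fpsi, freeOp_fpoly, freeOp_fpoly,
      freeOp_fpoly, sub_eq_iff_eq_add', V.psi_act]
  | coxeter a b σ ha hb =>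
    refine V.free_map_eq ?_
    rw [freeOp_altProd, freeOp_altProd, freeOp_fpsi, freeOp_fpsi, V.braid]
  | mixed a j y hy ρ τ σ ω hρ hτ hσ hω hρ_pos hτ_neg hopp sρ sτ =>
    refine V.free_map_eq ?_
    rw [freeOp_sub, freeOp_comp, freeOp_comp, freeOp_comp, freeOp_comp, freeOp_comp,
      freeOp_fwall, freeOp_fwall, freeOp_fwall, freeOp_fwall, freeOp_fwall, freeOp_fpsi,
      freeOp_fpsi, freeOp_fpoly, LinearMap.comp_assoc, LinearMap.comp_assoc]
    exact V.mixed a y hy.mem_cox.2 ρ τ σ ω hρ hτ hσ hω hρ_pos hτ_neg hopp sρ sτ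

lemma free_rel {A B : D.FreeCat Φ 𝕜} {f g : A ⟶ B} (h : Rel D Φ 𝕜 f g) :
    V.free.map f = V.free.map g := by
  induction h with
  | basic h => exact V.free_basic h
  | refl f => rfl
  | symm _ ih => exact ih.symm
  | trans _ _ ih ih' => exact ih.trans ih'
  | add _ _ ih ih' =>
    exact (freeLift_map_add 𝕜 _ _ _).trans
      ((congrArg₂ (· + ·) ih ih').trans (freeLift_map_add 𝕜 _ _ _).symm)
  | smul r _ ih =>
    exact (freeLift_map_smul 𝕜 _ r _).trans
      ((congrArg (r • ·) ih).trans (freeLift_map_smul 𝕜 _ r _).symm)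
  | comp_left f _ ih => rw [Functor.map_comp, Functor.map_comp, ih]
  | comp_right g _ ih => rw [Functor.map_comp, Functor.map_comp, ih]

/-- The functor of a representation. -/
def functor : D.CatA Φ 𝕜 ⥤ ModuleCat 𝕜 :=
  CategoryTheory.Quotient.lift _ V.free fun _ _ _ _ h => V.free_rel h

/-- The operator of a morphism. -/
def op {σ τ : D.Obj Φ} (f : ob 𝕜 σ ⟶ ob 𝕜 τ) : M σ →ₗ[𝕜] M τ := (V.functor.map f).hom

lemma op_comp (f : ob 𝕜 σ ⟶ ob 𝕜 τ) (g : ob 𝕜 τ ⟶ ob 𝕜 ρ) :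
    V.op (f ≫ g) = V.op g ∘ₗ V.op f :=
  congrArg ModuleCat.Hom.hom (V.functor.map_comp f g)

lemma op_add (f g : ob 𝕜 σ ⟶ ob 𝕜 τ) : V.op (f + g) = V.op f + V.op g := by
  obtain ⟨f, rfl⟩ := (CategoryTheory.Quotient.functor (Rel D Φ 𝕜)).map_surjective f
  obtain ⟨g, rfl⟩ := (CategoryTheory.Quotient.functor (Rel D Φ 𝕜)).map_surjective g
  exact V.freeOp_add f g

lemma op_poly (f : Sym X 𝕜) : V.op (σ := σ) (poly 𝕜 σ f) = V.act σ f := V.freeOp_fpoly f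

lemma op_wall : V.op (GaugeData.wall 𝕜 τ σ) = V.wall τ σ := V.freeOp_fwall

lemma op_psi (a : D.base.support) (h : D.Stable Φ a σ.sgn) :
    V.op (GaugeData.psi 𝕜 a σ h) = V.psi a σ h := V.freeOp_fpsi a h

variable (σ τ) in
/-- The operators of morphisms as a homomorphism. -/
def opHom : (ob 𝕜 σ ⟶ ob 𝕜 τ) →+ (M σ →ₗ[𝕜] M τ) := AddMonoidHom.mk' V.op V.op_add

lemma opHom_apply (f : ob 𝕜 σ ⟶ ob 𝕜 τ) : V.opHom σ τ f = V.op f := rfl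

end Rep

end Representation

end Steinberg.GaugeData
end

noncomputable section

namespace Steinberg.GaugeData

/-! ### Reduction of identities for the action of `S` to characters -/

section Generators

variable {X 𝕜 S M N : Type*} [AddCommGroup X] [Field 𝕜] [CommRing S] [Algebra 𝕜 S]
  [AddCommGroup M] [Module S M] [Module 𝕜 M] [IsScalarTower 𝕜 S M] [SMulCommClass S 𝕜 M]
  [AddCommGroup N] [Module S N] [Module 𝕜 N] [IsScalarTower 𝕜 S N] [SMulCommClass S 𝕜 N]

/-- A map that commutes with the action of the characters commutes with the action of `S`. -/
lemma map_sym_action (A : Sym X 𝕜 →ₐ[𝕜] Module.End S M) (B : Sym X 𝕜 →ₐ[𝕜] Module.End S N)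
    (h : M →ₗ[S] N) (hc : ∀ χ x, h (A (charS 𝕜 χ) x) = B (charS 𝕜 χ) (h x)) (f : Sym X 𝕜)
    (x : M) : h (A f x) = B f (h x) := by
  induction f using SymmetricAlgebra.induction generalizing x with
  | algebraMap r =>
    rw [AlgHom.commutes, AlgHom.commutes, Module.algebraMap_end_apply,
      Module.algebraMap_end_apply, LinearMap.map_smul_of_tower]
  | ι μ =>
    induction μ using TensorProduct.induction_on generalizing x with
    | zero => simp only [map_zero, LinearMap.zero_apply]
    | add μ ν hμ hν => simp only [map_add, LinearMap.add_apply, hμ, hν]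
    | tmul r χ =>
      rw [ι_tmul, map_smul, map_smul, LinearMap.smul_apply, LinearMap.smul_apply,
        LinearMap.map_smul_of_tower, hc]
  | mul f g hf hg => rw [map_mul, map_mul, Module.End.mul_apply, Module.End.mul_apply, hf, hg]
  | add f g hf hg => simp only [map_add, LinearMap.add_apply, hf, hg]

/-- It suffices to check the relation of a twisted derivation on characters. -/
lemma twisted_sym_action (A : Sym X 𝕜 →ₐ[𝕜] Module.End S M) (h : Module.End S M)
    (s d : Sym X 𝕜 →ₗ[𝕜] Sym X 𝕜)
    (hc : ∀ χ x, h (A (charS 𝕜 χ) x) = A (s (charS 𝕜 χ)) (h x) + A (d (charS 𝕜 χ)) x)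
    (μ : 𝕜 ⊗[ℤ] X) (x : M) :
    h (A (SymmetricAlgebra.ι 𝕜 _ μ) x) = A (s (SymmetricAlgebra.ι 𝕜 _ μ)) (h x) +
      A (d (SymmetricAlgebra.ι 𝕜 _ μ)) x := by
  induction μ using TensorProduct.induction_on with
  | zero => simp only [map_zero, LinearMap.zero_apply, add_zero]
  | add μ ν hμ hν =>
    simp only [map_add, LinearMap.add_apply, hμ, hν]
    abel
  | tmul r χ =>
    rw [ι_tmul, map_smul, map_smul, map_smul, map_smul, map_smul, LinearMap.smul_apply,
      LinearMap.smul_apply, LinearMap.smul_apply, LinearMap.map_smul_of_tower, hc, smul_add]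

variable (𝕜 S M) in
/-- The restriction of scalars of endomorphisms. -/
def restrictEnd : Module.End S M →ₐ[𝕜] Module.End 𝕜 M where
  toFun f := f.restrictScalars 𝕜
  map_one' := rfl
  map_mul' _ _ := rfl
  map_zero' := rfl
  map_add' _ _ := rfl
  commutes' _ := rfl

end Generators

/-! ### The relations on the specialized bimodules, and independence of folded walls -/

section Relations

variable {R X Y ι κ : Type*} [AddCommGroup X] [AddCommGroup Y] {D : GaugeData R X Y ι κ}
  (𝕜 : Type*) [Field 𝕜] {Φ : Set (κ → ℝ)} [Finite R] [Finite ι] [IsDomain (ExtSym X κ)]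
  (σ' : D.Obj Φ) {σ τ ρ : D.Obj Φ}

/-- The operator of a crossing of walls. -/
abbrev specWall (τ σ : D.Obj Φ) : D.SpecMod 𝕜 σ' σ →ₗ[Sym X 𝕜] D.SpecMod 𝕜 σ' τ :=
  ((D.polySys Φ).postWall σ' τ σ).baseChange (Sym X 𝕜)

/-- The operator of a simple root. -/
abbrev specPsi (a : D.base.support) (σ : D.Obj Φ) (h : D.Stable Φ a σ.sgn) :
    Module.End (Sym X 𝕜) (D.SpecMod 𝕜 σ' σ) :=
  ((D.polySys Φ).postPsi σ' a σ h).baseChange (Sym X 𝕜)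

lemma specLeft_eq (f : ExtSym X κ) :
    specLeft 𝕜 σ' σ f = ((D.polySys Φ).postP σ' σ f).baseChange (Sym X 𝕜) := rfl

lemma specWall_self : specWall 𝕜 σ' σ σ = LinearMap.id := by
  have h : (D.polySys Φ).postWall σ' σ σ = LinearMap.id := by
    refine LinearMap.ext fun x => Sys.Bimod.ext ?_
    rw [Sys.postWall_val, Sys.wall_self, Category.comp_id]
    rfl
  rw [specWall, h, LinearMap.baseChange_id]

lemma specWall_specWall :
    specWall 𝕜 σ' τ ρ ∘ₗ specWall 𝕜 σ' ρ σ =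
      leftAct 𝕜 σ' τ (tripleProd 𝕜 τ ρ σ) ∘ₗ specWall 𝕜 σ' τ σ := by
  rw [tripleProd, ← algebraMap_extProd, leftAct_algebraMap, specLeft_eq, specWall, specWall,
    specWall, ← LinearMap.baseChange_comp, ← LinearMap.baseChange_comp]
  congr 1
  refine LinearMap.ext fun x => Sys.Bimod.ext (LinearMap.ext fun y => ?_)
  obtain ⟨x, hx⟩ := x
  change D.extWall τ ρ * (D.extWall ρ σ * _) = _ * (D.extWall τ σ * _)
  rw [← mul_assoc, extWall_mul, mul_assoc]

lemma leftAct_comp_specWall (f : Sym X 𝕜) :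
    leftAct 𝕜 σ' τ f ∘ₗ specWall 𝕜 σ' τ σ = specWall 𝕜 σ' τ σ ∘ₗ leftAct 𝕜 σ' σ f := by
  refine LinearMap.ext fun x => (map_sym_action (leftAct 𝕜 σ' σ) (leftAct 𝕜 σ' τ)
    (specWall 𝕜 σ' τ σ) (fun χ x => ?_) f x).symm
  have h : specWall 𝕜 σ' τ σ ∘ₗ specLeft 𝕜 σ' σ (extChar (χ, 0)) =
      specLeft 𝕜 σ' τ (extChar (χ, 0)) ∘ₗ specWall 𝕜 σ' τ σ := by
    rw [specLeft_eq, specLeft_eq, specWall, ← LinearMap.baseChange_comp,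
      ← LinearMap.baseChange_comp]
    congr 1
    refine LinearMap.ext fun x => Sys.Bimod.ext ?_
    change (x.1 ≫ _) ≫ _ = (x.1 ≫ _) ≫ _
    rw [Category.assoc, ← Sys.wall_P, Category.assoc]
  rw [leftAct_charS, leftAct_charS]
  exact LinearMap.congr_fun h x

lemma specPsi_specPsi (a : D.base.support) (h : D.Stable Φ a σ.sgn) :
    specPsi 𝕜 σ' a σ h ∘ₗ specPsi 𝕜 σ' a σ h = 0 := by
  rw [specPsi, ← LinearMap.baseChange_comp]
  have e : (D.polySys Φ).postPsi σ' a σ h ∘ₗ (D.polySys Φ).postPsi σ' a σ h = 0 := by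
    refine LinearMap.ext fun x => Sys.Bimod.ext ?_
    change (x.1 ≫ _) ≫ _ = 0
    rw [Category.assoc, Sys.psi_psi, Limits.comp_zero]
  rw [e, LinearMap.baseChange_zero]

variable {𝕜} in
/-- The Demazure operator as a linear map. -/
def demazureHom {a : R} (ha : charS 𝕜 (D.roots.root a) ≠ 0) : Sym X 𝕜 →ₗ[𝕜] Sym X 𝕜 where
  toFun := D.demazure 𝕜 a
  map_add' := D.demazure_add ha
  map_smul' := D.demazure_smul ha

variable {𝕜} in
lemma specPsi_comp_leftAct (hroot : ∀ a ∈ D.base.support, charS 𝕜 (D.roots.root a) ≠ 0)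
    (a : D.base.support) (h : D.Stable Φ a σ.sgn) (μ : 𝕜 ⊗[ℤ] X) :
    specPsi 𝕜 σ' a σ h ∘ₗ leftAct 𝕜 σ' σ (SymmetricAlgebra.ι 𝕜 _ μ) =
      leftAct 𝕜 σ' σ (actS 𝕜 (D.roots.reflection a) (SymmetricAlgebra.ι 𝕜 _ μ)) ∘ₗ
        specPsi 𝕜 σ' a σ h + leftAct 𝕜 σ' σ (D.demazure 𝕜 a (SymmetricAlgebra.ι 𝕜 _ μ)) := by
  have ha := hroot a a.2
  refine LinearMap.ext fun x => twisted_sym_action (leftAct 𝕜 σ' σ) (specPsi 𝕜 σ' a σ h)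
    (actS 𝕜 (D.roots.reflection a)).toLinearMap (demazureHom ha) (fun χ x => ?_) μ x
  have key : specPsi 𝕜 σ' a σ h ∘ₗ specLeft 𝕜 σ' σ (extChar (χ, 0)) =
      specLeft 𝕜 σ' σ (extAct (D.roots.reflection a) (extChar (χ, 0))) ∘ₗ specPsi 𝕜 σ' a σ h +
        specLeft 𝕜 σ' σ (D.extDem a (extChar (χ, 0))) := by
    rw [specLeft_eq, specLeft_eq, specLeft_eq, specPsi, ← LinearMap.baseChange_comp,
      ← LinearMap.baseChange_comp, ← LinearMap.baseChange_add]
    congr 1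
    refine LinearMap.ext fun x => Sys.Bimod.ext (LinearMap.ext fun y => ?_)
    exact D.extDem_mul a (extChar (χ, 0)) _
  have e1 : leftAct 𝕜 σ' σ (actS 𝕜 (D.roots.reflection a) (charS 𝕜 χ)) =
      specLeft 𝕜 σ' σ (extAct (D.roots.reflection a) (extChar (χ, 0))) := by
    rw [← leftAct_algebraMap, algebraMap_extAct, algebraMap_extChar]
  have e2 : leftAct 𝕜 σ' σ (D.demazure 𝕜 a (charS 𝕜 χ)) =
      specLeft 𝕜 σ' σ (D.extDem a (extChar (χ, 0))) := by
    rw [← leftAct_algebraMap, ← D.demazure_algebraMap ha, algebraMap_extChar]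
  refine Eq.trans ?_ (congrArg₂ (· + ·) (LinearMap.congr_fun e1.symm _)
    (LinearMap.congr_fun e2.symm _))
  rw [leftAct_charS]
  exact LinearMap.congr_fun key x

lemma specPsi_braid (a b : D.base.support) (ha : D.Stable Φ a σ.sgn) (hb : D.Stable Φ b σ.sgn) :
    altWord (M := Module.End (Sym X 𝕜) (D.SpecMod 𝕜 σ' σ)) (specPsi 𝕜 σ' a σ ha)
        (specPsi 𝕜 σ' b σ hb) (D.coxeterM a b) =
      altWord (M := Module.End (Sym X 𝕜) (D.SpecMod 𝕜 σ' σ)) (specPsi 𝕜 σ' b σ hb)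
        (specPsi 𝕜 σ' a σ ha) (D.coxeterM a b) := by
  let θ : Module.End (ExtSym X κ) ((D.polySys Φ).Bimod σ' σ) →*
      Module.End (Sym X 𝕜) (D.SpecMod 𝕜 σ' σ) :=
    { toFun := fun f => f.baseChange (Sym X 𝕜)
      map_one' := LinearMap.baseChange_one _ _
      map_mul' := LinearMap.baseChange_mul }
  refine (map_altWord θ ((D.polySys Φ).postPsi σ' a σ ha) ((D.polySys Φ).postPsi σ' b σ hb)
    _).symm.trans (Eq.trans (congrArg θ ?_) (map_altWord θ ((D.polySys Φ).postPsi σ' b σ hb)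
    ((D.polySys Φ).postPsi σ' a σ ha) _))
  refine LinearMap.ext fun x => Sys.Bimod.ext ?_
  rw [Sys.postPsi_altWord, Sys.postPsi_altWord, Sys.braid]

variable {𝕜} in
lemma specPsi_mixed (hroot : ∀ a ∈ D.base.support, charS 𝕜 (D.roots.root a) ≠ 0)
    (a : D.base.support) {y : Point X κ} (hy : D.rootVal a y = 0) {ω : D.Obj Φ}
    (hρ : AdjacentTo ρ y) (hτ : AdjacentTo τ y) (hσ : AdjacentTo σ y) (hω : AdjacentTo ω y)
    (hρ_pos : ∀ i, D.matterVal i y = 0 → ρ.sgn i = true)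
    (hτ_neg : ∀ i, D.matterVal i y = 0 → τ.sgn i = false) (hopp : OppositeAt a y σ ω)
    (sρ : D.Stable Φ a ρ.sgn) (sτ : D.Stable Φ a τ.sgn) :
    specWall 𝕜 σ' ω τ ∘ₗ specPsi 𝕜 σ' a τ sτ ∘ₗ specWall 𝕜 σ' τ σ =
      specWall 𝕜 σ' ω ρ ∘ₗ specPsi 𝕜 σ' a ρ sρ ∘ₗ specWall 𝕜 σ' ρ σ -
        leftAct 𝕜 σ' ω (D.demazure 𝕜 a (D.weightProd 𝕜 fun i =>
          D.matterVal i y = 0 ∧ σ.sgn i = false ∧ ω.sgn i = false)) ∘ₗ specWall 𝕜 σ' ω σ := by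
  rw [← algebraMap_extProd, D.demazure_algebraMap (hroot a a.2), leftAct_algebraMap, specLeft_eq]
  simp only [specWall, specPsi]
  rw [← LinearMap.baseChange_comp, ← LinearMap.baseChange_comp, ← LinearMap.baseChange_comp,
    ← LinearMap.baseChange_comp, ← LinearMap.baseChange_comp, ← LinearMap.baseChange_sub]
  congr 1
  exact LinearMap.ext fun x => Sys.Bimod.ext (LinearMap.ext fun f =>
    D.extDem_mixed hy hρ hτ hσ hω hρ_pos hτ_neg hopp _)

/-- The representation of `A_{I'}` on the specialized bimodules. -/
def specRep (hroot : ∀ a ∈ D.base.support, charS 𝕜 (D.roots.root a) ≠ 0) (σ' : D.Obj Φ) :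
    Rep D Φ 𝕜 (D.SpecMod 𝕜 σ') where
  act σ := (restrictEnd 𝕜 (Sym X 𝕜) (D.SpecMod 𝕜 σ' σ)).comp (leftAct 𝕜 σ' σ)
  wall τ σ := (specWall 𝕜 σ' τ σ).restrictScalars 𝕜
  psi a σ h := (specPsi 𝕜 σ' a σ h).restrictScalars 𝕜
  wall_self σ := congrArg (LinearMap.restrictScalars 𝕜) (specWall_self 𝕜 σ')
  wall_wall τ ρ σ := congrArg (LinearMap.restrictScalars 𝕜) (specWall_specWall 𝕜 σ')
  act_wall τ σ f := congrArg (LinearMap.restrictScalars 𝕜) (leftAct_comp_specWall 𝕜 σ' f)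
  psi_psi a σ h := congrArg (LinearMap.restrictScalars 𝕜) (specPsi_specPsi 𝕜 σ' a h)
  psi_act a σ h μ := congrArg (LinearMap.restrictScalars 𝕜) (specPsi_comp_leftAct σ' hroot a h μ)
  braid a b σ ha hb := by
    have h := congrArg (restrictEnd 𝕜 (Sym X 𝕜) (D.SpecMod 𝕜 σ' σ)) (specPsi_braid 𝕜 σ' a b ha hb)
    have e := fun f g => map_altWord
      (restrictEnd 𝕜 (Sym X 𝕜) (D.SpecMod 𝕜 σ' σ)).toRingHom.toMonoidHom f g (D.coxeterM a b)
    exact (e _ _).symm.trans (h.trans (e _ _))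
  mixed a y hy ρ τ σ ω hρ hτ hσ hω hρ_pos hτ_neg hopp sρ sτ :=
    congrArg (LinearMap.restrictScalars 𝕜)
      (specPsi_mixed σ' hroot a hy hρ hτ hσ hω hρ_pos hτ_neg hopp sρ sτ)

variable {𝕜} {σ'} (hroot : ∀ a ∈ D.base.support, charS 𝕜 (D.roots.root a) ≠ 0)

lemma specRep_op_foldedWall (l : List (D.Turn Φ)) (t : Sym X 𝕜)
    (x : (D.polySys Φ).Bimod σ' τ) :
    ∃ y : (D.polySys Φ).Bimod σ' σ, y.1 = x.1 ≫ (D.polySys Φ).E σ τ l ∧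
      (specRep 𝕜 hroot σ').op (foldedWall 𝕜 σ τ l) (t ⊗ₜ x) = t ⊗ₜ y := by
  induction l generalizing τ with
  | nil =>
    refine ⟨(D.polySys Φ).postWall σ' σ τ x, rfl, ?_⟩
    rw [foldedWall, Rep.op_wall]
    rfl
  | cons s l ih =>
    obtain ⟨y, hy, e⟩ := ih ((D.polySys Φ).postPsi σ' s.root s.obj s.stable
      ((D.polySys Φ).postWall σ' s.obj τ x))
    refine ⟨y, ?_, ?_⟩
    · rw [hy, Sys.postPsi_val, Sys.postWall_val, Sys.E_cons, Category.assoc, Category.assoc]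
    · rw [foldedWall, Rep.op_comp, Rep.op_comp, Rep.op_wall, Rep.op_psi]
      exact e

include hroot in
/-- The morphisms attached to geodesic foldings are independent. -/
lemma foldedWall_independent [Fintype D.roots.weylGroup] (hΦ : IsFlavorSet Φ) (hε : D.Generic Φ)
    {l : D.roots.weylGroup → List (D.Turn Φ)} {p : Point X κ}
    (hp : p ∈ D.posChamber Φ σ.sgn) (hl : ∀ w, Good σ σ' (D.weylAct w p) (l w))
    (g : D.roots.weylGroup → Sym X 𝕜)
    (h : ∑ w, (poly 𝕜 σ' (g w) : ob 𝕜 σ' ⟶ ob 𝕜 σ') ≫ foldedWall 𝕜 σ σ' (l w) = 0) : g = 0 := by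
  obtain ⟨B, hB⟩ := Sys.exists_basis_bimod (A := D.polySys Φ) hΦ hε hp hl
    fun f hf => polySys_independent hp hl hf
  -- On `1 ⊗ id` the term for `w` gives `g w` times the basis vector of `w`.
  have key : ∀ w, (specRep 𝕜 hroot σ').op
      ((poly 𝕜 σ' (g w) : ob 𝕜 σ' ⟶ ob 𝕜 σ') ≫ foldedWall 𝕜 σ σ' (l w))
      (1 ⊗ₜ (D.polySys Φ).bimodOne σ') = g w • B.baseChange (Sym X 𝕜) w := by
    intro w
    obtain ⟨y, hy, e⟩ := specRep_op_foldedWall (σ := σ) hroot (l w) (g w)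
      ((D.polySys Φ).bimodOne σ')
    have hy' : y = B w := by
      rw [hB]
      exact Sys.Bimod.ext (hy.trans (Category.id_comp _))
    rw [Rep.op_comp, LinearMap.comp_apply, Rep.op_poly, Module.Basis.baseChange_apply,
      TensorProduct.smul_tmul', smul_eq_mul, mul_one, ← hy', ← e]
    congr 1
    refine (leftAct_one_tmul 𝕜 σ' (g w) 1).trans ?_
    rw [mul_one]
  have h2 := LinearMap.congr_fun (congrArg ((specRep 𝕜 hroot σ').opHom σ' σ) h)
    (1 ⊗ₜ (D.polySys Φ).bimodOne σ')
  rw [map_sum, map_zero, LinearMap.sum_apply, LinearMap.zero_apply] at h2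
  simp only [Rep.opHom_apply, key] at h2
  exact funext (Fintype.linearIndependent_iff.1 (B.baseChange (Sym X 𝕜)).linearIndependent g h2)

end Relations

end Steinberg.GaugeData
end

noncomputable section

namespace Steinberg.GaugeData

/-! ### The category as a system of morphisms -/

section CategorySystem

variable {R X Y ι κ : Type*} [AddCommGroup X] [AddCommGroup Y] {D : GaugeData R X Y ι κ}
  {𝕜 : Type*} [Field 𝕜] {Φ : Set (κ → ℝ)} [Finite ι] {σ σ' τ : D.Obj Φ}

lemma sound {f g : fob 𝕜 σ ⟶ fob 𝕜 τ} (h : BasicRel D Φ 𝕜 f g) :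
    (CategoryTheory.Quotient.functor (Rel D Φ 𝕜)).map f =
      (CategoryTheory.Quotient.functor (Rel D Φ 𝕜)).map g :=
  CategoryTheory.Quotient.sound _ (.basic h)

variable (𝕜) in
/-- The action of `S` on an object, as a morphism. -/
def polyHom (σ : D.Obj Φ) (f : Sym X 𝕜) : ob 𝕜 σ ⟶ ob 𝕜 σ := poly 𝕜 σ f

lemma polyHom_one : polyHom 𝕜 σ 1 = 𝟙 _ := (poly 𝕜 σ).map_one

lemma polyHom_mul (f g : Sym X 𝕜) :
    polyHom 𝕜 σ (f * g) = polyHom 𝕜 σ f ≫ polyHom 𝕜 σ g := by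
  rw [mul_comm]
  exact (poly 𝕜 σ).map_mul g f

lemma polyHom_add (f g : Sym X 𝕜) :
    polyHom 𝕜 σ (f + g) = polyHom 𝕜 σ f + polyHom 𝕜 σ g := (poly 𝕜 σ).map_add f g

lemma polyHom_algebraMap (r : 𝕜) : polyHom 𝕜 σ (algebraMap 𝕜 _ r) = r • 𝟙 (ob 𝕜 σ) := by
  refine (sound (.poly_algebraMap σ r)).trans ?_
  rfl

lemma wall_comp_wall (σ σ' σ'' : D.Obj Φ) : wall 𝕜 σ' σ'' ≫ wall 𝕜 σ σ' =
    wall 𝕜 σ σ'' ≫ polyHom 𝕜 σ (tripleProd 𝕜 σ σ' σ'') :=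
  ((CategoryTheory.Quotient.functor (Rel D Φ 𝕜)).map_comp _ _).symm.trans
    ((sound (.wall_wall σ σ' σ'')).trans
      ((CategoryTheory.Quotient.functor (Rel D Φ 𝕜)).map_comp _ _))

lemma wall_comp_polyHom (σ σ' : D.Obj Φ) (f : Sym X 𝕜) :
    wall 𝕜 σ σ' ≫ polyHom 𝕜 σ f = polyHom 𝕜 σ' f ≫ wall 𝕜 σ σ' := by
  induction f using SymmetricAlgebra.induction with
  | algebraMap r =>
    rw [polyHom_algebraMap, polyHom_algebraMap, Linear.comp_smul, Linear.smul_comp,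
      Category.comp_id, Category.id_comp]
  | ι μ =>
    exact ((CategoryTheory.Quotient.functor (Rel D Φ 𝕜)).map_comp _ _).symm.trans
      ((sound (.wall_poly σ σ' μ)).trans
        ((CategoryTheory.Quotient.functor (Rel D Φ 𝕜)).map_comp _ _))
  | mul f g hf hg =>
    rw [polyHom_mul, polyHom_mul, ← Category.assoc, hf, Category.assoc, hg, Category.assoc]
  | add f g hf hg =>
    rw [polyHom_add, polyHom_add, Preadditive.comp_add, Preadditive.add_comp, hf, hg]

lemma psi_comp_psi (a : D.base.support) (h : D.Stable Φ a σ.sgn) :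
    psi 𝕜 a σ h ≫ psi 𝕜 a σ h = 0 :=
  ((CategoryTheory.Quotient.functor (Rel D Φ 𝕜)).map_comp _ _).symm.trans
    ((sound (.psi_sq a σ h)).trans
      ((CategoryTheory.Quotient.functor (Rel D Φ 𝕜)).map_zero _ _))

lemma polyHom_comp_psi (a : D.base.support) (h : D.Stable Φ a σ.sgn) (μ : 𝕜 ⊗[ℤ] X) :
    polyHom 𝕜 σ (SymmetricAlgebra.ι 𝕜 _ μ) ≫ psi 𝕜 a σ h -
      psi 𝕜 a σ h ≫
        polyHom 𝕜 σ (actS 𝕜 (D.roots.reflection a) (SymmetricAlgebra.ι 𝕜 _ μ)) =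
      polyHom 𝕜 σ (D.demazure 𝕜 a (SymmetricAlgebra.ι 𝕜 _ μ)) := by
  have e := sound (.psi_poly a σ h μ)
  rw [Functor.map_sub, Functor.map_comp, Functor.map_comp] at e
  exact e

lemma actS_reflection_ι (a : R) (μ : 𝕜 ⊗[ℤ] X) : actS 𝕜 (D.roots.reflection a)
    (SymmetricAlgebra.ι 𝕜 _ (((D.roots.reflection a : X ≃ₗ[ℤ] X) : X →ₗ[ℤ] X).baseChange 𝕜 μ)) =
      SymmetricAlgebra.ι 𝕜 _ μ := by
  rw [actS, SymmetricAlgebra.lift_ι_apply, LinearMap.comp_apply]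
  refine congrArg _ ((LinearMap.congr_fun (LinearMap.baseChange_comp (A := 𝕜)
    ((D.roots.reflection a : X ≃ₗ[ℤ] X) : X →ₗ[ℤ] X) _) μ).symm.trans ?_)
  have e : ((D.roots.reflection a : X ≃ₗ[ℤ] X) : X →ₗ[ℤ] X) ∘ₗ
      ((D.roots.reflection a : X ≃ₗ[ℤ] X) : X →ₗ[ℤ] X) = LinearMap.id :=
    LinearMap.ext fun x => D.roots.reflection_same a x
  rw [e, LinearMap.baseChange_id, LinearMap.id_apply]

lemma exists_psi_comp_polyHom (a : D.base.support) (h : D.Stable Φ a σ.sgn) (f : Sym X 𝕜) :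
    ∃ g g', psi 𝕜 a σ h ≫ polyHom 𝕜 σ f =
      polyHom 𝕜 σ g ≫ psi 𝕜 a σ h + polyHom 𝕜 σ g' := by
  induction f using SymmetricAlgebra.induction with
  | algebraMap r =>
    refine ⟨algebraMap 𝕜 _ r, 0, ?_⟩
    have e : polyHom 𝕜 σ 0 = 0 := (poly 𝕜 σ).map_zero
    rw [polyHom_algebraMap, Linear.comp_smul, Linear.smul_comp, Category.comp_id,
      Category.id_comp, e, add_zero]
  | ι μ =>
    -- The defining relation is applied to `s_a μ`, so that the factor behind `psi` is `μ`.
    have e := polyHom_comp_psi a h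
      (((D.roots.reflection a : X ≃ₗ[ℤ] X) : X →ₗ[ℤ] X).baseChange 𝕜 μ)
    rw [actS_reflection_ι] at e
    refine ⟨SymmetricAlgebra.ι 𝕜 _
      (((D.roots.reflection a : X ≃ₗ[ℤ] X) : X →ₗ[ℤ] X).baseChange 𝕜 μ),
      -D.demazure 𝕜 a (SymmetricAlgebra.ι 𝕜 _ (((D.roots.reflection a : X ≃ₗ[ℤ] X) : X →ₗ[ℤ] X).baseChange 𝕜 μ)), ?_⟩
    have e2 : ∀ f, polyHom 𝕜 σ (-f) = -polyHom 𝕜 σ f := (poly 𝕜 σ).map_neg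
    rw [e2, ← e, neg_sub, add_sub_cancel]
  | mul f g hf hg =>
    obtain ⟨f1, f2, hf⟩ := hf
    obtain ⟨g1, g2, hg⟩ := hg
    refine ⟨f1 * g1, f1 * g2 + f2 * g, ?_⟩
    rw [polyHom_mul, ← Category.assoc, hf, Preadditive.add_comp, Category.assoc, hg,
      Preadditive.comp_add, polyHom_mul, polyHom_add, polyHom_mul, polyHom_mul, Category.assoc,
      add_assoc]
  | add f g hf hg =>
    obtain ⟨f1, f2, hf⟩ := hf
    obtain ⟨g1, g2, hg⟩ := hg
    refine ⟨f1 + g1, f2 + g2, ?_⟩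
    rw [polyHom_add, Preadditive.comp_add, hf, hg, polyHom_add, polyHom_add,
      Preadditive.add_comp]
    abel

lemma psi_braid (a b : D.base.support) (ha : D.Stable Φ a σ.sgn) (hb : D.Stable Φ b σ.sgn) :
    altWord (M := End (ob 𝕜 σ)) (psi 𝕜 a σ ha) (psi 𝕜 b σ hb) (D.coxeterM a b) =
      altWord (M := End (ob 𝕜 σ)) (psi 𝕜 b σ hb) (psi 𝕜 a σ ha) (D.coxeterM a b) :=
  (map_altProd (CategoryTheory.Quotient.functor (Rel D Φ 𝕜)) (c := fob 𝕜 σ) _ _ _).symm.trans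
    ((sound (.coxeter a b σ ha hb)).trans
      (map_altProd (CategoryTheory.Quotient.functor (Rel D Φ 𝕜)) (c := fob 𝕜 σ) _ _ _))

variable (D Φ 𝕜) in
/-- The generating morphisms of `A_{I'}`. -/
def catSys : Sys D Φ (Sym X 𝕜) (D.CatA Φ 𝕜) where
  ob := ob 𝕜
  P := polyHom 𝕜
  wall := wall 𝕜
  psi := psi 𝕜
  P_one _ := polyHom_one
  P_mul _ := polyHom_mul
  P_add _ := polyHom_add
  wall_self σ := by
    refine (sound (.wall_self σ)).trans ?_
    rfl
  wall_wall σ σ' σ'' h := by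
    have e : tripleProd 𝕜 σ σ' σ'' = 1 := by
      rw [tripleProd, weightProd]
      refine Finset.prod_eq_one fun i hi => ?_
      rw [Set.Finite.mem_toFinset] at hi
      exact absurd (h i hi.1) hi.2
    rw [wall_comp_wall, e, polyHom_one, Category.comp_id]
  wall_wall' σ σ' σ'' := ⟨_, (wall_comp_wall σ σ' σ'').trans (wall_comp_polyHom _ _ _)⟩
  wall_P := wall_comp_polyHom
  psi_psi a σ h := psi_comp_psi a h
  psi_P a σ h := exists_psi_comp_polyHom a h
  braid a b σ := psi_braid a b
  mixed a j y hy ρ τ σ σ' hρ hτ hσ hσ' hρ_pos hτ_neg hopp sρ sτ := by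
    have e := sound (.mixed (𝕜 := 𝕜) a j y hy ρ τ σ σ' hρ hτ hσ hσ' hρ_pos hτ_neg hopp sρ sτ)
    rw [Functor.map_sub, Functor.map_comp, Functor.map_comp, Functor.map_comp, Functor.map_comp,
      Functor.map_comp] at e
    refine ⟨-D.demazure 𝕜 a (D.weightProd 𝕜 fun i =>
      D.matterVal i y = 0 ∧ σ.sgn i = false ∧ σ'.sgn i = false), e.trans ?_⟩
    have e2 : ∀ f, polyHom 𝕜 σ (-f) = -polyHom 𝕜 σ f := (poly 𝕜 σ).map_neg
    rw [e2, Preadditive.neg_comp, ← sub_eq_add_neg, ← wall_comp_polyHom]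
    rfl

lemma catSys_E (l : List (D.Turn Φ)) :
    (D.catSys 𝕜 Φ).E σ σ' l = foldedWall 𝕜 σ σ' l := by
  induction l generalizing σ' with
  | nil => rfl
  | cons t l ih =>
    rw [Sys.E_cons, foldedWall, ih]
    rfl

variable (𝕜) in
/-- The composite of a path of generators. -/
def pathHom {σ' σ : D.Vertex Φ 𝕜} (p : Quiver.Path σ' σ) : ob 𝕜 σ' ⟶ ob 𝕜 σ :=
  (CategoryTheory.Quotient.functor (Rel D Φ 𝕜)).map
    (freeHom 𝕜 (C := Paths (D.Vertex Φ 𝕜)) (A := σ') (B := σ) p)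

lemma pathHom_cons {σ' τ σ : D.Vertex Φ 𝕜} (p : Quiver.Path σ' τ) (g : D.Gen Φ 𝕜 τ σ) :
    pathHom 𝕜 (p.cons g) =
      pathHom 𝕜 p ≫ (CategoryTheory.Quotient.functor (Rel D Φ 𝕜)).map (fgen 𝕜 g) :=
  (congrArg (CategoryTheory.Quotient.functor (Rel D Φ 𝕜)).map
    (freeHom_comp 𝕜 (C := Paths (D.Vertex Φ 𝕜)) (A := σ') (B := τ) (B' := σ) p
      (Quiver.Hom.toPath g))).trans (Functor.map_comp _ _ _)

lemma comp_fgen_mem {x : ob 𝕜 σ' ⟶ ob 𝕜 τ} (hx : x ∈ (D.catSys 𝕜 Φ).total σ' τ)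
    (g : D.Gen Φ 𝕜 τ σ) :
    x ≫ (CategoryTheory.Quotient.functor (Rel D Φ 𝕜)).map (fgen 𝕜 g) ∈
      (D.catSys 𝕜 Φ).total σ' σ := by
  obtain ⟨n, hx⟩ := hx
  cases g with
  | poly _ f => exact ⟨n, Sys.F_comp_P (A := D.catSys 𝕜 Φ) f hx⟩
  | wall _ _ => exact ⟨n, Sys.F_comp_wall (A := D.catSys 𝕜 Φ) hx⟩
  | psi a _ h => exact ⟨n + 1, Sys.F_comp_psi (A := D.catSys 𝕜 Φ) a h hx⟩

lemma pathHom_mem {σ' σ : D.Vertex Φ 𝕜} (p : Quiver.Path σ' σ) :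
    pathHom 𝕜 p ∈ (D.catSys 𝕜 Φ).total σ' σ := by
  induction p with
  | nil =>
    have e : pathHom 𝕜 (Quiver.Path.nil : Quiver.Path σ' σ') = 𝟙 (ob 𝕜 σ') := rfl
    rw [e]
    exact ⟨_, Sys.id_mem_F⟩
  | cons p g ih =>
    rw [pathHom_cons]
    exact comp_fgen_mem ih g

/-- The products attached to lists of turns span the morphisms. -/
lemma mem_total (x : ob 𝕜 σ' ⟶ ob 𝕜 σ) : x ∈ (D.catSys 𝕜 Φ).total σ' σ := by
  obtain ⟨x, rfl⟩ := (CategoryTheory.Quotient.functor (Rel D Φ 𝕜)).map_surjective x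
  refine free_induction 𝕜 (C := Paths (D.Vertex Φ 𝕜)) (A := σ') (B := σ)
    (p := fun x => (CategoryTheory.Quotient.functor (Rel D Φ 𝕜)).map x ∈
      (D.catSys 𝕜 Φ).total σ' σ) ?_ (fun f g hf hg => ?_) (fun r f => ?_) x
  · rw [Functor.map_zero]
    exact zero_mem _
  · rw [Functor.map_add]
    exact add_mem hf hg
  -- Scalars are absorbed into the action of `S` on the source, since the spans are only additive
  -- subgroups closed under that action.
  · have h : r • pathHom 𝕜 f = polyHom 𝕜 σ' (algebraMap 𝕜 _ r) ≫ pathHom 𝕜 f := by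
      rw [polyHom_algebraMap, Linear.smul_comp, Category.id_comp]
    obtain ⟨n, hn⟩ := pathHom_mem f
    refine ⟨n, ?_⟩
    have := Sys.F_P_comp (A := D.catSys 𝕜 Φ) (algebraMap 𝕜 _ r) hn
    rw [Functor.map_smul]
    exact h ▸ this

end CategorySystem

end Steinberg.GaugeData
end

/-! ### The basis theorem -/

theorem mainTheorem6 {R X Y ι κ 𝕜 : Type*} [Finite R] [Finite ι] [Finite κ]
    [AddCommGroup X] [Module.Finite ℤ X] [AddCommGroup Y] [Module.Finite ℤ Y] [Field 𝕜]
    (D : Steinberg.GaugeData R X Y ι κ) (Φ : Set (κ → ℝ))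
    (hΦ : Φ = Set.univ ∨ ∃ n : κ → ℤ, Φ = {fun c => (n c : ℝ)})
    (hε : D.Generic Φ)
    (hroot : ∀ a ∈ D.base.support, Steinberg.GaugeData.charS 𝕜 (D.roots.root a) ≠ 0)
    (σ' σ : D.Obj Φ) :
    (∀ w : D.roots.weylGroup, ∃ l, Steinberg.GaugeData.IsFolding σ' σ w l) ∧
    ∀ l : D.roots.weylGroup → List (D.Turn Φ),
      (∀ w, Steinberg.GaugeData.IsFolding σ' σ w (l w)) →
      ∃ B : Module.Basis D.roots.weylGroup (Steinberg.GaugeData.Sym X 𝕜)ᵐᵒᵖ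
          (Steinberg.GaugeData.ob 𝕜 σ' ⟶ Steinberg.GaugeData.ob 𝕜 σ),
        ∀ w, B w = Steinberg.GaugeData.foldedWall 𝕜 σ σ' (l w) := by
  refine ⟨Steinberg.GaugeData.exists_isFolding hΦ σ' σ, fun l hl => ?_⟩
  have := D.isDomain_extSym
  have := Fintype.ofFinite D.roots.weylGroup
  obtain ⟨n, hn, γ, hp⟩ := σ.feasible
  -- Each folding comes with its own point of the chamber of `σ`; goodness depends only on the
  -- chamber, so one point serves for all `w`.
  have hgood : ∀ w, Steinberg.GaugeData.Good σ σ'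
      (D.weylAct w (γ, fun c => (n c : ℝ))) (l w) := by
    intro w
    obtain ⟨z, hz, h⟩ := (hl w).good hΦ
    exact h.congr hn (Steinberg.GaugeData.val_weylAct_mul_pos hz hp)
  have hval : ∀ (f : Steinberg.GaugeData.Sym X 𝕜) w,
      MulOpposite.op f • Steinberg.GaugeData.foldedWall 𝕜 σ σ' (l w) =
        Steinberg.GaugeData.polyHom 𝕜 σ' f ≫ Steinberg.GaugeData.foldedWall 𝕜 σ σ' (l w) :=
    fun f w => Steinberg.GaugeData.op_smul_eq 𝕜 f _
  have hli : LinearIndependent (Steinberg.GaugeData.Sym X 𝕜)ᵐᵒᵖ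
      fun w => Steinberg.GaugeData.foldedWall 𝕜 σ σ' (l w) := by
    refine Fintype.linearIndependent_iff.2 fun g hg w => ?_
    have h := Steinberg.GaugeData.foldedWall_independent hroot hΦ hε hp hgood
      (fun w => (g w).unop) hg
    exact MulOpposite.unop_injective (congrFun h w)
  refine ⟨Module.Basis.mk hli fun x _ => ?_, fun w => Module.Basis.mk_apply _ _ _⟩
  obtain ⟨m, hx⟩ := Steinberg.GaugeData.mem_total x
  obtain ⟨g, rfl⟩ := Steinberg.GaugeData.Sys.exists_expansion hΦ hε (fun _ => hp) hgood m hx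
  refine sum_mem fun w _ => ?_
  rw [Steinberg.GaugeData.catSys_E]
  refine (hval (g w) w).symm ▸ Submodule.smul_mem _ _ (Submodule.subset_span ⟨w, rfl⟩)
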